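/- **Theorem (control on vertical strips).** Let $L>0$, let $\Omega_y$ be $(0,\pi)$, $\mathbb S^1=\mathbb R/2\pi\mathbb Z$ or $\mathbb R$, and let $\Omega=(-L,L)\times\Omega_y$. Let $\gamma\ge 1$ be an integer and let $q\in C^\infty([-L,L])$ satisfy $q^{(k)}(0)=0$ for $0\le k\le\gamma-1$, $q^{(\gamma)}(0)>0$, and $q(x)\ne0$ for every $x\ne0$. Let $r\in C^\infty(\Omega_y)$ with $r>0$, and $r\equiv1$ if $\Omega_y=\mathbb R$. Let $V\in L^\infty(-L,L)$ be a function of $x$ alone. All functions are real-valued. Let $G_V=-\partial_x^2-q(x)^2\partial_y(r(y)^2\partial_y)+V(x)$ be the Friedrichs extension on $L^2(\Omega)$ of this operator defined on $C_c^\infty(\Omega)$. Its form domain $D(G_V^{1/2})\subset L^2(\Omega)$ is the completion of $C_c^\infty(\Omega)$ for the norm with square $\int_\Omega |\partial_xf|^2+q^2r^2|\partial_yf|^2+(V+c)|f|^2\,dx\,dy$, where $c$ is a sufficiently large constant; it does not depend on $c$ (nor on $V$). Let $\tilde\omega=\tilde\omega_x\times\Omega_y$, where $\tilde\omega_x\subset(-L,L)$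 is a nonempty measurable set with $\operatorname{dist}(\tilde\omega_x,0)>0$. For $T>0$ consider the control system $$\partial_tf-\partial_x^2f-q(x)^2\partial_y(r(y)^2\partial_yf)+V(x)f=u\,\mathbf 1_{\tilde\omega}\ \text{ in }(0,T)\times\Omega,\qquad f=0\ \text{ on }(0,T)\times\partial\Omega,\qquad f(0)=f_0,$$ with $u\in L^2((0,T)\times\tilde\omega)$, whose solution is understood as the weak solution $f\in C^0([0,T],L^2(\Omega))\cap L^2((0,T),D(G_V^{1/2}))$. Say that $f_0$ can be steered to $0$ in time $T$ if for some $u\in L^2((0,T)\times\tilde\omega)$ the solution satisfies $f(T)=0$. Put $$d_{\mathrm{agm}}(x)=\int_{\min(0,x)}^{\max(0,x)}|q(s)|\,ds,\qquad d_{\mathrm{agm}}(\tilde\omega_x)=\inf_{x\in\tilde\omega_x}d_{\mathrm{agm}}(x).$$ (i) If $\gamma=1$, then for every $T>0$ with $T<d_{\mathrm{agm}}(\tilde\omega_x)/q'(0)$ there is $f_0\in D(G_V^{1/2})$ that cannot be steered to $0$ in time $T$. (ii) If $\gamma>1$, then for every $T>0$ there is $f_0\in D(G_V^{1/2})$ that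 cannot be steered to $0$ in time $T$. -/

import Mathlib

open MeasureTheory Set

namespace Grushin

/-- The three possible transversal domains `Ω_y`: the interval `(0, π)`, the circle `𝕊¹ = ℝ / 2πℤ`
and the line `ℝ`. Functions on the circle are represented by `2π`-periodic functions on `ℝ`
(up to null sets: functions on the fundamental domain `[0, 2π)`). -/
inductive YDomain where
  | interval
  | circle
  | line

/-- The points of `Ω_y`, as a subset of `ℝ` (a fundamental domain in the case of the circle). -/
def YDomain.carrier : YDomain → Set ℝ
  | .interval => Ioo 0 Real.pi
  | .circle => Ico 0 (2 * Real.pi)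
  | .line => univ

/-- `Ω = (-L, L) × Ω_y`. -/
def domain (L : ℝ) (Y : YDomain) : Set (ℝ × ℝ) := Ioo (-L) L ×ˢ Y.carrier

/-- The Lebesgue measure `dx dy` on `Ω`. -/
noncomputable def meas (L : ℝ) (Y : YDomain) : Measure (ℝ × ℝ) := volume.restrict (domain L Y)

/-- The real Hilbert space `L²(Ω)`. -/
noncomputable abbrev L2 (L : ℝ) (Y : YDomain) := Lp ℝ 2 (meas L Y)

/-- The assumption on `q`: it is smooth on `[-L, L]`, vanishes at `0` exactly to order `γ`, with
positive `γ`-th derivative there, and has no other zero. -/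
structure IsGrushinCoeff (L : ℝ) (γ : ℕ) (q : ℝ → ℝ) : Prop where
  smooth : ContDiffOn ℝ ((⊤ : ℕ∞) : WithTop ℕ∞) q (Icc (-L) L)
  deriv_zero : ∀ k < γ, iteratedDeriv k q 0 = 0
  deriv_pos : 0 < iteratedDeriv γ q 0
  ne_zero : ∀ x ∈ Icc (-L) L, x ≠ 0 → q x ≠ 0

/-- The assumption on `r`: smooth and positive on `Ω_y`, and identically one if `Ω_y = ℝ`. -/
def IsTransversalCoeff : YDomain → (ℝ → ℝ) → Prop
  | .interval, r => ContDiffOn ℝ ((⊤ : ℕ∞) : WithTop ℕ∞) r (Ioo 0 Real.pi) ∧ ∀ y ∈ Ioo 0 Real.pi, 0 < r y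
  | .circle, r => ContDiff ℝ ((⊤ : ℕ∞) : WithTop ℕ∞) r ∧ Function.Periodic r (2 * Real.pi) ∧ ∀ y, 0 < r y
  | .line, r => ∀ y, r y = 1

/-- The test functions `C_c^∞(Ω)`. On the circle these are the smooth functions that are
`2π`-periodic in `y` and vanish for `x` near `±L`. -/
def IsTest (L : ℝ) : YDomain → (ℝ × ℝ → ℝ) → Prop
  | .interval, φ =>
      ContDiff ℝ ((⊤ : ℕ∞) : WithTop ℕ∞) φ ∧ HasCompactSupport φ ∧ tsupport φ ⊆ Ioo (-L) L ×ˢ Ioo 0 Real.pi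
  | .circle, φ =>
      ContDiff ℝ ((⊤ : ℕ∞) : WithTop ℕ∞) φ ∧ (∀ x y, φ (x, y + 2 * Real.pi) = φ (x, y)) ∧
        ∃ a < L, ∀ x y, a ≤ |x| → φ (x, y) = 0
  | .line, φ =>
      ContDiff ℝ ((⊤ : ℕ∞) : WithTop ℕ∞) φ ∧ HasCompactSupport φ ∧ tsupport φ ⊆ Ioo (-L) L ×ˢ univ

/-- `∂_x φ`. -/
noncomputable def dx (φ : ℝ × ℝ → ℝ) (z : ℝ × ℝ) : ℝ := deriv (fun x => φ (x, z.2)) z.1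

/-- `q(x) r(y) ∂_y φ`. -/
noncomputable def dY (q r : ℝ → ℝ) (φ : ℝ × ℝ → ℝ) (z : ℝ × ℝ) : ℝ :=
  q z.1 * r z.2 * deriv (fun y => φ (z.1, y)) z.2

/-- The closure in `L²(Ω)³` of the set of triples `(φ, ∂_x φ, q r ∂_y φ)` with `φ ∈ C_c^∞(Ω)`. A
triple `(f, g, h)` in it consists of an element `f` of the completion of `C_c^∞(Ω)` for the norm
`(‖φ‖² + ‖∂_x φ‖² + ‖q r ∂_y φ‖²)^{1/2}` and of its weak derivatives `g = ∂_x f`,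
`h = q r ∂_y f`. -/
def formGraph (L : ℝ) (Y : YDomain) (q r : ℝ → ℝ) : Set (L2 L Y × L2 L Y × L2 L Y) :=
  closure {p | ∃ φ, IsTest L Y φ ∧ p.1 =ᵐ[meas L Y] φ ∧ p.2.1 =ᵐ[meas L Y] dx φ ∧
    p.2.2 =ᵐ[meas L Y] dY q r φ}

/-- The form domain `D(G_V^{1/2})` of the Friedrichs extension of
`G_V = -∂_x² - q² ∂_y (r² ∂_y) + V`, as a subset of `L²(Ω)`. For bounded `V`, the form
`∫ |∂_x φ|² + q² r² |∂_y φ|² + V |φ|²`, shifted by a large multiple of `‖φ‖²` so as to be positive,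
defines a norm equivalent to the one in `formGraph`; the form domain does not depend on `V`. -/
def formDomain (L : ℝ) (Y : YDomain) (q r : ℝ → ℝ) : Set (L2 L Y) :=
  {f | ∃ g h, (f, g, h) ∈ formGraph L Y q r}

/-- `f ∈ C⁰([0,T], L²(Ω)) ∩ L²((0,T), D(G_V^{1/2}))` is the (weak) solution of
`∂_t f - ∂_x² f - q² ∂_y (r² ∂_y f) + V(x) f = u 𝟙_W` on `(0,T) × Ω`, with Dirichlet boundary
condition and with `f(0) = f₀`. -/
def IsSolution (L : ℝ) (Y : YDomain) (q r V : ℝ → ℝ) (W : Set (ℝ × ℝ)) (T : ℝ)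
    (f₀ : L2 L Y) (u : ℝ × (ℝ × ℝ) → ℝ) (f : ℝ → L2 L Y) : Prop :=
  ContinuousOn f (Icc 0 T) ∧ f 0 = f₀ ∧
  ∃ g h : ℝ → L2 L Y,
    MemLp g 2 (volume.restrict (Ioo 0 T)) ∧ MemLp h 2 (volume.restrict (Ioo 0 T)) ∧
    (∀ᵐ t ∂volume.restrict (Ioo 0 T), (f t, g t, h t) ∈ formGraph L Y q r) ∧
    ∀ φ, IsTest L Y φ → ∀ t ∈ Icc 0 T,
      (∫ z, f t z * φ z ∂meas L Y) +
        (∫ s in Ioo 0 t, ∫ z, (g s z * dx φ z + h s z * dY q r φ z + V z.1 * f s z * φ z)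
          ∂meas L Y)
      = (∫ z, f₀ z * φ z ∂meas L Y) +
        ∫ s in Ioo 0 t, ∫ z in W, u (s, z) * φ z ∂meas L Y

/-- The initial state `f₀` can be steered to `0` in time `T` by a control in
`L²((0,T) × W)`. -/
def Steerable (L : ℝ) (Y : YDomain) (q r V : ℝ → ℝ) (W : Set (ℝ × ℝ)) (T : ℝ)
    (f₀ : L2 L Y) : Prop :=
  ∃ u : ℝ × (ℝ × ℝ) → ℝ,
    MemLp u 2 ((volume.restrict (Ioo 0 T)).prod ((meas L Y).restrict W)) ∧
    ∃ f : ℝ → L2 L Y, IsSolution L Y q r V W T f₀ u f ∧ f T = 0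

/-- The Agmon distance of `x` to `0`. -/
noncomputable def agmonDist (q : ℝ → ℝ) (x : ℝ) : ℝ := ∫ s in (min 0 x)..(max 0 x), |q s|

/-- The Agmon distance of a nonempty set to `0`. -/
noncomputable def agmonDistSet (q : ℝ → ℝ) (A : Set ℝ) : ℝ := sInf (agmonDist q '' A)

end Grushin

/-! At transversal frequency `μ` the operator becomes `-∂_x² + μ² q² + V`. Near `x = 0` one has `|q
x| ≤ b |x|` for any `b > q'(0)`, so comparison with a harmonic oscillator bounds the lowest energy
by `b μ + O(1)`. A state of almost minimal energy concentrates at `0`, and by Agmon's estimate its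
size on the control region is about `exp (-μ d)`, with `d` the Agmon distance. Over a time `T` such
a state loses only a factor `exp (-b μ T)`, while the control sees it through `exp (-μ d)`; if `b T
< d` the control cannot cancel it. For `γ > 1`, `q'(0) = 0`, so `b` can be as small as desired and
every `T` is too short.

The line has no transversal eigenfunctions, and on the interval `r` may degenerate at the ends.
Eigenfunctions are therefore replaced throughout by quasimodes made of test functions.
`exists_transversal_quasimode` gives arbitrarily precise ones at arbitrarily high energy `ν = μ ^
2`; `exists_longitudinal_quasimode` takes near-minimisers of the form in `x`, localised by
`agmon_estimate`; `abs_form_error_le` shows that their product is a quasimode against the whole form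
graph.

Pairing a trajectory that ends at `0` with such a product `w` and applying Grönwall backwards in
time (`exists_abs_inner_initial_le`) bounds `|⟪f₀, w⟫|` by a constant, depending on the trajectory
and its control, times `(ε + s) exp (Λ T)`. Here `ε` is the precision of `w`, `s` its size on the
control region and `Λ` bounds its energy. If every state of the form domain were steerable, the
uniform boundedness principle would make this constant linear in the graph norm. Inserting `w`
itself then gives `1 ≤ const * μ ^ 3 * exp (-(d - b T) μ)`, with `d` now the decay rate after an
arbitrarily small loss, which is false for large `μ` (`exists_not_steerable_of_quasimodes`). The bad
initial state is thus not constructed. -/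

namespace Grushin

/-! ### Test functions, their slices and tensor products. -/

/-- Lebesgue measure on `(-L, L)`. -/
noncomputable abbrev measX (L : ℝ) : Measure ℝ := volume.restrict (Ioo (-L) L)

/-- Lebesgue measure on `Ω_y`. -/
noncomputable abbrev measY (Y : YDomain) : Measure ℝ := volume.restrict Y.carrier

theorem meas_eq_prod (L : ℝ) (Y : YDomain) : meas L Y = (measX L).prod (measY Y) := by
  rw [meas, domain, Measure.prod_restrict, Measure.volume_eq_prod]

/-- Test functions on `(-L, L)`. -/
structure IsTestX (L : ℝ) (φ : ℝ → ℝ) : Prop where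
  smooth : ContDiff ℝ ((⊤ : ℕ∞) : WithTop ℕ∞) φ
  vanish : ∃ a < L, ∀ x, a ≤ |x| → φ x = 0

/-- Test functions on `Ω_y`. -/
def IsTestY : YDomain → (ℝ → ℝ) → Prop
  | .interval, ψ =>
      ContDiff ℝ ((⊤ : ℕ∞) : WithTop ℕ∞) ψ ∧ HasCompactSupport ψ ∧ tsupport ψ ⊆ Ioo 0 Real.pi
  | .circle, ψ => ContDiff ℝ ((⊤ : ℕ∞) : WithTop ℕ∞) ψ ∧ Function.Periodic ψ (2 * Real.pi)
  | .line, ψ => ContDiff ℝ ((⊤ : ℕ∞) : WithTop ℕ∞) ψ ∧ HasCompactSupport ψ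

namespace IsTestX

variable {L : ℝ} {φ χ : ℝ → ℝ}

theorem tsupport_subset (h : IsTestX L φ) : tsupport φ ⊆ Ioo (-L) L := by
  obtain ⟨a, ha, hv⟩ := h.vanish
  have h1 : tsupport φ ⊆ Icc (-a) a := by
    apply closure_minimal _ isClosed_Icc
    intro x hx
    by_contra hc
    apply hx
    apply hv
    by_contra hlt
    exact hc (abs_le.1 (not_le.1 hlt).le)
  exact h1.trans (fun x hx => ⟨by linarith [hx.1], by linarith [hx.2]⟩)

theorem hasCompactSupport (h : IsTestX L φ) : HasCompactSupport φ :=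
  HasCompactSupport.of_support_subset_isCompact (isCompact_Icc (a := -L) (b := L))
    ((subset_tsupport φ).trans (h.tsupport_subset.trans Ioo_subset_Icc_self))

theorem continuous (h : IsTestX L φ) : Continuous φ := h.smooth.continuous

theorem continuous_deriv (h : IsTestX L φ) : Continuous (deriv φ) :=
  h.smooth.continuous_deriv (by simp)

theorem differentiable (h : IsTestX L φ) : Differentiable ℝ φ :=
  h.smooth.differentiable (by simp)

theorem add (h : IsTestX L φ) (h' : IsTestX L χ) : IsTestX L (φ + χ) := by
  obtain ⟨a, ha, hv⟩ := h.vanish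
  obtain ⟨b, hb, hw⟩ := h'.vanish
  refine ⟨h.smooth.add h'.smooth, max a b, max_lt ha hb, fun x hx => ?_⟩
  simp [hv x (le_trans (le_max_left _ _) hx), hw x (le_trans (le_max_right _ _) hx)]

theorem const_smul (c : ℝ) (h : IsTestX L φ) : IsTestX L (c • φ) := by
  obtain ⟨a, ha, hv⟩ := h.vanish
  exact ⟨h.smooth.const_smul c, a, ha, fun x hx => by simp [hv x hx]⟩

theorem memLp (h : IsTestX L φ) (p : ENNReal) : MemLp φ p (measX L) :=
  (h.continuous.memLp_of_hasCompactSupport h.hasCompactSupport).restrict _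

theorem memLp_deriv (h : IsTestX L φ) (p : ENNReal) : MemLp (deriv φ) p (measX L) :=
  (h.continuous_deriv.memLp_of_hasCompactSupport h.hasCompactSupport.deriv).restrict _

/-- A function that is smooth on `(-L, L)` multiplies test functions. -/
theorem mul_left {m : ℝ → ℝ} (hm : ContDiffOn ℝ ((⊤ : ℕ∞) : WithTop ℕ∞) m (Ioo (-L) L))
    (h : IsTestX L φ) : IsTestX L (fun x => m x * φ x) := by
  refine ⟨contDiff_iff_contDiffAt.2 fun x => ?_, ?_⟩
  · by_cases hx : x ∈ Ioo (-L) L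
    · exact (hm.contDiffAt (isOpen_Ioo.mem_nhds hx)).mul h.smooth.contDiffAt
    · have : (fun x => m x * φ x) =ᶠ[nhds x] fun _ => 0 := by
        have h0 := notMem_tsupport_iff_eventuallyEq.1 (fun hc => hx (h.tsupport_subset hc))
        filter_upwards [h0] with y hy
        simp [hy]
      exact contDiffAt_const.congr_of_eventuallyEq this
  · obtain ⟨a, ha, hv⟩ := h.vanish
    exact ⟨a, ha, fun x hx => by simp [hv x hx]⟩

end IsTestX

theorem IsTestY.smooth {Y : YDomain} {ψ : ℝ → ℝ} (h : IsTestY Y ψ) :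
    ContDiff ℝ ((⊤ : ℕ∞) : WithTop ℕ∞) ψ := by
  cases Y <;> exact h.1

theorem IsTestY.add {Y : YDomain} {ψ χ : ℝ → ℝ} (h : IsTestY Y ψ) (h' : IsTestY Y χ) :
    IsTestY Y (ψ + χ) := by
  refine match Y, h, h' with
  | .interval, h, h' => ⟨h.1.add h'.1, h.2.1.add h'.2.1, (tsupport_add ψ χ).trans ?_⟩
  | .circle, h, h' => ⟨h.1.add h'.1, h.2.add h'.2⟩
  | .line, h, h' => ⟨h.1.add h'.1, h.2.add h'.2⟩
  exact union_subset h.2.2 h'.2.2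

theorem IsTestY.const_smul {Y : YDomain} {ψ : ℝ → ℝ} (c : ℝ) (h : IsTestY Y ψ) :
    IsTestY Y (c • ψ) := by
  have hs : tsupport (c • ψ) ⊆ tsupport ψ := closure_mono (Function.support_const_smul_subset c ψ)
  exact match Y, h with
  | .interval, h => ⟨h.1.const_smul c, h.2.1.mono (Function.support_const_smul_subset c ψ), hs.trans h.2.2⟩
  | .circle, h => ⟨h.1.const_smul c, fun y => by simp [h.2 y]⟩
  | .line, h => ⟨h.1.const_smul c, h.2.mono (Function.support_const_smul_subset c ψ)⟩

theorem IsTest.smooth {L : ℝ} {Y : YDomain} {F : ℝ × ℝ → ℝ} (h : IsTest L Y F) :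
    ContDiff ℝ ((⊤ : ℕ∞) : WithTop ℕ∞) F := by
  cases Y <;> exact h.1

theorem IsTest.add {L : ℝ} {Y : YDomain} {F G : ℝ × ℝ → ℝ} (h : IsTest L Y F) (h' : IsTest L Y G) :
    IsTest L Y (F + G) := by
  refine match Y, h, h' with
  | .interval, h, h' => ⟨h.1.add h'.1, h.2.1.add h'.2.1,
      (tsupport_add F G).trans (union_subset h.2.2 h'.2.2)⟩
  | .circle, h, h' => ⟨h.1.add h'.1, fun x y => by simp [h.2.1 x y, h'.2.1 x y], ?_⟩
  | .line, h, h' => ⟨h.1.add h'.1, h.2.1.add h'.2.1,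
      (tsupport_add F G).trans (union_subset h.2.2 h'.2.2)⟩
  obtain ⟨a, ha, hv⟩ := h.2.2
  obtain ⟨b, hb, hw⟩ := h'.2.2
  refine ⟨max a b, max_lt ha hb, fun x y hx => ?_⟩
  simp [hv x y (le_trans (le_max_left _ _) hx), hw x y (le_trans (le_max_right _ _) hx)]

theorem IsTest.const_smul {L : ℝ} {Y : YDomain} {F : ℝ × ℝ → ℝ} (c : ℝ) (h : IsTest L Y F) :
    IsTest L Y (c • F) := by
  have hs : tsupport (c • F) ⊆ tsupport F := closure_mono (Function.support_const_smul_subset c F)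
  refine match Y, h with
  | .interval, h => ⟨h.1.const_smul c, h.2.1.mono (Function.support_const_smul_subset c F), hs.trans h.2.2⟩
  | .circle, h => ⟨h.1.const_smul c, fun x y => by simp [h.2.1 x y], ?_⟩
  | .line, h => ⟨h.1.const_smul c, h.2.1.mono (Function.support_const_smul_subset c F), hs.trans h.2.2⟩
  obtain ⟨a, ha, hv⟩ := h.2.2
  exact ⟨a, ha, fun x y hx => by simp [hv x y hx]⟩

/-- `|x|` attains a maximum below `L` on the compact support. This gives one margin, uniform in `y`,
for the interval and the line, as the circle has by definition. -/
theorem exists_abs_lt_of_tsupport_subset {L : ℝ} {F : ℝ × ℝ → ℝ} (hL : 0 < L)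
    (hc : HasCompactSupport F) (hs : tsupport F ⊆ Ioo (-L) L ×ˢ univ) :
    ∃ a < L, ∀ x y, a ≤ |x| → F (x, y) = 0 := by
  rcases (tsupport F).eq_empty_or_nonempty with h0 | hne
  · refine ⟨0, hL, fun x y _ => image_eq_zero_of_notMem_tsupport ?_⟩
    simp [h0]
  · obtain ⟨z, hz, hmax⟩ := hc.isCompact.exists_isMaxOn hne
      (f := fun z : ℝ × ℝ => |z.1|) (by fun_prop)
    have hzL : |z.1| < L := abs_lt.2 (hs hz).1
    refine ⟨(|z.1| + L) / 2, by linarith, fun x y hx => image_eq_zero_of_notMem_tsupport fun hm => ?_⟩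
    have : |x| ≤ |z.1| := hmax hm
    linarith

theorem IsTest.slice_x {L : ℝ} {Y : YDomain} {F : ℝ × ℝ → ℝ} (hL : 0 < L) (h : IsTest L Y F)
    (y : ℝ) : IsTestX L (fun x => F (x, y)) := by
  refine ⟨h.smooth.comp (contDiff_id.prodMk contDiff_const), ?_⟩
  have : ∃ a < L, ∀ x y, a ≤ |x| → F (x, y) = 0 :=
    match Y, h with
    | .interval, h => exists_abs_lt_of_tsupport_subset hL h.2.1
        (h.2.2.trans (prod_mono subset_rfl (subset_univ _)))
    | .circle, h => h.2.2
    | .line, h => exists_abs_lt_of_tsupport_subset hL h.2.1 h.2.2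
  obtain ⟨a, ha, hv⟩ := this
  exact ⟨a, ha, fun x hx => hv x y hx⟩

theorem tsupport_slice_subset (F : ℝ × ℝ → ℝ) (x : ℝ) :
    tsupport (fun y => F (x, y)) ⊆ (fun y => (x, y)) ⁻¹' tsupport F :=
  closure_minimal (fun y hy => subset_tsupport F hy)
    ((isClosed_tsupport F).preimage (by fun_prop))

theorem hasCompactSupport_slice {F : ℝ × ℝ → ℝ} (hc : HasCompactSupport F) (x : ℝ) :
    HasCompactSupport (fun y => F (x, y)) :=
  HasCompactSupport.of_support_subset_isCompact (hc.isCompact.image continuous_snd)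
    fun y hy => ⟨(x, y), subset_tsupport F hy, rfl⟩

theorem IsTest.slice_y {L : ℝ} {Y : YDomain} {F : ℝ × ℝ → ℝ} (h : IsTest L Y F) (x : ℝ) :
    IsTestY Y (fun y => F (x, y)) := by
  have hs : ContDiff ℝ ((⊤ : ℕ∞) : WithTop ℕ∞) (fun y => F (x, y)) :=
    h.smooth.comp (contDiff_const.prodMk contDiff_id)
  exact match Y, h with
  | .interval, h => ⟨hs, hasCompactSupport_slice h.2.1 x,
      fun y hy => (h.2.2 (tsupport_slice_subset F x hy)).2⟩
  | .circle, h => ⟨hs, fun y => h.2.1 x y⟩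
  | .line, h => ⟨hs, hasCompactSupport_slice h.2.1 x⟩

/-- The function `φ(x) ψ(y)`. -/
def tensor (φ ψ : ℝ → ℝ) (z : ℝ × ℝ) : ℝ := φ z.1 * ψ z.2

theorem tsupport_tensor_subset (φ ψ : ℝ → ℝ) :
    tsupport (tensor φ ψ) ⊆ tsupport φ ×ˢ tsupport ψ := by
  apply closure_minimal _ ((isClosed_tsupport φ).prod (isClosed_tsupport ψ))
  intro z hz
  exact ⟨subset_tsupport _ (left_ne_zero_of_mul hz), subset_tsupport _ (right_ne_zero_of_mul hz)⟩

theorem hasCompactSupport_tensor {φ ψ : ℝ → ℝ} (h : HasCompactSupport φ)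
    (h' : HasCompactSupport ψ) : HasCompactSupport (tensor φ ψ) :=
  (h.isCompact.prod h'.isCompact).of_isClosed_subset (isClosed_tsupport _)
    (tsupport_tensor_subset φ ψ)

theorem IsTestX.tensor {L : ℝ} {Y : YDomain} {φ ψ : ℝ → ℝ} (hφ : IsTestX L φ)
    (hψ : IsTestY Y ψ) : IsTest L Y (tensor φ ψ) := by
  have hs : ContDiff ℝ ((⊤ : ℕ∞) : WithTop ℕ∞) (Grushin.tensor φ ψ) :=
    (hφ.smooth.comp contDiff_fst).mul (hψ.smooth.comp contDiff_snd)
  refine match Y, hψ with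
  | .interval, h => ⟨hs, hasCompactSupport_tensor hφ.hasCompactSupport h.2.1,
      (tsupport_tensor_subset φ ψ).trans (prod_mono hφ.tsupport_subset h.2.2)⟩
  | .circle, h => ⟨hs, fun x y => ?_, ?_⟩
  | .line, h => ⟨hs, hasCompactSupport_tensor hφ.hasCompactSupport h.2,
      (tsupport_tensor_subset φ ψ).trans (prod_mono hφ.tsupport_subset (subset_univ _))⟩
  · simp only [Grushin.tensor]; rw [h.2 y]
  · obtain ⟨a, ha, hv⟩ := hφ.vanish
    exact ⟨a, ha, fun x y hx => by simp [Grushin.tensor, hv x hx]⟩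

theorem dx_tensor (φ ψ : ℝ → ℝ) : dx (tensor φ ψ) = tensor (deriv φ) ψ := by
  funext z
  simp [dx, tensor]

theorem dY_tensor (q r φ ψ : ℝ → ℝ) :
    dY q r (tensor φ ψ) = tensor (fun x => q x * φ x) (fun y => r y * deriv ψ y) := by
  funext z
  simp only [dY, tensor, deriv_const_mul_field]
  ring

theorem memLp_tensor {μ ν : Measure ℝ} [SFinite μ] [SFinite ν] {φ ψ : ℝ → ℝ} (hφ : MemLp φ 2 μ)
    (hψ : MemLp ψ 2 ν) : MemLp (tensor φ ψ) 2 (μ.prod ν) := by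
  have hm : AEStronglyMeasurable (tensor φ ψ) (μ.prod ν) :=
    hφ.1.comp_fst.mul hψ.1.comp_snd
  rw [memLp_two_iff_integrable_sq hm]
  refine (hφ.integrable_sq.mul_prod hψ.integrable_sq).congr (Filter.Eventually.of_forall fun z => ?_)
  simp [tensor, mul_pow]

theorem integral_tensor_sq (μ ν : Measure ℝ) [SFinite μ] [SFinite ν] (φ ψ : ℝ → ℝ) :
    ∫ z, tensor φ ψ z ^ 2 ∂(μ.prod ν) = (∫ x, φ x ^ 2 ∂μ) * ∫ y, ψ y ^ 2 ∂ν := by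
  rw [← integral_prod_mul]
  simp [tensor, mul_pow]

theorem memLp_circle_of_continuous {f : ℝ → ℝ} (hf : Continuous f) :
    MemLp f 2 (measY .circle) := by
  obtain ⟨C, hC⟩ := (isCompact_Icc (a := (0 : ℝ)) (b := 2 * Real.pi)).exists_bound_of_continuousOn
    hf.continuousOn
  have : IsFiniteMeasure (measY .circle) :=
    ⟨by rw [Measure.restrict_apply_univ]; exact measure_Ico_lt_top⟩
  refine MemLp.of_bound hf.aestronglyMeasurable C ?_
  refine (ae_restrict_iff' measurableSet_Ico).2 (Filter.Eventually.of_forall fun y hy => ?_)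
  exact hC y (Ico_subset_Icc_self hy)

theorem IsTestY.memLp {Y : YDomain} {ψ : ℝ → ℝ} (h : IsTestY Y ψ) : MemLp ψ 2 (measY Y) :=
  match Y, h with
  | .interval, h => (h.1.continuous.memLp_of_hasCompactSupport h.2.1).restrict _
  | .circle, h => memLp_circle_of_continuous h.1.continuous
  | .line, h => (h.1.continuous.memLp_of_hasCompactSupport h.2).restrict _

theorem IsTestY.memLp_deriv {Y : YDomain} {r ψ : ℝ → ℝ} (hr : IsTransversalCoeff Y r)
    (h : IsTestY Y ψ) : MemLp (fun y => r y * deriv ψ y) 2 (measY Y) :=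
  match Y, hr, h with
  | .interval, hr, h => by
      have hd : Continuous (deriv ψ) := h.1.continuous_deriv (by simp)
      have hs : tsupport (deriv ψ) ⊆ Ioo 0 Real.pi := (tsupport_deriv_subset).trans h.2.2
      refine MemLp.restrict _ (Continuous.memLp_of_hasCompactSupport (continuous_iff_continuousAt.2
        fun y => ?_) (h.2.1.deriv.mul_left))
      -- `r` is controlled only inside the open interval; elsewhere the product vanishes locally
      -- because `deriv ψ` has compact support inside it.
      by_cases hy : y ∈ Ioo 0 Real.pi
      · exact (hr.1.continuousOn.continuousAt (isOpen_Ioo.mem_nhds hy)).mul hd.continuousAt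
      · have : (fun y => r y * deriv ψ y) =ᶠ[nhds y] fun _ => 0 := by
          filter_upwards [notMem_tsupport_iff_eventuallyEq.1 (fun hc => hy (hs hc))] with x hx
          simp [hx]
        exact continuousAt_const.congr this.symm
  | .circle, hr, h => memLp_circle_of_continuous
      (hr.1.continuous.mul (h.1.continuous_deriv (by simp)))
  | .line, hr, h => by
      have hr1 : r = fun _ => 1 := funext hr
      simp only [hr1, one_mul]
      exact ((h.1.continuous_deriv (by simp)).memLp_of_hasCompactSupport h.2.deriv).restrict _

/-! ### Approximate spectrum of symmetric operators. -/

theorem sq_le_mul_of_quadratic_nonneg {a b c : ℝ} (h : ∀ t : ℝ, 0 ≤ a + 2 * t * b + t ^ 2 * c) :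
    b ^ 2 ≤ a * c := by
  -- A nonnegative quadratic has nonpositive discriminant: this is Cauchy–Schwarz for semidefinite
  -- forms that are not given as inner products.
  have := discrim_le_zero (a := c) (b := 2 * b) (c := a) (fun t => by nlinarith [h t])
  rw [discrim] at this
  nlinarith

open scoped RealInnerProductSpace

/-- If `C` is bounded and symmetric and `‖C k‖² < δ ⟪C k, k⟫` for some `k`, then `C` has
approximate spectrum in `(0, δ)`. -/
theorem exists_approx_eigenvalue {K : Type*} [NormedAddCommGroup K] [InnerProductSpace ℝ K]
    (C : K →L[ℝ] K) (hC : ∀ x y, ⟪C x, y⟫ = ⟪x, C y⟫) {δ : ℝ} (hδ : 0 < δ) (k₀ : K)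
    (hk₀ : ‖C k₀‖ ^ 2 < δ * ⟪C k₀, k₀⟫) :
    ∃ β, 0 < β ∧ β < δ ∧ ∀ ε > 0, ∃ k, k ≠ 0 ∧ ‖C k - β • k‖ ≤ ε * ‖k‖ := by
  have hk0 : k₀ ≠ 0 := by
    rintro rfl
    simp at hk₀
  -- After centring at the middle of `(0, δ)` the hypothesis on `k₀` reads `‖B k₀‖ < (δ / 2) ‖k₀‖`.
  -- Hence the bottom `m` of `B²` is below `(δ / 2) ^ 2`, and one of `δ / 2 ± √m` must be
  -- approximate spectrum of `C`.
  set B : K →L[ℝ] K := C - (δ / 2) • ContinuousLinearMap.id ℝ K with hB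
  have hBx : ∀ x, B x = C x - (δ / 2) • x := fun x => by simp [hB]
  have hBs : ∀ x y, ⟪B x, y⟫ = ⟪x, B y⟫ := fun x y => by
    simp [hBx, inner_sub_left, inner_sub_right, hC, inner_smul_left, inner_smul_right]
  set A : Set ℝ := {t | ∃ x : K, x ≠ 0 ∧ t = ‖B x‖ ^ 2 / ‖x‖ ^ 2} with hA
  have hAb : BddBelow A := ⟨0, by rintro t ⟨x, -, rfl⟩; positivity⟩
  have hAne : A.Nonempty := ⟨_, k₀, hk0, rfl⟩
  set m := sInf A with hm
  have hm0 : 0 ≤ m := le_csInf hAne (by rintro t ⟨x, -, rfl⟩; positivity)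
  have hmlt : m < (δ / 2) ^ 2 := by
    refine lt_of_le_of_lt (csInf_le hAb ⟨k₀, hk0, rfl⟩) ?_
    have hn : 0 < ‖k₀‖ ^ 2 := by positivity
    rw [div_lt_iff₀ hn, hBx, norm_sub_sq_real, inner_smul_right, norm_smul, mul_pow]
    simp only [Real.norm_eq_abs, sq_abs]
    nlinarith
  have hmle : ∀ x, m * ‖x‖ ^ 2 ≤ ‖B x‖ ^ 2 := by
    intro x
    by_cases hx : x = 0
    · simp [hx]
    · have hn : 0 < ‖x‖ ^ 2 := by positivity
      rw [← le_div_iff₀ hn]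
      exact csInf_le hAb ⟨x, hx, rfl⟩
  have hsq : √m < δ / 2 := by
    rw [Real.sqrt_lt' (by positivity)]; exact hmlt
  by_contra hcon
  push Not at hcon
  obtain ⟨ε₁, hε₁, h1⟩ := hcon (δ / 2 - √m) (by linarith) (by linarith [Real.sqrt_nonneg m])
  obtain ⟨ε₂, hε₂, h2⟩ := hcon (δ / 2 + √m) (by linarith [Real.sqrt_nonneg m]) (by linarith)
  have h1' : ∀ x, ε₁ * ‖x‖ ≤ ‖B x + √m • x‖ := by
    intro x
    by_cases hx : x = 0
    · simp [hx]
    · refine (h1 x hx).le.trans_eq ?_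
      rw [hBx]; congr 1; module
  have h2' : ∀ x, ε₂ * ‖x‖ ≤ ‖B x - √m • x‖ := by
    intro x
    by_cases hx : x = 0
    · simp [hx]
    · refine (h2 x hx).le.trans_eq ?_
      rw [hBx]; congr 1; module
  -- If both points were excluded, `B² - m = (B - √m)(B + √m)` would be bounded below by `ε₁ ε₂`;
  -- `η` is so small that a vector with Rayleigh quotient below `m + η` contradicts this.
  set η := (ε₁ * ε₂) ^ 2 / (2 * (‖B‖ ^ 2 + 1)) with hη
  have hηpos : 0 < η := by positivity
  obtain ⟨t, ⟨x, hx, rfl⟩, hxlt⟩ := exists_lt_of_csInf_lt hAne (show sInf A < m + η by linarith)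
  have hn : 0 < ‖x‖ ^ 2 := by positivity
  rw [div_lt_iff₀ hn] at hxlt
  set z := B x + √m • x with hz
  set y := B z - √m • z with hy
  have hyx : y = B (B x) - m • x := by
    have hmm : √m * √m = m := Real.mul_self_sqrt hm0
    rw [hy, hz, map_add, map_smul]
    conv_rhs => rw [← hmm]
    module
  have hlow : ε₁ * ε₂ * ‖x‖ ≤ ‖y‖ := by
    calc ε₁ * ε₂ * ‖x‖ = ε₂ * (ε₁ * ‖x‖) := by ring
      _ ≤ ε₂ * ‖z‖ := by gcongr; exact h1' x
      _ ≤ ‖y‖ := h2' z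
  have hxy : ⟪B x, B y⟫ - m * ⟪x, y⟫ = ‖y‖ ^ 2 := by
    rw [← real_inner_self_eq_norm_sq y]
    nth_rewrite 3 [hyx]
    rw [inner_sub_left, inner_smul_left, hBs (B x) y]
    simp
  -- Cauchy–Schwarz for the nonnegative form of `B² - m`, between `x` and `y = (B² - m) x`; the
  -- cross term is `‖y‖ ^ 2`.
  have hcs : (‖y‖ ^ 2) ^ 2 ≤ (‖B x‖ ^ 2 - m * ‖x‖ ^ 2) * (‖B y‖ ^ 2 - m * ‖y‖ ^ 2) := by
    apply sq_le_mul_of_quadratic_nonneg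
    intro t
    have := hmle (x + t • y)
    rw [map_add, map_smul, norm_add_sq_real, norm_add_sq_real, norm_smul, norm_smul,
      inner_smul_right, inner_smul_right, mul_pow, mul_pow] at this
    simp only [Real.norm_eq_abs, sq_abs] at this
    have hty : 2 * t * ‖y‖ ^ 2 = 2 * t * (⟪B x, B y⟫ - m * ⟪x, y⟫) := by rw [hxy]
    linarith
  have hBy : ‖B y‖ ^ 2 ≤ ‖B‖ ^ 2 * ‖y‖ ^ 2 := by
    rw [← mul_pow]; gcongr; exact B.le_opNorm y
  have hypos : 0 < ‖y‖ ^ 2 := by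
    have : 0 < ‖y‖ := lt_of_lt_of_le (by positivity) hlow
    positivity
  have hup : (‖y‖ ^ 2) ^ 2 ≤ (η * ‖x‖ ^ 2) * (‖B‖ ^ 2 * ‖y‖ ^ 2) := by
    refine hcs.trans ?_
    have h3 := hmle x
    have h4 : 0 ≤ m * ‖y‖ ^ 2 := by positivity
    gcongr <;> linarith [hmle y]
  have hup' : ‖y‖ ^ 2 ≤ η * ‖x‖ ^ 2 * ‖B‖ ^ 2 := by
    have : ‖y‖ ^ 2 * ‖y‖ ^ 2 ≤ (η * ‖x‖ ^ 2 * ‖B‖ ^ 2) * ‖y‖ ^ 2 := by nlinarith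
    exact le_of_mul_le_mul_right this hypos
  have hlow' : (ε₁ * ε₂) ^ 2 * ‖x‖ ^ 2 ≤ ‖y‖ ^ 2 := by
    rw [← mul_pow]; gcongr
  have hfin : η * ‖B‖ ^ 2 < (ε₁ * ε₂) ^ 2 := by
    rw [hη, div_mul_eq_mul_div, div_lt_iff₀ (by positivity)]
    have : 0 < (ε₁ * ε₂) ^ 2 := by positivity
    nlinarith [sq_nonneg ‖B‖]
  nlinarith

theorem inner_eq_integral {α : Type*} [MeasurableSpace α] {μ : Measure α} {a b : Lp ℝ 2 μ}
    {f g : α → ℝ} (ha : a =ᵐ[μ] f) (hb : b =ᵐ[μ] g) : ⟪a, b⟫ = ∫ x, f x * g x ∂μ := by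
  rw [L2.inner_def]
  refine integral_congr_ae ?_
  filter_upwards [ha, hb] with x h1 h2
  simp [h1, h2, mul_comm]

theorem norm_sq_eq_integral {α : Type*} [MeasurableSpace α] {μ : Measure α} {a : Lp ℝ 2 μ}
    {f : α → ℝ} (ha : a =ᵐ[μ] f) : ‖a‖ ^ 2 = ∫ x, f x ^ 2 ∂μ := by
  rw [← real_inner_self_eq_norm_sq, inner_eq_integral ha ha]
  simp [sq]

/-! ### High-energy quasimodes of the transversal operator. -/

/-- The pairs `(ψ, r ψ')`, `ψ` a test function on `Ω_y`, in `L²(Ω_y) ⊕ L²(Ω_y)`. -/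
def transversalGraph (Y : YDomain) (r : ℝ → ℝ) :
    Submodule ℝ (WithLp 2 (Lp ℝ 2 (measY Y) × Lp ℝ 2 (measY Y))) where
  carrier := {p | ∃ ψ, IsTestY Y ψ ∧ p.fst =ᵐ[measY Y] ψ ∧
    p.snd =ᵐ[measY Y] fun y => r y * deriv ψ y}
  add_mem' := by
    rintro p p' ⟨ψ, hψ, h1, h2⟩ ⟨χ, hχ, h3, h4⟩
    refine ⟨ψ + χ, hψ.add hχ, ?_, ?_⟩
    · rw [WithLp.add_fst]
      exact (Lp.coeFn_add _ _).trans (h1.add h3)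
    · rw [WithLp.add_snd]
      refine (Lp.coeFn_add _ _).trans ((h2.add h4).trans (Filter.Eventually.of_forall fun y => ?_))
      have hd := deriv_add (hψ.smooth.differentiable (by simp) y)
        (hχ.smooth.differentiable (by simp) y)
      simp only [Pi.add_apply, hd]
      ring
  zero_mem' := by
    refine ⟨0, ?_, ?_, ?_⟩
    · have h0 : HasCompactSupport (0 : ℝ → ℝ) := HasCompactSupport.zero
      cases Y
      · exact ⟨contDiff_const, h0, by simp⟩
      · exact ⟨contDiff_const, fun y => rfl⟩
      · exact ⟨contDiff_const, h0⟩
    · exact Lp.coeFn_zero _ _ _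
    · refine (Lp.coeFn_zero _ _ _).trans (Filter.Eventually.of_forall fun y => ?_)
      simp
  smul_mem' := by
    rintro c p ⟨ψ, hψ, h1, h2⟩
    refine ⟨c • ψ, hψ.const_smul c, ?_, ?_⟩
    · rw [WithLp.smul_fst]
      exact (Lp.coeFn_smul _ _).trans (h1.const_smul c)
    · rw [WithLp.smul_snd]
      refine (Lp.coeFn_smul _ _).trans ((h2.const_smul c).trans
        (Filter.Eventually.of_forall fun y => ?_))
      have hd := deriv_const_smul c (hψ.smooth.differentiable (by simp) y)
      simp only [Pi.smul_apply, hd, smul_eq_mul]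
      ring

theorem IsTestY.exists_mem_transversalGraph {Y : YDomain} {r ψ : ℝ → ℝ}
    (hr : IsTransversalCoeff Y r) (hψ : IsTestY Y ψ) :
    ∃ p ∈ transversalGraph Y r, p.fst =ᵐ[measY Y] ψ ∧
      p.snd =ᵐ[measY Y] fun y => r y * deriv ψ y :=
  ⟨WithLp.toLp 2 (hψ.memLp.toLp ψ, (hψ.memLp_deriv hr).toLp _),
    ⟨ψ, hψ, hψ.memLp.coeFn_toLp, (hψ.memLp_deriv hr).coeFn_toLp⟩, hψ.memLp.coeFn_toLp,
    (hψ.memLp_deriv hr).coeFn_toLp⟩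

/-- Quasimodes for a closed form `‖J k‖² + ‖J' k‖² = ‖k‖²`, in a dense set `D`. -/
theorem exists_form_quasimode {H K : Type*} [NormedAddCommGroup H] [InnerProductSpace ℝ H]
    [CompleteSpace H] [NormedAddCommGroup K] [InnerProductSpace ℝ K] [CompleteSpace K]
    (J J' : K →L[ℝ] H) (hinner : ∀ k k' : K, ⟪k, k'⟫ = ⟪J k, J k'⟫ + ⟪J' k, J' k'⟫)
    {D : Set K} (hdense : Dense D) {δ : ℝ} (hδ : 0 < δ) (k₀ : K) (e : H)
    (hek : ∀ k ∈ D, ⟪J k₀, J k⟫ = -⟪e, J' k⟫) (hlt : ‖e‖ ^ 2 < δ * ‖J k₀‖ ^ 2) :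
    ∃ β, 0 < β ∧ β < δ ∧ ∀ ε > 0, ∃ k ∈ D, 0 < ‖J k‖ ∧ ∀ k',
      |⟪J' k, J' k'⟫ - (1 / β - 1) * ⟪J k, J k'⟫| ≤ ε * ‖J k‖ * ‖k'‖ := by
  -- `J* J` represents the `H` inner product in the form space, so it acts as the inverse of one
  -- plus the operator: `β` in its spectrum corresponds to the energy `1 / β - 1`, and small `β` to
  -- high energy.
  set C : K →L[ℝ] K := (ContinuousLinearMap.adjoint J).comp J with hC
  have hCi : ∀ x y, ⟪C x, y⟫ = ⟪J x, J y⟫ := fun x y => by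
    simp [hC, ContinuousLinearMap.adjoint_inner_left]
  have hCs : ∀ x y, ⟪C x, y⟫ = ⟪x, C y⟫ := fun x y => by
    rw [hCi, real_inner_comm, real_inner_comm (C y) x, hCi]
  have hek : ∀ k : K, ⟪J k₀, J k⟫ = -⟪e, J' k⟫ := fun k =>
    hdense.induction (P := fun k => ⟪J k₀, J k⟫ = -⟪e, J' k⟫) hek
      (isClosed_eq (by fun_prop) (by fun_prop)) k
  have hJ'le : ∀ k, ‖J' k‖ ≤ ‖k‖ := fun k => by
    have h1 := hinner k k
    rw [real_inner_self_eq_norm_sq, real_inner_self_eq_norm_sq, real_inner_self_eq_norm_sq] at h1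
    exact abs_le_of_sq_le_sq' (by nlinarith [sq_nonneg ‖J k‖]) (norm_nonneg _) |>.2
  -- `J k₀` is a divergence with potential `e`, so its dual norm in the form space is at most `‖e‖`.
  have hCk₀ : ‖C k₀‖ ≤ ‖e‖ := by
    have h1 : ‖C k₀‖ ^ 2 = -⟪e, J' (C k₀)⟫ := by
      rw [← real_inner_self_eq_norm_sq, hCi, hek]
    have h2 : -⟪e, J' (C k₀)⟫ ≤ ‖e‖ * ‖C k₀‖ :=
      (neg_le_abs _).trans ((abs_real_inner_le_norm _ _).trans
        (mul_le_mul_of_nonneg_left (hJ'le _) (norm_nonneg _)))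
    by_contra hlt'
    push Not at hlt'
    nlinarith [norm_nonneg e]
  have hk₀ : ‖C k₀‖ ^ 2 < δ * ⟪C k₀, k₀⟫ := by
    rw [hCi, real_inner_self_eq_norm_sq]
    refine lt_of_le_of_lt ?_ hlt
    gcongr
  obtain ⟨β, hβ, hβδ, happ⟩ := exists_approx_eigenvalue C hCs hδ k₀ hk₀
  refine ⟨β, hβ, hβδ, fun ε hε => ?_⟩
  -- The first bound forces `‖J k‖ ^ 2 ≥ (β / 2) ‖k‖ ^ 2`; the second is the requested precision
  -- once `‖k‖` is replaced by `‖J k‖` and the estimate divided by `β`.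
  set ε₁ := min (β / 2) (ε * β * √(β / 2)) with hε₁
  have hε₁pos : 0 < ε₁ := by positivity
  obtain ⟨k₁, hk₁, hk₁le⟩ := happ (ε₁ / 2) (by positivity)
  obtain ⟨k, hkG, hk0, hkle⟩ : ∃ k : K, k ∈ D ∧ k ≠ 0 ∧
      ‖C k - β • k‖ ≤ ε₁ * ‖k‖ := by
    -- The strict inequality is an open condition, so the approximate eigenvector can be moved into
    -- the dense set; starting from `ε₁ / 2` makes it strict.
    have hopen : IsOpen {k : K | ‖C k - β • k‖ < ε₁ * ‖k‖} := isOpen_lt (by fun_prop) (by fun_prop)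
    obtain ⟨k, hk, hkG⟩ := hdense.inter_open_nonempty _ hopen ⟨k₁, by
      have : 0 < ‖k₁‖ := norm_pos_iff.2 hk₁
      exact lt_of_le_of_lt hk₁le (by nlinarith)⟩
    refine ⟨k, hkG, ?_, le_of_lt hk⟩
    rintro rfl
    simp at hk
  have hkpos : 0 < ‖k‖ := norm_pos_iff.2 hk0
  have hJk : β / 2 * ‖k‖ ^ 2 ≤ ‖J k‖ ^ 2 := by
    have h1 : ⟪C k - β • k, k⟫ = ‖J k‖ ^ 2 - β * ‖k‖ ^ 2 := by
      rw [inner_sub_left, hCi, inner_smul_left, real_inner_self_eq_norm_sq,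
        real_inner_self_eq_norm_sq]; simp
    have h2 : -⟪C k - β • k, k⟫ ≤ (β / 2 * ‖k‖) * ‖k‖ :=
      (neg_le_abs _).trans ((abs_real_inner_le_norm _ _).trans
        (mul_le_mul_of_nonneg_right (hkle.trans
          (mul_le_mul_of_nonneg_right (min_le_left _ _) (norm_nonneg _))) (norm_nonneg _)))
    nlinarith
  have hJkpos : 0 < ‖J k‖ := by
    have : 0 < ‖J k‖ ^ 2 := lt_of_lt_of_le (by positivity) hJk
    exact (sq_pos_iff.1 this).lt_of_le' (norm_nonneg _)
  have hk' : ‖k‖ ≤ ‖J k‖ / √(β / 2) := by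
    rw [le_div_iff₀ (by positivity)]
    apply (abs_le_of_sq_le_sq' _ (norm_nonneg _)).2
    rw [mul_pow, Real.sq_sqrt (by positivity)]
    linarith
  refine ⟨k, hkG, hJkpos, fun k' => ?_⟩
  have e6 : ⟪J' k, J' k'⟫ - (1 / β - 1) * ⟪J k, J k'⟫ = -(β⁻¹ * ⟪C k - β • k, k'⟫) := by
    rw [inner_sub_left, hCi, inner_smul_left, hinner]
    simp only [conj_trivial]
    field_simp
    ring
  rw [e6, abs_neg, abs_mul, abs_of_nonneg (by positivity : 0 ≤ β⁻¹)]
  calc β⁻¹ * |⟪C k - β • k, k'⟫|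
      ≤ β⁻¹ * ((ε * β * √(β / 2)) * (‖J k‖ / √(β / 2)) * ‖k'‖) := by
        gcongr
        refine (abs_real_inner_le_norm _ _).trans ?_
        gcongr
        refine hkle.trans ?_
        gcongr
        exact min_le_right _ _
    _ = ε * ‖J k‖ * ‖k'‖ := by
        have : 0 < √(β / 2) := by positivity
        field_simp

/-- A function `Φ` whose derivative is a test function and that is much smaller than its
derivative yields transversal quasimodes of high energy. -/
theorem exists_transversal_quasimode_of_potential {Y : YDomain} {r : ℝ → ℝ}
    (hr : IsTransversalCoeff Y r) {δ : ℝ} (hδ : 0 < δ) {Φ : ℝ → ℝ} (hΦ : IsTestY Y (deriv Φ))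
    (hΦr : MemLp (fun y => Φ y / r y) 2 (measY Y))
    (hparts : ∀ χ, IsTestY Y χ → ∫ y, deriv Φ y * χ y ∂measY Y =
      -∫ y, (Φ y / r y) * (r y * deriv χ y) ∂measY Y)
    (hlt : ∫ y, (Φ y / r y) ^ 2 ∂measY Y < δ * ∫ y, deriv Φ y ^ 2 ∂measY Y) :
    ∃ β, 0 < β ∧ β < δ ∧ ∀ ε > 0, ∃ ψ, IsTestY Y ψ ∧ ∫ y, ψ y ^ 2 ∂measY Y = 1 ∧
      ∀ χ, IsTestY Y χ →
        (∫ y, (r y * deriv ψ y) * (r y * deriv χ y) ∂measY Y - (1 / β - 1) * ∫ y, ψ y * χ y ∂measY Y) ^ 2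
          ≤ ε ^ 2 * (∫ y, χ y ^ 2 ∂measY Y + ∫ y, (r y * deriv χ y) ^ 2 ∂measY Y) := by
  set G := transversalGraph Y r with hG
  set H := Lp ℝ 2 (measY Y)
  -- Working in the closed graph itself avoids closability: the second component need not be
  -- determined by the first.
  set K := G.topologicalClosure
  have : CompleteSpace K := G.isClosed_topologicalClosure.completeSpace_coe
  set J : K →L[ℝ] H := (WithLp.fstL 2 ℝ H H).comp K.subtypeL with hJ
  set J' : K →L[ℝ] H := (WithLp.sndL 2 ℝ H H).comp K.subtypeL with hJ'
  have hinner : ∀ k k' : K, ⟪k, k'⟫ = ⟪J k, J k'⟫ + ⟪J' k, J' k'⟫ := fun k k' => by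
    rw [Submodule.coe_inner, WithLp.prod_inner_apply]; rfl
  have hdense : Dense {k : K | (k : WithLp 2 (H × H)) ∈ G} := by
    intro k
    rw [closure_subtype]
    have : Subtype.val '' {k : K | (k : WithLp 2 (H × H)) ∈ G} = (G : Set (WithLp 2 (H × H))) := by
      ext x
      constructor
      · rintro ⟨k, hk, rfl⟩; exact hk
      · intro hx; exact ⟨⟨x, G.le_topologicalClosure hx⟩, hx, rfl⟩
    rw [this]
    exact k.2
  obtain ⟨p₀, hp₀, hp1, hp2⟩ := hΦ.exists_mem_transversalGraph hr
  set k₀ : K := ⟨p₀, G.le_topologicalClosure hp₀⟩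
  set e : H := hΦr.toLp _ with he
  have hek : ∀ k : K, (k : WithLp 2 (H × H)) ∈ G → ⟪J k₀, J k⟫ = -⟪e, J' k⟫ := by
    rintro k ⟨χ, hχ, h1, h2⟩
    have e1 : ⟪J k₀, J k⟫ = ∫ y, deriv Φ y * χ y ∂measY Y := inner_eq_integral hp1 h1
    have e2 : ⟪e, J' k⟫ = ∫ y, (Φ y / r y) * (r y * deriv χ y) ∂measY Y :=
      inner_eq_integral hΦr.coeFn_toLp h2
    rw [e1, e2, hparts χ hχ]
  have hJk₀ : ‖J k₀‖ ^ 2 = ∫ y, deriv Φ y ^ 2 ∂measY Y := norm_sq_eq_integral hp1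
  have he2 : ‖e‖ ^ 2 = ∫ y, (Φ y / r y) ^ 2 ∂measY Y := norm_sq_eq_integral hΦr.coeFn_toLp
  rw [← hJk₀, ← he2] at hlt
  obtain ⟨β, hβ, hβδ, happ⟩ := exists_form_quasimode J J' hinner hdense hδ k₀ e hek hlt
  refine ⟨β, hβ, hβδ, fun ε hε => ?_⟩
  obtain ⟨k, hkG, hJkpos, hk⟩ := happ ε hε
  obtain ⟨ψ, hψ, h1, h2⟩ := hkG
  have hψn : ‖J k‖ ^ 2 = ∫ y, ψ y ^ 2 ∂measY Y := norm_sq_eq_integral h1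
  refine ⟨‖J k‖⁻¹ • ψ, hψ.const_smul _, ?_, fun χ hχ => ?_⟩
  · simp only [Pi.smul_apply, smul_eq_mul, mul_pow, integral_const_mul, ← hψn]
    field_simp
  obtain ⟨p, hp, h3, h4⟩ := hχ.exists_mem_transversalGraph hr
  set k' : K := ⟨p, G.le_topologicalClosure hp⟩
  have hd : ∀ y, deriv (‖J k‖⁻¹ • ψ) y = ‖J k‖⁻¹ * deriv ψ y := fun y => by
    rw [deriv_const_smul _ (hψ.smooth.differentiable (by simp) y)]; rfl
  have e1 : ⟪J k, J k'⟫ = ∫ y, ψ y * χ y ∂measY Y := inner_eq_integral h1 h3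
  have e2 : ⟪J' k, J' k'⟫ = ∫ y, (r y * deriv ψ y) * (r y * deriv χ y) ∂measY Y :=
    inner_eq_integral h2 h4
  have e3 : ‖k'‖ ^ 2 = ∫ y, χ y ^ 2 ∂measY Y + ∫ y, (r y * deriv χ y) ^ 2 ∂measY Y := by
    rw [← real_inner_self_eq_norm_sq, hinner, real_inner_self_eq_norm_sq,
      real_inner_self_eq_norm_sq]
    congr 1
    · exact norm_sq_eq_integral h3
    · exact norm_sq_eq_integral h4
  have e4 : ∫ y, (r y * deriv (‖J k‖⁻¹ • ψ) y) * (r y * deriv χ y) ∂measY Y =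
      ‖J k‖⁻¹ * ⟪J' k, J' k'⟫ := by
    rw [e2, ← integral_const_mul]
    congr 1; funext y; rw [hd]; ring
  have e5 : ∫ y, (‖J k‖⁻¹ • ψ) y * χ y ∂measY Y = ‖J k‖⁻¹ * ⟪J k, J k'⟫ := by
    rw [e1, ← integral_const_mul]
    congr 1; funext y; simp only [Pi.smul_apply, smul_eq_mul]; ring
  rw [e4, e5, ← e3]
  have e6 : ‖J k‖⁻¹ * ⟪J' k, J' k'⟫ - (1 / β - 1) * (‖J k‖⁻¹ * ⟪J k, J k'⟫) =
      ‖J k‖⁻¹ * (⟪J' k, J' k'⟫ - (1 / β - 1) * ⟪J k, J k'⟫) := by ring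
  rw [e6, ← mul_pow, sq_le_sq, abs_mul, abs_of_pos (inv_pos.2 hJkpos),
    abs_of_nonneg (by positivity : 0 ≤ ε * ‖k'‖), inv_mul_le_iff₀ hJkpos]
  refine (hk k').trans_eq ?_
  ring

/-- Narrow bumps have derivatives that are large compared to the bump. -/
theorem exists_potential_of_bump {Y : YDomain} {r : ℝ → ℝ}
    (hS : Icc (1 / 2) (3 / 2) ⊆ Y.carrier)
    (htest : ∀ ψ, ContDiff ℝ ((⊤ : ℕ∞) : WithTop ℕ∞) ψ → HasCompactSupport ψ →
      tsupport ψ ⊆ Icc (1 / 2) (3 / 2) → IsTestY Y ψ)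
    (hrc : ContinuousOn r (Icc (1 / 2) (3 / 2))) (hrpos : ∀ y ∈ Icc (1 / 2 : ℝ) (3 / 2), 0 < r y)
    {δ : ℝ} (hδ : 0 < δ) :
    ∃ Φ : ℝ → ℝ, IsTestY Y (deriv Φ) ∧ MemLp (fun y => Φ y / r y) 2 (measY Y) ∧
      (∀ χ, IsTestY Y χ → ∫ y, deriv Φ y * χ y ∂measY Y =
        -∫ y, (Φ y / r y) * (r y * deriv χ y) ∂measY Y) ∧
      ∫ y, (Φ y / r y) ^ 2 ∂measY Y < δ * ∫ y, deriv Φ y ^ 2 ∂measY Y := by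
  obtain ⟨y₀, hy₀, hmin⟩ := (isCompact_Icc (a := (1 / 2 : ℝ)) (b := 3 / 2)).exists_isMinOn
    (nonempty_Icc.2 (by norm_num)) hrc
  set r₀ := r y₀ with hr₀
  have hr₀pos : 0 < r₀ := hrpos y₀ hy₀
  -- A bump `f` of width `t` satisfies `‖f / r‖² ≤ 2 t / r₀²` and `‖f'‖² ≥ 1 / t`. The second bound
  -- on `t` gives `2 t² < δ r₀²`, the first keeps the support in `[1/2, 3/2]`.
  set t := min (1 / 2) (r₀ * √δ / 2) with ht
  have htpos : 0 < t := by positivity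
  have ht2 : t ≤ 1 / 2 := min_le_left _ _
  have htδ : 2 * t / r₀ ^ 2 < δ * (1 / t) := by
    have h1 : t ^ 2 ≤ (r₀ * √δ / 2) ^ 2 := by gcongr; exact min_le_right _ _
    rw [div_pow, mul_pow, Real.sq_sqrt hδ.le] at h1
    have : 0 < r₀ ^ 2 * δ := by positivity
    rw [mul_one_div, div_lt_div_iff₀ (by positivity) htpos]
    nlinarith
  let f : ContDiffBump (1 : ℝ) := ⟨t / 2, t, by positivity, by linarith⟩
  have hfs : ContDiff ℝ ((⊤ : ℕ∞) : WithTop ℕ∞) f := f.contDiff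
  have hfc : HasCompactSupport f := f.hasCompactSupport
  have hft : tsupport f = Icc (1 - t) (1 + t) := by
    rw [f.tsupport_eq, Real.closedBall_eq_Icc]
  have hfI : Icc (1 - t) (1 + t) ⊆ Icc (1 / 2) (3 / 2) := Icc_subset_Icc (by linarith) (by linarith)
  have hf0 : ∀ y, y ∉ Icc (1 - t) (1 + t) → f y = 0 := fun y hy =>
    image_eq_zero_of_notMem_tsupport (by rwa [hft])
  have hdt : tsupport (deriv f) ⊆ Icc (1 / 2) (3 / 2) :=
    tsupport_deriv_subset.trans (hft.subset.trans hfI)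
  have hdc : Continuous (deriv f) := hfs.continuous_deriv (by simp)
  have hd0 : ∀ y, y ∉ Y.carrier → deriv f y = 0 := fun y hy =>
    image_eq_zero_of_notMem_tsupport fun h => hy (hS (hdt h))
  have hfY : ∀ y, y ∉ Y.carrier → f y = 0 := fun y hy => hf0 y fun h => hy (hS (hfI h))
  have hbound : ∀ y, ‖(f y / r y) ^ 2‖ ≤ (Icc (1 - t) (1 + t)).indicator (fun _ => 1 / r₀ ^ 2) y := by
    intro y
    by_cases hy : y ∈ Icc (1 - t) (1 + t)
    · rw [indicator_of_mem hy, Real.norm_eq_abs, abs_of_nonneg (sq_nonneg _), div_pow]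
      have h1 : r₀ ≤ r y := hmin (hfI hy)
      have h2 : f y ^ 2 ≤ 1 := pow_le_one₀ f.nonneg f.le_one
      gcongr
    · rw [indicator_of_notMem hy, hf0 y hy]; simp
  have hmeas : AEStronglyMeasurable (fun y => f y / r y) (measY Y) := by
    refine AEStronglyMeasurable.restrict ?_
    have : (fun y => f y / r y) = (Icc (1 / 2) (3 / 2)).indicator (fun y => f y / r y) := by
      funext y
      by_cases hy : y ∈ Icc (1 / 2 : ℝ) (3 / 2)
      · rw [indicator_of_mem hy]
      · rw [indicator_of_notMem hy, hf0 y (fun h => hy (hfI h)), zero_div]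
    rw [this, aestronglyMeasurable_indicator_iff measurableSet_Icc]
    exact (hfs.continuous.continuousOn.div hrc fun y hy => (hrpos y hy).ne').aestronglyMeasurable
      measurableSet_Icc
  have hint : Integrable ((Icc (1 - t) (1 + t)).indicator (fun _ => 1 / r₀ ^ 2)) volume := by
    rw [integrable_indicator_iff measurableSet_Icc]
    exact integrableOn_const (by simp)
  have hsq : Integrable (fun y => (f y / r y) ^ 2) (measY Y) :=
    Integrable.mono' hint.restrict (hmeas.pow 2) (Filter.Eventually.of_forall hbound)
  refine ⟨f, htest _ (hfs.deriv' ) hfc.deriv hdt, (memLp_two_iff_integrable_sq hmeas).2 hsq, ?_, ?_⟩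
  · intro χ hχ
    have hχs := hχ.smooth
    have hχc := hχs.continuous
    have hχd : Continuous (deriv χ) := hχs.continuous_deriv (by simp)
    have e1 : ∫ y, deriv f y * χ y ∂measY Y = ∫ y, deriv f y * χ y :=
      setIntegral_eq_integral_of_forall_compl_eq_zero fun y hy => by rw [hd0 y hy, zero_mul]
    have e2 : ∫ y, (f y / r y) * (r y * deriv χ y) ∂measY Y = ∫ y, f y * deriv χ y := by
      rw [← setIntegral_eq_integral_of_forall_compl_eq_zero (s := Y.carrier)
        (f := fun y => f y * deriv χ y) (fun y hy => by rw [hfY y hy, zero_mul])]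
      refine integral_congr_ae (Filter.Eventually.of_forall fun y => ?_)
      dsimp only
      by_cases hy : y ∈ Icc (1 - t) (1 + t)
      · have := (hrpos y (hfI hy)).ne'
        field_simp
      · simp [hf0 y hy]
    rw [e1, e2, integral_mul_deriv_eq_deriv_mul_of_integrable (u := f) (u' := deriv f) (v := χ)
      (v' := deriv χ), neg_neg]
    · exact fun y _ => (hfs.differentiable (by simp) y).hasDerivAt
    · exact fun y _ => (hχs.differentiable (by simp) y).hasDerivAt
    · exact (hfs.continuous.mul hχd).integrable_of_hasCompactSupport hfc.mul_right
    · exact (hdc.mul hχc).integrable_of_hasCompactSupport hfc.deriv.mul_right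
    · exact (hfs.continuous.mul hχc).integrable_of_hasCompactSupport hfc.mul_right
  · have hup : ∫ y, (f y / r y) ^ 2 ∂measY Y ≤ 2 * t / r₀ ^ 2 := by
      calc ∫ y, (f y / r y) ^ 2 ∂measY Y
          ≤ ∫ y, (Icc (1 - t) (1 + t)).indicator (fun _ => 1 / r₀ ^ 2) y ∂measY Y :=
            integral_mono hsq hint.restrict fun y => (le_abs_self _).trans (hbound y)
        _ ≤ ∫ y, (Icc (1 - t) (1 + t)).indicator (fun _ => 1 / r₀ ^ 2) y :=
            setIntegral_le_integral hint (Filter.Eventually.of_forall fun y =>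
              indicator_nonneg (fun _ _ => by positivity) y)
        _ = 2 * t / r₀ ^ 2 := by
            rw [integral_indicator measurableSet_Icc, setIntegral_const, Measure.real,
              Real.volume_Icc, ENNReal.toReal_ofReal (by linarith), smul_eq_mul]
            ring
    have hlow : 1 / t ≤ ∫ y, deriv f y ^ 2 ∂measY Y := by
      have hsqc : Continuous fun y => deriv f y ^ 2 := hdc.pow 2
      have e1 : ∫ y, deriv f y ^ 2 ∂measY Y = ∫ y, deriv f y ^ 2 :=
        setIntegral_eq_integral_of_forall_compl_eq_zero fun y hy => by rw [hd0 y hy]; simp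
      have hi : Integrable fun y => deriv f y ^ 2 := by
        refine hsqc.integrable_of_hasCompactSupport ?_
        simp only [sq]
        exact hfc.deriv.mul_right (f' := deriv f)
      have e2 : ∫ y in (1 - t)..1, deriv f y = 1 := by
        rw [intervalIntegral.integral_deriv_eq_sub (fun y _ => hfs.differentiable (by simp) y)
          (hdc.intervalIntegrable _ _)]
        have h1 : f 1 = 1 := f.one_of_mem_closedBall (by simpa using f.rIn_pos.le)
        have h2 : f (1 - t) = 0 := f.zero_of_le_dist (by simp [abs_of_pos htpos]; rfl)
        rw [h1, h2, sub_zero]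
      -- Integrated form of `(f' - 1 / t)² ≥ 0`, using that `f` climbs from `0` to `1` over a length
      -- `t`.
      calc 1 / t = ∫ y in (1 - t)..1, (2 / t * deriv f y - 1 / t ^ 2) := by
            rw [intervalIntegral.integral_sub ((hdc.intervalIntegrable _ _).const_mul _) (by simp),
              intervalIntegral.integral_const_mul, e2, intervalIntegral.integral_const]
            simp only [smul_eq_mul]
            field_simp
            ring
        _ ≤ ∫ y in (1 - t)..1, deriv f y ^ 2 := by
            refine intervalIntegral.integral_mono_on (by linarith)
              (((hdc.intervalIntegrable _ _).const_mul _).sub (by simp))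
              (hsqc.intervalIntegrable _ _) fun y _ => ?_
            have := sq_nonneg (deriv f y - 1 / t)
            have e : (1 / t) ^ 2 = 1 / t ^ 2 := by rw [div_pow, one_pow]
            have e' : 2 / t * deriv f y = 2 * deriv f y * (1 / t) := by ring
            rw [sub_sq, e] at this
            rw [e']
            linarith
        _ ≤ ∫ y, deriv f y ^ 2 := by
            rw [intervalIntegral.integral_of_le (by linarith)]
            exact setIntegral_le_integral hi (Filter.Eventually.of_forall fun y => sq_nonneg _)
        _ = _ := e1.symm
    calc _ ≤ _ := hup
      _ < δ * (1 / t) := htδ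
      _ ≤ _ := by gcongr

/-- A compactly supported bump is not periodic, so oscillation replaces concentration: for `Φ = sin
(n y) / n` the derivative has squared norm `π` for every `n`, while `Φ / r` is `O(1 / n)`. -/
theorem exists_potential_circle {r : ℝ → ℝ} (hr : IsTransversalCoeff .circle r)
    {δ : ℝ} (hδ : 0 < δ) :
    ∃ Φ : ℝ → ℝ, IsTestY .circle (deriv Φ) ∧ MemLp (fun y => Φ y / r y) 2 (measY .circle) ∧
      (∀ χ, IsTestY .circle χ → ∫ y, deriv Φ y * χ y ∂measY .circle =
        -∫ y, (Φ y / r y) * (r y * deriv χ y) ∂measY .circle) ∧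
      ∫ y, (Φ y / r y) ^ 2 ∂measY .circle < δ * ∫ y, deriv Φ y ^ 2 ∂measY .circle := by
  obtain ⟨hrs, hrp, hrpos⟩ := hr
  have hconv : ∀ f : ℝ → ℝ, ∫ y, f y ∂measY .circle = ∫ y in (0)..(2 * Real.pi), f y := by
    intro f
    rw [intervalIntegral.integral_of_le (by positivity), ← integral_Ico_eq_integral_Ioc]
    rfl
  obtain ⟨y₀, hy₀, hmin⟩ := (isCompact_Icc (a := (0 : ℝ)) (b := 2 * Real.pi)).exists_isMinOn
    (nonempty_Icc.2 (by positivity)) hrs.continuous.continuousOn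
  set r₀ := r y₀ with hr₀
  have hr₀pos : 0 < r₀ := hrpos y₀
  obtain ⟨m, hm⟩ := exists_nat_gt (2 / (δ * r₀ ^ 2))
  set n : ℕ := m + 1 with hn
  have hn1 : (1 : ℝ) ≤ n := by simp [hn]
  have hnpos : (0 : ℝ) < n := by linarith
  have hnδ : 2 / (r₀ ^ 2 * (n : ℝ) ^ 2) < δ := by
    have h1 : 2 / (δ * r₀ ^ 2) < (n : ℝ) := hm.trans (by simp [hn])
    rw [div_lt_iff₀ (by positivity)] at h1 ⊢
    nlinarith [show (n : ℝ) ≤ n ^ 2 by nlinarith, show 0 < δ * r₀ ^ 2 by positivity]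
  set Φ : ℝ → ℝ := fun y => Real.sin (n * y) / n with hΦ
  have hΦd : ∀ y, HasDerivAt Φ (Real.cos (n * y)) y := by
    intro y
    have h1 : HasDerivAt (fun y : ℝ => (n : ℝ) * y) n y := by
      simpa using (hasDerivAt_id y).const_mul (n : ℝ)
    have := (h1.sin).div_const (n : ℝ)
    rwa [mul_div_cancel_right₀ _ hnpos.ne'] at this
  have hder : deriv Φ = fun y => Real.cos (n * y) := funext fun y => (hΦd y).deriv
  have hΦc : Continuous Φ := by fun_prop
  have hq : Continuous fun y => Φ y / r y := hΦc.div hrs.continuous fun y => (hrpos y).ne'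
  refine ⟨Φ, ?_, memLp_circle_of_continuous hq, ?_, ?_⟩
  · rw [hder]
    refine ⟨by fun_prop, fun y => ?_⟩
    dsimp only
    have : (n : ℝ) * (y + 2 * Real.pi) = n * y + n * (2 * Real.pi) := by ring
    rw [this, Real.cos_add_nat_mul_two_pi]
  · intro χ hχ
    have hχs := hχ.smooth
    have hχd : Continuous (deriv χ) := hχs.continuous_deriv (by simp)
    have e : ∀ y, (Φ y / r y) * (r y * deriv χ y) = Φ y * deriv χ y := fun y => by
      have := (hrpos y).ne'
      field_simp
    simp only [e]
    rw [hconv, hconv, hder, intervalIntegral.integral_mul_deriv_eq_deriv_mul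
      (fun y _ => hΦd y) (fun y _ => (hχs.differentiable (by simp) y).hasDerivAt)
      (Continuous.intervalIntegrable (by fun_prop) _ _) (hχd.intervalIntegrable _ _)]
    have h1 : Φ (2 * Real.pi) = 0 := by
      simp only [hΦ]
      rw [show (n : ℝ) * (2 * Real.pi) = 0 + n * (2 * Real.pi) by ring, Real.sin_add_nat_mul_two_pi]
      simp
    have h0 : Φ 0 = 0 := by simp [hΦ]
    rw [h1, h0]
    ring
  · rw [hconv, hconv, hder]
    have hcos : ∫ y in (0)..(2 * Real.pi), Real.cos (n * y) ^ 2 = Real.pi := by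
      rw [intervalIntegral.integral_comp_mul_left (fun y => Real.cos y ^ 2) hnpos.ne',
        integral_cos_sq]
      rw [show (n : ℝ) * (2 * Real.pi) = 0 + n * (2 * Real.pi) by ring,
        Real.sin_add_nat_mul_two_pi, mul_zero, Real.sin_zero]
      simp only [smul_eq_mul]
      field_simp
      ring
    rw [hcos]
    calc ∫ y in (0)..(2 * Real.pi), (Φ y / r y) ^ 2
        ≤ ∫ y in (0)..(2 * Real.pi), 1 / (r₀ ^ 2 * (n : ℝ) ^ 2) := by
          refine intervalIntegral.integral_mono_on (by positivity)
            ((hq.pow 2).intervalIntegrable _ _) (by simp) fun y hy => ?_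
          have h1 : r₀ ≤ r y := hmin hy
          rw [div_pow, hΦ]
          simp only [div_pow, div_div]
          rw [mul_comm (r₀ ^ 2)]
          gcongr
          rw [sq_le_one_iff_abs_le_one]
          exact Real.abs_sin_le_one _
      _ = Real.pi * (2 / (r₀ ^ 2 * (n : ℝ) ^ 2)) := by
          rw [intervalIntegral.integral_const, smul_eq_mul]; ring
      _ < Real.pi * δ := by gcongr
      _ = δ * Real.pi := mul_comm _ _

/-- The transversal operator `-∂_y (r² ∂_y)` has quasimodes of arbitrarily high energy `ν` and
arbitrary precision. -/
theorem exists_transversal_quasimode {Y : YDomain} {r : ℝ → ℝ} (hr : IsTransversalCoeff Y r)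
    (M : ℝ) :
    ∃ ν, M ≤ ν ∧ ∀ ε > 0, ∃ ψ, IsTestY Y ψ ∧ ∫ y, ψ y ^ 2 ∂measY Y = 1 ∧
      ∀ χ, IsTestY Y χ →
        (∫ y, (r y * deriv ψ y) * (r y * deriv χ y) ∂measY Y - ν * ∫ y, ψ y * χ y ∂measY Y) ^ 2
          ≤ ε ^ 2 * (∫ y, χ y ^ 2 ∂measY Y + ∫ y, (r y * deriv χ y) ^ 2 ∂measY Y) := by
  -- The energy is `1 / β - 1` with `β < δ`, hence exceeds `|M|`. It is fixed before `ε`, so the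
  -- precision may later be taken exponentially small in `√ν`.
  set δ := 1 / (|M| + 1) with hδ
  have hδpos : 0 < δ := by positivity
  have hpi := Real.pi_gt_three
  have hI : Icc (1 / 2 : ℝ) (3 / 2) ⊆ Ioo 0 Real.pi := fun y hy =>
    ⟨by linarith [hy.1], by linarith [hy.2]⟩
  obtain ⟨Φ, h1, h2, h3, h4⟩ : ∃ Φ : ℝ → ℝ, IsTestY Y (deriv Φ) ∧
      MemLp (fun y => Φ y / r y) 2 (measY Y) ∧
      (∀ χ, IsTestY Y χ → ∫ y, deriv Φ y * χ y ∂measY Y =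
        -∫ y, (Φ y / r y) * (r y * deriv χ y) ∂measY Y) ∧
      ∫ y, (Φ y / r y) ^ 2 ∂measY Y < δ * ∫ y, deriv Φ y ^ 2 ∂measY Y :=
    match Y, hr with
    | .interval, hr => exists_potential_of_bump (Y := .interval) hI
        (fun ψ a b c => ⟨a, b, c.trans hI⟩) (hr.1.continuousOn.mono hI)
        (fun y hy => hr.2 y (hI hy)) hδpos
    | .circle, hr => exists_potential_circle hr hδpos
    | .line, hr => by
        have hr1 : r = fun _ => 1 := funext hr
        subst hr1
        exact exists_potential_of_bump (Y := .line) (subset_univ _)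
          (fun ψ a b c => ⟨a, b⟩) continuousOn_const (fun y hy => one_pos) hδpos
  obtain ⟨β, hβ, hβδ, h⟩ := exists_transversal_quasimode_of_potential hr hδpos h1 h2 h3 h4
  refine ⟨1 / β - 1, ?_, h⟩
  have : |M| + 1 < 1 / β := by
    rw [lt_one_div (by positivity) hβ]; exact hβδ
  linarith [le_abs_self M]

/-! ### Trial states and near-minimisers of the longitudinal form. -/

theorem integral_measX {L : ℝ} (hL : 0 < L) (f : ℝ → ℝ) :
    ∫ x, f x ∂measX L = ∫ x in (-L)..L, f x := by
  rw [intervalIntegral.integral_of_le (by linarith), integral_Ioc_eq_integral_Ioo]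

/-- Truncated Gaussians are almost ground states of the harmonic oscillator. -/
theorem exists_truncated_gaussian {L s : ℝ} (hs : 0 < s) (h2s : 2 * s < L) :
    ∃ C : ℝ, 0 ≤ C ∧ ∀ c : ℝ, 0 ≤ c → ∃ φ, IsTestX L φ ∧ (∀ x, 2 * s ≤ |x| → φ x = 0) ∧
      0 < ∫ x, φ x ^ 2 ∂measX L ∧
      ∫ x, (deriv φ x ^ 2 + c ^ 2 * x ^ 2 * φ x ^ 2) ∂measX L ≤
        (c + C) * ∫ x, φ x ^ 2 ∂measX L := by
  have hL : 0 < L := by linarith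
  let χ : ContDiffBump (0 : ℝ) := ⟨s, 2 * s, hs, by linarith⟩
  have hχs : ContDiff ℝ ((⊤ : ℕ∞) : WithTop ℕ∞) χ := χ.contDiff
  have hχd : Continuous (deriv χ) := hχs.continuous_deriv (by simp)
  obtain ⟨M, hM⟩ := hχd.bounded_above_of_compact_support χ.hasCompactSupport.deriv
  have hχ0 : ∀ x, 2 * s ≤ |x| → χ x = 0 := fun x hx => χ.zero_of_le_dist (by simpa using hx)
  have hχ1 : ∀ x, |x| ≤ s → χ x = 1 := fun x hx => χ.one_of_mem_closedBall (by simpa using hx)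
  have hχd0 : ∀ x, |x| < s → deriv χ x = 0 := by
    intro x hx
    have : χ =ᶠ[nhds x] fun _ => (1 : ℝ) := by
      filter_upwards [(isOpen_lt continuous_abs continuous_const).mem_nhds hx] with y hy
      exact hχ1 y (le_of_lt hy)
    rw [this.deriv_eq]; simp
  -- The cutoff costs at most `2 L M² exp (-c s²)` and the mass is at least `2 s exp (-c s²)`; the
  -- exponentials cancel in the quotient, which is why the constant does not depend on `c`.
  refine ⟨L * M ^ 2 / s, by positivity, fun c hc => ?_⟩
  set G : ℝ → ℝ := fun x => Real.exp (-(c * x ^ 2 / 2)) with hG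
  have hGs : ContDiff ℝ ((⊤ : ℕ∞) : WithTop ℕ∞) G := by fun_prop
  have hGd : ∀ x, HasDerivAt G (-(c * x) * G x) x := by
    intro x
    have h1 : HasDerivAt (fun x : ℝ => -(c * x ^ 2 / 2)) (-(c * x)) x := by
      refine HasDerivAt.congr_deriv (((hasDerivAt_pow 2 x).const_mul c).div_const 2).neg ?_
      norm_num; ring
    have := h1.exp
    convert this using 1
    simp only [hG]; ring
  have hGsq : ∀ x, G x ^ 2 = Real.exp (-(c * x ^ 2)) := fun x => by
    rw [hG, ← Real.exp_nat_mul]; congr 1; push_cast; ring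
  set φ : ℝ → ℝ := fun x => χ x * G x with hφ
  have hφt : IsTestX L φ := ⟨hχs.mul hGs, 2 * s, h2s, fun x hx => by simp [hφ, hχ0 x hx]⟩
  have hφd : ∀ x, deriv φ x = deriv χ x * G x - c * x * φ x := fun x => by
    have := ((hχs.differentiable (by simp) x).hasDerivAt.mul (hGd x)).deriv
    rw [hφ]
    refine this.trans ?_
    ring
  have hφc := hφt.continuous
  have hφdc := hφt.continuous_deriv
  have hlow : 2 * s * Real.exp (-(c * s ^ 2)) ≤ ∫ x, φ x ^ 2 ∂measX L := by
    calc 2 * s * Real.exp (-(c * s ^ 2)) = ∫ x in (-s)..s, Real.exp (-(c * s ^ 2)) := by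
          rw [intervalIntegral.integral_const, smul_eq_mul]; ring
      _ ≤ ∫ x in (-s)..s, φ x ^ 2 := by
          refine intervalIntegral.integral_mono_on (by linarith) (by simp)
            ((hφc.pow 2).intervalIntegrable _ _) fun x hx => ?_
          have hx' : |x| ≤ s := abs_le.2 hx
          simp only [hφ]
          rw [hχ1 x hx', one_mul, hGsq]
          have h2 : x ^ 2 ≤ s ^ 2 := sq_le_sq' hx.1 hx.2
          gcongr
      _ ≤ ∫ x in (-L)..L, φ x ^ 2 := by
          refine intervalIntegral.integral_mono_interval (by linarith) (by linarith) (by linarith)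
            (Filter.Eventually.of_forall fun x => sq_nonneg _) ((hφc.pow 2).intervalIntegrable _ _)
      _ = _ := (integral_measX hL _).symm
  have hpos : 0 < ∫ x, φ x ^ 2 ∂measX L := lt_of_lt_of_le (by positivity) hlow
  refine ⟨φ, hφt, fun x hx => by simp [hφ, hχ0 x hx], hpos, ?_⟩
  -- The total derivative of `x φ²` integrates to `0`. Removing `c` times it from the energy density
  -- leaves `c φ²`, the oscillator's ground energy, and the cutoff term.
  have hder : ∀ x, HasDerivAt (fun x => x * φ x ^ 2) (φ x ^ 2 + x * (2 * φ x * deriv φ x)) x := by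
    intro x
    refine HasDerivAt.congr_deriv
      ((hasDerivAt_id x).mul ((hφt.differentiable x).hasDerivAt.pow 2)) ?_
    norm_num
  have hzero : ∫ x in (-L)..L, (φ x ^ 2 + x * (2 * φ x * deriv φ x)) = 0 := by
    rw [intervalIntegral.integral_eq_sub_of_hasDerivAt (fun x _ => hder x)
      (Continuous.intervalIntegrable (by fun_prop) _ _)]
    have h1 : φ L = 0 := by
      simp only [hφ]; rw [hχ0 L (by rw [abs_of_pos hL]; linarith), zero_mul]
    have h2 : φ (-L) = 0 := by
      simp only [hφ]; rw [hχ0 (-L) (by rw [abs_neg, abs_of_pos hL]; linarith), zero_mul]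
    simp [h1, h2]
  have hid : ∀ x, deriv φ x ^ 2 + c ^ 2 * x ^ 2 * φ x ^ 2 =
      (deriv χ x * G x) ^ 2 + c * φ x ^ 2 - c * (φ x ^ 2 + x * (2 * φ x * deriv φ x)) := by
    intro x
    rw [hφd]
    ring
  have hGc := hGs.continuous
  have hcut : ∫ x in (-L)..L, (deriv χ x * G x) ^ 2 ≤ 2 * L * (M ^ 2 * Real.exp (-(c * s ^ 2))) := by
    calc ∫ x in (-L)..L, (deriv χ x * G x) ^ 2
        ≤ ∫ x in (-L)..L, M ^ 2 * Real.exp (-(c * s ^ 2)) := by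
          refine intervalIntegral.integral_mono_on (by linarith)
            (Continuous.intervalIntegrable (by fun_prop) _ _) (by simp) fun x hx => ?_
          rw [mul_pow, hGsq]
          by_cases hx : |x| < s
          · rw [hχd0 x hx]; simp; positivity
          · have h1 : deriv χ x ^ 2 ≤ M ^ 2 := by
              rw [← sq_abs]; gcongr; exact hM x
            have h2 : s ^ 2 ≤ x ^ 2 := by
              rw [← sq_abs x]; push Not at hx; gcongr
            gcongr
      _ = _ := by rw [intervalIntegral.integral_const, smul_eq_mul]; ring
  rw [integral_measX hL, integral_measX hL]
  rw [integral_measX hL] at hlow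
  simp only [hid]
  rw [intervalIntegral.integral_sub (Continuous.intervalIntegrable (by fun_prop) _ _)
    (Continuous.intervalIntegrable (by fun_prop) _ _),
    intervalIntegral.integral_add (Continuous.intervalIntegrable (by fun_prop) _ _)
    (Continuous.intervalIntegrable (by fun_prop) _ _), intervalIntegral.integral_const_mul,
    intervalIntegral.integral_const_mul, hzero]
  have : 2 * L * (M ^ 2 * Real.exp (-(c * s ^ 2))) ≤
      L * M ^ 2 / s * ∫ x in (-L)..L, φ x ^ 2 := by
    calc _ = L * M ^ 2 / s * (2 * s * Real.exp (-(c * s ^ 2))) := by field_simp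
      _ ≤ _ := by gcongr
  linarith

/-- The form `∫ φ' χ' + P φ χ` on `(-L, L)`. -/
noncomputable def formX (L : ℝ) (P φ χ : ℝ → ℝ) : ℝ :=
  ∫ x, deriv φ x * deriv χ x ∂measX L + ∫ x, P x * (φ x * χ x) ∂measX L

section Form

variable {L : ℝ} {P φ χ : ℝ → ℝ}

theorem IsTestX.integrable_mul (hφ : IsTestX L φ) (hχ : IsTestX L χ) :
    Integrable (fun x => φ x * χ x) (measX L) :=
  (hφ.memLp 2).integrable_mul (hχ.memLp 2)

theorem IsTestX.integrable_deriv_mul (hφ : IsTestX L φ) (hχ : IsTestX L χ) :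
    Integrable (fun x => deriv φ x * deriv χ x) (measX L) :=
  (hφ.memLp_deriv 2).integrable_mul (hχ.memLp_deriv 2)

theorem IsTestX.integrable_potential_mul (hP : MemLp P ⊤ (measX L)) (hφ : IsTestX L φ)
    (hχ : IsTestX L χ) : Integrable (fun x => P x * (φ x * χ x)) (measX L) :=
  MemLp.integrable_mul hP (memLp_one_iff_integrable.2 (hφ.integrable_mul hχ))

theorem integral_sq_add_smul (hφ : IsTestX L φ) (hχ : IsTestX L χ) (t : ℝ) :
    ∫ x, (φ + t • χ) x ^ 2 ∂measX L = ∫ x, φ x ^ 2 ∂measX L +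
      2 * t * ∫ x, φ x * χ x ∂measX L + t ^ 2 * ∫ x, χ x ^ 2 ∂measX L := by
  rw [← integral_const_mul, ← integral_const_mul, ← integral_add, ← integral_add]
  · congr 1; funext x; simp; ring
  · exact (hφ.memLp 2).integrable_sq.add ((hφ.integrable_mul hχ).const_mul _)
  · exact (hχ.memLp 2).integrable_sq.const_mul _
  · exact (hφ.memLp 2).integrable_sq
  · exact (hφ.integrable_mul hχ).const_mul _

theorem formX_add_smul (hP : MemLp P ⊤ (measX L)) (hφ : IsTestX L φ) (hχ : IsTestX L χ) (t : ℝ) :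
    formX L P (φ + t • χ) (φ + t • χ) =
      formX L P φ φ + 2 * t * formX L P φ χ + t ^ 2 * formX L P χ χ := by
  have hd : ∀ x, deriv (φ + t • χ) x = deriv φ x + t * deriv χ x := fun x => by
    rw [deriv_add (hφ.differentiable x) ((hχ.differentiable x).const_smul t),
      deriv_const_smul _ (hχ.differentiable x)]; rfl
  have e1 : ∫ x, deriv (φ + t • χ) x * deriv (φ + t • χ) x ∂measX L =
      ∫ x, deriv φ x * deriv φ x ∂measX L + 2 * t * ∫ x, deriv φ x * deriv χ x ∂measX L +
        t ^ 2 * ∫ x, deriv χ x * deriv χ x ∂measX L := by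
    rw [← integral_const_mul, ← integral_const_mul, ← integral_add, ← integral_add]
    · congr 1; funext x; rw [hd]; ring
    · exact (hφ.integrable_deriv_mul hφ).add ((hφ.integrable_deriv_mul hχ).const_mul _)
    · exact (hχ.integrable_deriv_mul hχ).const_mul _
    · exact hφ.integrable_deriv_mul hφ
    · exact (hφ.integrable_deriv_mul hχ).const_mul _
  have e2 : ∫ x, P x * ((φ + t • χ) x * (φ + t • χ) x) ∂measX L =
      ∫ x, P x * (φ x * φ x) ∂measX L + 2 * t * ∫ x, P x * (φ x * χ x) ∂measX L +
        t ^ 2 * ∫ x, P x * (χ x * χ x) ∂measX L := by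
    rw [← integral_const_mul, ← integral_const_mul, ← integral_add, ← integral_add]
    · congr 1; funext x; simp; ring
    · exact (hφ.integrable_potential_mul hP hφ).add ((hφ.integrable_potential_mul hP hχ).const_mul _)
    · exact (hχ.integrable_potential_mul hP hχ).const_mul _
    · exact hφ.integrable_potential_mul hP hφ
    · exact (hφ.integrable_potential_mul hP hχ).const_mul _
  rw [formX, e1, e2, formX, formX, formX]
  ring

theorem abs_integral_potential_le {c : ℝ} (hP : MemLp P ⊤ (measX L))
    (hc : ∀ᵐ x ∂measX L, |P x| ≤ c) (hφ : IsTestX L φ) :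
    |∫ x, P x * (φ x * φ x) ∂measX L| ≤ c * ∫ x, φ x ^ 2 ∂measX L := by
  rw [← integral_const_mul]
  refine abs_integral_le_integral_abs.trans (integral_mono_ae
    (hφ.integrable_potential_mul hP hφ).abs ((hφ.memLp 2).integrable_sq.const_mul _) ?_)
  filter_upwards [hc] with x hx
  rw [abs_mul, abs_mul_self, sq]
  exact mul_le_mul_of_nonneg_right hx (mul_self_nonneg _)

theorem formX_self (φ : ℝ → ℝ) : formX L P φ φ =
    ∫ x, deriv φ x ^ 2 ∂measX L + ∫ x, P x * (φ x * φ x) ∂measX L := by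
  simp [formX, sq]

/-- The bottom of the form is approached by normalised test functions. -/
theorem exists_form_bottom {c Λ : ℝ} (hP : MemLp P ⊤ (measX L)) (hc : ∀ᵐ x ∂measX L, -c ≤ P x)
    (hΛ : ∃ φ, IsTestX L φ ∧ 0 < ∫ x, φ x ^ 2 ∂measX L ∧
      formX L P φ φ ≤ Λ * ∫ x, φ x ^ 2 ∂measX L) :
    ∃ l : ℝ, -c ≤ l ∧ l ≤ Λ ∧ (∀ χ, IsTestX L χ → l * ∫ x, χ x ^ 2 ∂measX L ≤ formX L P χ χ) ∧
      ∀ ε > 0, ∃ φ, IsTestX L φ ∧ ∫ x, φ x ^ 2 ∂measX L = 1 ∧ formX L P φ φ ≤ l + ε := by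
  -- Only the infimum of the Rayleigh quotients is used; no ground state has to exist.
  set A : Set ℝ := {t | ∃ φ, IsTestX L φ ∧ 0 < ∫ x, φ x ^ 2 ∂measX L ∧
    t = formX L P φ φ / ∫ x, φ x ^ 2 ∂measX L} with hA
  have hge : ∀ φ, IsTestX L φ → -c * ∫ x, φ x ^ 2 ∂measX L ≤ formX L P φ φ := by
    intro φ hφ
    have h1 : 0 ≤ ∫ x, deriv φ x ^ 2 ∂measX L := integral_nonneg fun x => sq_nonneg _
    have h2 : -c * ∫ x, φ x ^ 2 ∂measX L ≤ ∫ x, P x * (φ x * φ x) ∂measX L := by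
      rw [← integral_const_mul]
      refine integral_mono_ae ((hφ.memLp 2).integrable_sq.const_mul _)
        (hφ.integrable_potential_mul hP hφ) ?_
      filter_upwards [hc] with x hx
      rw [sq]
      exact mul_le_mul_of_nonneg_right hx (mul_self_nonneg _)
    rw [formX_self]
    linarith
  have hlb : ∀ t ∈ A, -c ≤ t := by
    rintro t ⟨φ, hφ, hpos, rfl⟩
    rw [le_div_iff₀ hpos]
    exact hge φ hφ
  have hbdd : BddBelow A := ⟨-c, hlb⟩
  obtain ⟨φ₀, hφ₀, hpos₀, hle₀⟩ := hΛ
  have hne : A.Nonempty := ⟨_, φ₀, hφ₀, hpos₀, rfl⟩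
  refine ⟨sInf A, le_csInf hne hlb, (csInf_le hbdd ⟨φ₀, hφ₀, hpos₀, rfl⟩).trans
    ((div_le_iff₀ hpos₀).2 hle₀), fun χ hχ => ?_, fun ε hε => ?_⟩
  · rcases (integral_nonneg fun x => sq_nonneg (χ x) :
      0 ≤ ∫ x, χ x ^ 2 ∂measX L).eq_or_lt' with h0 | hpos
    · rw [h0, mul_zero]
      simpa [h0] using hge χ hχ
    · rw [← le_div_iff₀ hpos]
      exact csInf_le hbdd ⟨χ, hχ, hpos, rfl⟩
  · obtain ⟨t, ⟨φ, hφ, hpos, rfl⟩, ht⟩ := exists_lt_of_csInf_lt hne (lt_add_of_pos_right (sInf A) hε)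
    set N := ∫ x, φ x ^ 2 ∂measX L with hN
    have hs : (√N)⁻¹ ^ 2 = N⁻¹ := by rw [inv_pow, Real.sq_sqrt hpos.le]
    have hd : ∀ x, deriv ((√N)⁻¹ • φ) x = (√N)⁻¹ * deriv φ x := fun x => by
      rw [deriv_const_smul _ (hφ.differentiable x)]; rfl
    refine ⟨(√N)⁻¹ • φ, hφ.const_smul _, ?_, ?_⟩
    · simp only [Pi.smul_apply, smul_eq_mul, mul_pow, integral_const_mul, hs, ← hN]
      exact inv_mul_cancel₀ hpos.ne'
    · have : formX L P ((√N)⁻¹ • φ) ((√N)⁻¹ • φ) = formX L P φ φ / N := by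
        rw [formX_self, formX_self, div_eq_inv_mul, mul_add, ← hs, ← integral_const_mul,
          ← integral_const_mul]
        congr 1
        · congr 1; funext x; rw [hd]; ring
        · congr 1; funext x; simp only [Pi.smul_apply, smul_eq_mul]; ring
      rw [this]
      exact ht.le

/-- Near-minimisers of the form are quasimodes in the weak sense. -/
theorem form_quasimode {l ε : ℝ} (hP : MemLp P ⊤ (measX L))
    (hl : ∀ χ, IsTestX L χ → l * ∫ x, χ x ^ 2 ∂measX L ≤ formX L P χ χ)
    (hφ : IsTestX L φ) (h1 : ∫ x, φ x ^ 2 ∂measX L = 1) (hε : formX L P φ φ ≤ l + ε)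
    (hχ : IsTestX L χ) :
    (formX L P φ χ - l * ∫ x, φ x * χ x ∂measX L) ^ 2 ≤
      ε * (formX L P χ χ - l * ∫ x, χ x ^ 2 ∂measX L) := by
  -- Cauchy–Schwarz for the form shifted by `-l`, which is nonnegative and at most `ε` on `φ`.
  have hcs : (formX L P φ χ - l * ∫ x, φ x * χ x ∂measX L) ^ 2 ≤
      (formX L P φ φ - l) * (formX L P χ χ - l * ∫ x, χ x ^ 2 ∂measX L) := by
    apply sq_le_mul_of_quadratic_nonneg
    intro t
    have := hl _ (hφ.add (hχ.const_smul t))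
    rw [formX_add_smul hP hφ hχ, integral_sq_add_smul hφ hχ, h1] at this
    linarith
  refine hcs.trans (mul_le_mul_of_nonneg_right (by linarith) ?_)
  linarith [hl χ hχ]

end Form

theorem memLp_top_of_continuousOn {L c : ℝ} {f : ℝ → ℝ} (hf : ContinuousOn f (Ioo (-L) L))
    (hc : ∀ x ∈ Ioo (-L) L, |f x| ≤ c) : MemLp f ⊤ (measX L) :=
  memLp_top_of_bound (hf.aestronglyMeasurable measurableSet_Ioo) c
    (ae_restrict_of_forall_mem measurableSet_Ioo hc)

theorem exists_ae_abs_le {L : ℝ} {V : ℝ → ℝ} (hV : MemLp V ⊤ (measX L)) :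
    ∃ c : ℝ, 0 ≤ c ∧ ∀ᵐ x ∂measX L, |V x| ≤ c := by
  refine ⟨(eLpNormEssSup V (measX L)).toReal, ENNReal.toReal_nonneg, ?_⟩
  have hlt : eLpNormEssSup V (measX L) < ⊤ := by
    simpa using hV.eLpNorm_lt_top
  filter_upwards [enorm_ae_le_eLpNormEssSup V (measX L)] with x hx
  rw [← Real.norm_eq_abs, ← toReal_enorm]
  exact ENNReal.toReal_mono hlt.ne hx

/-! ### Exponential localisation away from `0`. -/

/-- Agmon's energy estimate for near-minimisers of the form. -/
theorem agmon_estimate {L c l Θ : ℝ} {P θ : ℝ → ℝ} (hc0 : 0 ≤ c) (hP : MemLp P ⊤ (measX L))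
    (hc : ∀ᵐ x ∂measX L, |P x| ≤ c)
    (hl : ∀ χ, IsTestX L χ → l * ∫ x, χ x ^ 2 ∂measX L ≤ formX L P χ χ)
    (hθ : ContDiffOn ℝ ((⊤ : ℕ∞) : WithTop ℕ∞) θ (Ioo (-L) L))
    (hθ0 : ∀ x ∈ Ioo (-L) L, |θ x| ≤ Θ) (hθ1 : ∀ x ∈ Ioo (-L) L, |deriv θ x| ≤ Θ) :
    ∃ ε₀ > 0, ∀ ε, 0 < ε → ε ≤ ε₀ → ∀ φ, IsTestX L φ → ∫ x, φ x ^ 2 ∂measX L = 1 →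
      formX L P φ φ ≤ l + ε →
      Integrable (fun x => (P x - l - deriv θ x ^ 2) * (φ x * (Real.exp (2 * θ x) * φ x))) (measX L) ∧
      ∫ x, (P x - l - deriv θ x ^ 2) * (φ x * (Real.exp (2 * θ x) * φ x)) ∂measX L ≤ 1 := by
  set E := Real.exp (2 * Θ) with hE
  -- `K` bounds the shifted form at `χ = exp (2 θ) φ`, uniformly over normalised `φ` of energy at
  -- most `l + 1`; `ε K ≤ 1` then bounds by `1` the quasimode error tested on `χ`.
  set K := 2 * E ^ 2 * (|l| + 1 + c + 4 * Θ ^ 2) + (c + |l|) * E ^ 2 with hK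
  have hKpos : 0 < K := by positivity
  refine ⟨min 1 (1 / K), by positivity, fun ε hε hεle φ hφ h1 hφε => ?_⟩
  have hε1 : ε ≤ 1 := hεle.trans (min_le_left _ _)
  have hεK : ε * K ≤ 1 := by
    rw [← le_div_iff₀ hKpos]; exact hεle.trans (min_le_right _ _)
  set m : ℝ → ℝ := fun x => Real.exp (2 * θ x) with hm
  have hms : ContDiffOn ℝ ((⊤ : ℕ∞) : WithTop ℕ∞) m (Ioo (-L) L) :=
    (contDiffOn_const.mul hθ).exp
  set χ : ℝ → ℝ := fun x => m x * φ x with hχ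
  have hχt : IsTestX L χ := hφ.mul_left hms
  have hχd : ∀ x ∈ Ioo (-L) L, deriv χ x = m x * (deriv φ x + 2 * deriv θ x * φ x) := by
    intro x hx
    have hθx : HasDerivAt θ (deriv θ x) x :=
      ((hθ.contDiffAt (isOpen_Ioo.mem_nhds hx)).differentiableAt (by simp)).hasDerivAt
    have h2 := ((hθx.const_mul 2).exp.mul (hφ.differentiable x).hasDerivAt).deriv
    refine h2.trans ?_
    simp only [hm]
    ring
  have hmE : ∀ x ∈ Ioo (-L) L, m x ≤ E := fun x hx => by
    simp only [hm, hE]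
    gcongr
    exact (le_abs_self _).trans (hθ0 x hx)
  have hm0 : ∀ x, 0 < m x := fun x => Real.exp_pos _
  have hχ2 : ∫ x, χ x ^ 2 ∂measX L ≤ E ^ 2 := by
    calc ∫ x, χ x ^ 2 ∂measX L ≤ ∫ x, E ^ 2 * φ x ^ 2 ∂measX L := by
          refine integral_mono_ae (hχt.memLp 2).integrable_sq
            ((hφ.memLp 2).integrable_sq.const_mul _) (ae_restrict_of_forall_mem measurableSet_Ioo
              fun x hx => ?_)
          simp only [hχ, mul_pow]
          have := hmE x hx
          have := (hm0 x).le
          gcongr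
      _ = E ^ 2 := by rw [integral_const_mul, h1, mul_one]
  have habs := abs_le.1 (abs_integral_potential_le hP hc hφ)
  have hφd2 : ∫ x, deriv φ x ^ 2 ∂measX L ≤ |l| + 1 + c := by
    rw [formX_self] at hφε
    rw [h1, mul_one] at habs
    linarith [le_abs_self l, habs.1]
  have hχd2 : ∫ x, deriv χ x ^ 2 ∂measX L ≤ 2 * E ^ 2 * (|l| + 1 + c + 4 * Θ ^ 2) := by
    calc ∫ x, deriv χ x ^ 2 ∂measX L
        ≤ ∫ x, 2 * E ^ 2 * (deriv φ x ^ 2 + 4 * Θ ^ 2 * φ x ^ 2) ∂measX L := by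
          refine integral_mono_ae (hχt.memLp_deriv 2).integrable_sq
            (((hφ.memLp_deriv 2).integrable_sq.add
              ((hφ.memLp 2).integrable_sq.const_mul _)).const_mul _)
            (ae_restrict_of_forall_mem measurableSet_Ioo fun x hx => ?_)
          dsimp only
          rw [hχd x hx, mul_pow, mul_comm 2 (E ^ 2), mul_assoc (E ^ 2)]
          have h3 := hmE x hx
          have h4 := (hm0 x).le
          have h5 : deriv θ x ^ 2 ≤ Θ ^ 2 := by rw [← sq_abs]; gcongr; exact hθ1 x hx
          gcongr
          have h6 : 4 * deriv θ x ^ 2 * φ x ^ 2 ≤ 4 * Θ ^ 2 * φ x ^ 2 := by gcongr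
          nlinarith [sq_nonneg (deriv φ x - 2 * deriv θ x * φ x)]
      _ = 2 * E ^ 2 * (∫ x, deriv φ x ^ 2 ∂measX L + 4 * Θ ^ 2) := by
          rw [integral_const_mul, integral_add (hφ.memLp_deriv 2).integrable_sq
            ((hφ.memLp 2).integrable_sq.const_mul _), integral_const_mul, h1, mul_one]
      _ ≤ _ := by gcongr
  have hS : formX L P χ χ - l * ∫ x, χ x ^ 2 ∂measX L ≤ K := by
    have h2 := (abs_le.1 (abs_integral_potential_le hP hc hχt)).2
    have h3 : 0 ≤ ∫ x, χ x ^ 2 ∂measX L := integral_nonneg fun x => sq_nonneg _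
    have h4 : (c + |l|) * ∫ x, χ x ^ 2 ∂measX L ≤ (c + |l|) * E ^ 2 := by gcongr
    have h5 := mul_le_mul_of_nonneg_right (neg_le_abs l) h3
    rw [formX_self]
    nlinarith
  have hq : formX L P φ χ - l * ∫ x, φ x * χ x ∂measX L ≤ 1 := by
    refine (abs_le_of_sq_le_sq' ?_ zero_le_one).2
    rw [one_pow]
    refine (form_quasimode hP hl hφ h1 hφε hχt).trans (le_trans ?_ hεK)
    gcongr
  have hθ'c : ContinuousOn (deriv θ) (Ioo (-L) L) :=
    hθ.continuousOn_deriv_of_isOpen isOpen_Ioo (by simp)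
  have hθ2 : MemLp (fun x => deriv θ x ^ 2) ⊤ (measX L) := by
    refine memLp_top_of_continuousOn (c := Θ ^ 2) (hθ'c.pow 2) fun x hx => ?_
    rw [abs_pow]
    gcongr
    exact hθ1 x hx
  have hint : Integrable (fun x => (P x - l - deriv θ x ^ 2) * (φ x * χ x)) (measX L) :=
    hφ.integrable_potential_mul ((hP.sub (memLp_const l)).sub hθ2) hχt
  refine ⟨hint, le_trans ?_ hq⟩
  have hi : Integrable (fun x => deriv φ x * deriv χ x + P x * (φ x * χ x)) (measX L) :=
    (hφ.integrable_deriv_mul hχt).add (hφ.integrable_potential_mul hP hχt)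
  rw [formX, ← integral_const_mul, ← integral_add (hφ.integrable_deriv_mul hχt)
    (hφ.integrable_potential_mul hP hχt), ← integral_sub hi ((hφ.integrable_mul hχt).const_mul _)]
  refine integral_mono_ae hint (hi.sub ((hφ.integrable_mul hχt).const_mul _))
    (ae_restrict_of_forall_mem measurableSet_Ioo fun x hx => ?_)
  -- Agmon's identity `φ' χ' = m ((φ' + θ' φ)² - θ'² φ²)`; dropping the square leaves the effective
  -- potential `P - l - θ'²`.
  have h6 : 0 ≤ m x * (deriv φ x + deriv θ x * φ x) ^ 2 := mul_nonneg (hm0 x).le (sq_nonneg _)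
  dsimp only
  rw [hχd x hx]
  simp only [hχ]
  nlinarith

set_option maxHeartbeats 1000000 in
/-- Near `0` the operator `-∂_x² + μ² q² + V` has quasimodes of energy at most `b μ + C` that are
exponentially small, in the Agmon sense, on `ω`. -/
theorem exists_longitudinal_quasimode {L b s a d σ κ q₀ Q₁ D₁ : ℝ} {q V D : ℝ → ℝ} {ω : Set ℝ}
    (hq : ContinuousOn q (Ioo (-L) L)) (hQ₁ : ∀ x ∈ Ioo (-L) L, |q x| ≤ Q₁)
    (hV : MemLp V ⊤ (measX L)) (hb : 0 ≤ b) (hs : 0 < s) (h2s : 2 * s < L)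
    (hqb : ∀ x, |x| ≤ 2 * s → |q x| ≤ b * |x|)
    (hD : ContDiffOn ℝ ((⊤ : ℕ∞) : WithTop ℕ∞) D (Ioo (-L) L))
    (hD0 : ∀ x ∈ Ioo (-L) L, |D x| ≤ D₁) (hDq : ∀ x ∈ Ioo (-L) L, |deriv D x| ≤ |q x|)
    (hω : MeasurableSet ω) (hωd : ∀ x ∈ ω, d ≤ D x)
    (hωa : ∀ x ∈ ω, a ≤ |x|) (hσ : 0 ≤ σ) (hDσ : ∀ x, |x| < a → D x ≤ σ) (hq₀ : 0 < q₀)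
    (hqa : ∀ x ∈ Ioo (-L) L, a ≤ |x| → q₀ ≤ |q x|) (hκ : 0 < κ) (hκ1 : κ < 1) :
    ∃ C M : ℝ, 0 ≤ C ∧ 0 < M ∧ ∀ μ, M ≤ μ → ∀ ε > 0, ∃ l φ, IsTestX L φ ∧
      ∫ x, φ x ^ 2 ∂measX L = 1 ∧ |l| ≤ b * μ + C ∧ ∫ x, deriv φ x ^ 2 ∂measX L ≤ b * μ + C ∧
      (∀ χ, IsTestX L χ →
        (formX L (fun x => V x + μ ^ 2 * q x ^ 2) φ χ - l * ∫ x, φ x * χ x ∂measX L) ^ 2 ≤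
          ε ^ 2 * (∫ x, χ x ^ 2 ∂measX L + ∫ x, deriv χ x ^ 2 ∂measX L)) ∧
      ∫ x in ω, φ x ^ 2 ∂measX L ≤ (1 + (b * μ + C)) * Real.exp (-(2 * μ * (κ * (d - σ)))) := by
  obtain ⟨v, hv0, hv⟩ := exists_ae_abs_le hV
  obtain ⟨C₀, hC₀, hgauss⟩ := exists_truncated_gaussian hs h2s
  -- `C₀` comes from the cutoff, one `v` from `V` in the upper bound on `l`, the other from `V ≥
  -- -v`, and `1` from the excess energy of the near-minimiser.
  set C := C₀ + 2 * v + 1 with hC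
  have hκ2 : 0 < 1 - κ ^ 2 := by nlinarith
  -- Beyond this threshold the quadratic barrier `(1 - κ²) μ² q₀²` exceeds the linear energy bound
  -- `b μ + C` by at least `1`.
  refine ⟨C, max 1 ((b + C + 1) / ((1 - κ ^ 2) * q₀ ^ 2)), by positivity, by positivity,
    fun μ hμ ε hε => ?_⟩
  have hμ1 : 1 ≤ μ := (le_max_left _ _).trans hμ
  have hμ0 : 0 < μ := by linarith
  have hμM : b * μ + C + 1 ≤ (1 - κ ^ 2) * μ ^ 2 * q₀ ^ 2 := by
    have h1 := (le_max_right _ _).trans hμ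
    rw [div_le_iff₀ (by positivity)] at h1
    have h2 : 0 ≤ C := by positivity
    nlinarith
  set P : ℝ → ℝ := fun x => V x + μ ^ 2 * q x ^ 2 with hPdef
  set c := v + μ ^ 2 * Q₁ ^ 2 with hc
  have hc0 : 0 ≤ c := by positivity
  have hq2 : MemLp (fun x => q x ^ 2) ⊤ (measX L) :=
    memLp_top_of_continuousOn (c := Q₁ ^ 2) (hq.pow 2) fun x hx => by
      rw [abs_pow]; gcongr; exact hQ₁ x hx
  have hP : MemLp P ⊤ (measX L) := hV.add (hq2.const_mul _)
  have hPc : ∀ᵐ x ∂measX L, |P x| ≤ c := by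
    filter_upwards [hv, ae_restrict_mem measurableSet_Ioo] with x h1 h2
    refine (abs_add_le _ _).trans (add_le_add h1 ?_)
    rw [abs_of_nonneg (by positivity), ← sq_abs (q x)]
    gcongr
    exact hQ₁ x h2
  have hPv : ∀ᵐ x ∂measX L, -v ≤ P x := by
    filter_upwards [hv] with x h1
    have : 0 ≤ μ ^ 2 * q x ^ 2 := by positivity
    linarith [(abs_le.1 h1).1]
  -- On the support of the trial state `μ² q² ≤ (b μ)² x²`, so the oscillator of frequency `b μ`
  -- dominates.
  obtain ⟨φ₀, hφ₀, hφ₀s, hφ₀pos, hφ₀le⟩ := hgauss (b * μ) (by positivity)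
  have hΛ : formX L P φ₀ φ₀ ≤ (b * μ + C₀ + v) * ∫ x, φ₀ x ^ 2 ∂measX L := by
    rw [formX_self, ← integral_add (hφ₀.memLp_deriv 2).integrable_sq
      (hφ₀.integrable_potential_mul hP hφ₀)]
    have hx2 : MemLp (fun x : ℝ => (b * μ) ^ 2 * x ^ 2) ⊤ (measX L) :=
      memLp_top_of_continuousOn (c := (b * μ) ^ 2 * L ^ 2) (by fun_prop) fun x hx => by
        rw [abs_of_nonneg (by positivity)]
        have : x ^ 2 ≤ L ^ 2 := sq_le_sq' hx.1.le hx.2.le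
        gcongr
    have hi : Integrable (fun x => deriv φ₀ x ^ 2 + (b * μ) ^ 2 * x ^ 2 * φ₀ x ^ 2) (measX L) := by
      refine (hφ₀.memLp_deriv 2).integrable_sq.add ?_
      simpa only [sq (φ₀ _)] using hφ₀.integrable_potential_mul hx2 hφ₀
    calc ∫ x, (deriv φ₀ x ^ 2 + P x * (φ₀ x * φ₀ x)) ∂measX L
        ≤ ∫ x, ((deriv φ₀ x ^ 2 + (b * μ) ^ 2 * x ^ 2 * φ₀ x ^ 2) + v * φ₀ x ^ 2) ∂measX L := by
          refine integral_mono_ae ((hφ₀.memLp_deriv 2).integrable_sq.add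
            (hφ₀.integrable_potential_mul hP hφ₀))
            (hi.add ((hφ₀.memLp 2).integrable_sq.const_mul _)) ?_
          filter_upwards [hv] with x h1
          by_cases hx : 2 * s ≤ |x|
          · simp [hφ₀s x hx]
          · have h3 : q x ^ 2 ≤ b ^ 2 * x ^ 2 := by
              rw [← sq_abs, ← sq_abs x, ← mul_pow]
              gcongr
              exact hqb x (not_le.1 hx).le
            have h4 : P x ≤ v + (b * μ) ^ 2 * x ^ 2 := by
              have : μ ^ 2 * q x ^ 2 ≤ μ ^ 2 * (b ^ 2 * x ^ 2) := by gcongr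
              simp only [hPdef]
              nlinarith [(abs_le.1 h1).2]
            have := mul_le_mul_of_nonneg_right h4 (sq_nonneg (φ₀ x))
            nlinarith
      _ ≤ _ := by
          rw [integral_add hi ((hφ₀.memLp 2).integrable_sq.const_mul _), integral_const_mul]
          linarith
  obtain ⟨l, hlv, hlΛ, hl, hmin⟩ := exists_form_bottom hP hPv ⟨φ₀, hφ₀, hφ₀pos, hΛ⟩
  have hbμ : 0 ≤ b * μ := by positivity
  have hl' : |l| + v ≤ b * μ + C := by
    have : |l| ≤ b * μ + C₀ + v := abs_le.2 ⟨by linarith, hlΛ⟩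
    linarith
  -- Since `|D'| ≤ |q|`, the factor `κ < 1` keeps the share `(1 - κ²) μ² q²` of the barrier in the
  -- effective potential.
  set θ : ℝ → ℝ := fun x => μ * κ * D x with hθ
  have hθd : ∀ x ∈ Ioo (-L) L, deriv θ x = μ * κ * deriv D x := fun x hx => by
    simp only [hθ, deriv_const_mul_field]
  -- `agmon_estimate` takes a single constant for `θ` and its derivative, hence the sum `D₁ + Q₁`.
  have hθ0 : ∀ x ∈ Ioo (-L) L, |θ x| ≤ μ * κ * (D₁ + Q₁) := by
    intro x hx
    simp only [hθ]
    rw [abs_mul, abs_of_pos (by positivity : 0 < μ * κ)]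
    have h1 := hD0 x hx
    have h2 := (abs_nonneg _).trans (hQ₁ x hx)
    gcongr
    linarith
  have hθ1 : ∀ x ∈ Ioo (-L) L, |deriv θ x| ≤ μ * κ * (D₁ + Q₁) := by
    intro x hx
    rw [hθd x hx, abs_mul, abs_of_pos (by positivity : 0 < μ * κ)]
    have h1 := (hDq x hx).trans (hQ₁ x hx)
    have h2 := (abs_nonneg _).trans (hD0 x hx)
    gcongr
    linarith
  obtain ⟨ε₀, hε₀, hagmon⟩ := agmon_estimate hc0 hP hPc hl (contDiffOn_const.mul hD) hθ0 hθ1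
  -- The last bound pays for replacing the shifted form of a test function by its `H¹` norm.
  set ε₁ := min (min ε₀ 1) (ε ^ 2 / (c + |l| + 1)) with hε₁
  have hε₁pos : 0 < ε₁ := by positivity
  obtain ⟨φ, hφ, h1, hφε⟩ := hmin ε₁ hε₁pos
  obtain ⟨hint, hag⟩ := hagmon ε₁ hε₁pos ((min_le_left _ _).trans (min_le_left _ _)) φ hφ h1 hφε
  refine ⟨l, φ, hφ, h1, by linarith, ?_, fun χ hχ => ?_, ?_⟩
  · have h2 : -v ≤ ∫ x, P x * (φ x * φ x) ∂measX L := by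
      have h3 : ∫ x, -v * φ x ^ 2 ∂measX L ≤ ∫ x, P x * (φ x * φ x) ∂measX L := by
        refine integral_mono_ae ((hφ.memLp 2).integrable_sq.const_mul _)
          (hφ.integrable_potential_mul hP hφ) ?_
        filter_upwards [hPv] with x hx
        rw [sq]
        exact mul_le_mul_of_nonneg_right hx (mul_self_nonneg _)
      rwa [integral_const_mul, h1, mul_one] at h3
    have h4 : ε₁ ≤ 1 := (min_le_left _ _).trans (min_le_right _ _)
    rw [formX_self] at hφε
    linarith
  · refine (form_quasimode hP hl hφ h1 hφε hχ).trans ?_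
    have h2 := (abs_le.1 (abs_integral_potential_le hP hPc hχ)).2
    have h3 : 0 ≤ ∫ x, χ x ^ 2 ∂measX L := integral_nonneg fun x => sq_nonneg _
    have h4 : 0 ≤ ∫ x, deriv χ x ^ 2 ∂measX L := integral_nonneg fun x => sq_nonneg _
    have h5 := mul_le_mul_of_nonneg_right (neg_le_abs l) h3
    have h6 : formX L P χ χ - l * ∫ x, χ x ^ 2 ∂measX L ≤
        (c + |l| + 1) * (∫ x, χ x ^ 2 ∂measX L + ∫ x, deriv χ x ^ 2 ∂measX L) := by
      rw [formX_self]
      nlinarith [mul_nonneg (add_nonneg hc0 (abs_nonneg l)) h4]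
    calc ε₁ * (formX L P χ χ - l * ∫ x, χ x ^ 2 ∂measX L)
        ≤ ε ^ 2 / (c + |l| + 1) *
          ((c + |l| + 1) * (∫ x, χ x ^ 2 ∂measX L + ∫ x, deriv χ x ^ 2 ∂measX L)) :=
          mul_le_mul (min_le_right _ _) h6 (by linarith [hl χ hχ]) (by positivity)
      _ = _ := by field_simp
  · set Λ := b * μ + C with hΛdef
    have hΛ0 : 0 ≤ Λ := by positivity
    set e₁ := Real.exp (2 * (μ * κ * d)) with he₁
    set e₂ := Real.exp (2 * (μ * κ * σ)) with he₂
    -- For `|x| ≥ a` the effective potential is at least `1`, with weight at least `e₁` on `ω`; for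
    -- `|x| < a` it is at least `-Λ`, with weight at most `e₂`. The mass of `φ` on `ω` is then at
    -- most of order `Λ e₂ / e₁`.
    have hpt : ∀ᵐ x ∂measX L, ω.indicator (fun x => e₁ * φ x ^ 2) x - Λ * e₂ * φ x ^ 2 ≤
        (P x - l - deriv θ x ^ 2) * (φ x * (Real.exp (2 * θ x) * φ x)) := by
      filter_upwards [hv, ae_restrict_mem measurableSet_Ioo] with x hvx hx
      have hθ2 : deriv θ x ^ 2 ≤ κ ^ 2 * (μ ^ 2 * q x ^ 2) := by
        rw [hθd x hx]
        have : deriv D x ^ 2 ≤ q x ^ 2 := sq_le_sq.2 (hDq x hx)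
        calc (μ * κ * deriv D x) ^ 2 = κ ^ 2 * (μ ^ 2 * deriv D x ^ 2) := by ring
          _ ≤ _ := by gcongr
      have hlow : (1 - κ ^ 2) * μ ^ 2 * q x ^ 2 - Λ ≤ P x - l - deriv θ x ^ 2 := by
        simp only [hPdef]
        linarith [(abs_le.1 hvx).1, le_abs_self l]
      have hE : 0 < Real.exp (2 * θ x) := Real.exp_pos _
      have hφ2 := sq_nonneg (φ x)
      have hrw : (P x - l - deriv θ x ^ 2) * (φ x * (Real.exp (2 * θ x) * φ x)) =
          (P x - l - deriv θ x ^ 2) * (Real.exp (2 * θ x) * φ x ^ 2) := by ring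
      rw [hrw]
      have he₂pos : 0 ≤ Λ * e₂ * φ x ^ 2 := by positivity
      by_cases hxa : a ≤ |x|
      · have h2 : 1 ≤ P x - l - deriv θ x ^ 2 := by
          have : q₀ ^ 2 ≤ q x ^ 2 := by
            rw [← sq_abs (q x)]; gcongr; exact hqa x hx hxa
          have : (1 - κ ^ 2) * μ ^ 2 * q₀ ^ 2 ≤ (1 - κ ^ 2) * μ ^ 2 * q x ^ 2 := by gcongr
          linarith
        have h3 : Real.exp (2 * θ x) * φ x ^ 2 ≤
            (P x - l - deriv θ x ^ 2) * (Real.exp (2 * θ x) * φ x ^ 2) :=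
          le_mul_of_one_le_left (by positivity) h2
        by_cases hxω : x ∈ ω
        · rw [indicator_of_mem hxω]
          have h4 : e₁ ≤ Real.exp (2 * θ x) := by
            simp only [he₁, hθ]
            have := hωd x hxω
            gcongr
          have h5 : e₁ * φ x ^ 2 ≤ Real.exp (2 * θ x) * φ x ^ 2 := by gcongr
          linarith
        · rw [indicator_of_notMem hxω]
          have : 0 ≤ Real.exp (2 * θ x) * φ x ^ 2 := by positivity
          linarith
      · rw [indicator_of_notMem fun h => hxa (hωa x h)]
        have h4 : Real.exp (2 * θ x) ≤ e₂ := by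
          simp only [he₂, hθ]
          have := hDσ x (not_le.1 hxa)
          gcongr
        have h5 : -Λ ≤ P x - l - deriv θ x ^ 2 := by
          have : 0 ≤ (1 - κ ^ 2) * μ ^ 2 * q x ^ 2 := by positivity
          linarith
        have h6 := mul_le_mul_of_nonneg_right h5
          (by positivity : 0 ≤ Real.exp (2 * θ x) * φ x ^ 2)
        have h7 : Λ * (Real.exp (2 * θ x) * φ x ^ 2) ≤ Λ * (e₂ * φ x ^ 2) := by gcongr
        linarith
    have hφi := (hφ.memLp 2).integrable_sq
    have hi1 : Integrable (ω.indicator fun x => e₁ * φ x ^ 2) (measX L) :=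
      (hφi.const_mul e₁).indicator hω
    have h3 := integral_mono_ae (hi1.sub (hφi.const_mul (Λ * e₂))) hint hpt
    simp only [Pi.sub_apply] at h3
    rw [integral_sub hi1 (hφi.const_mul _), integral_indicator hω, integral_const_mul,
      integral_const_mul, h1] at h3
    have he₂1 : 1 ≤ e₂ := Real.one_le_exp (by positivity)
    have h4 : e₁ * ∫ x in ω, φ x ^ 2 ∂measX L ≤ (1 + Λ) * e₂ := by nlinarith
    have he : Real.exp (-(2 * μ * (κ * (d - σ)))) = e₂ / e₁ := by
      rw [he₁, he₂, ← Real.exp_sub]; congr 1; ring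
    rw [he, ← mul_div_assoc, le_div_iff₀ (Real.exp_pos _)]
    linarith

/-! ### Products of longitudinal and transversal quasimodes. -/

theorem abs_mul_le_of_sq_le {ε a b N : ℝ} (hε : 0 < ε) (hb : b ^ 2 ≤ ε ^ 2 * N) :
    |a * b| ≤ ε / 2 * (a ^ 2 + N) := by
  -- Young's inequality weighted by `ε`; the resulting bound is additive in `a ^ 2` and `N`, so it
  -- can be integrated over slices.
  have h1 : 0 ≤ (ε * |a| - |b|) ^ 2 := sq_nonneg _
  have h2 : ε * (2 * |a * b|) ≤ ε * (ε * (a ^ 2 + N)) := by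
    rw [abs_mul]
    nlinarith [sq_abs a, sq_abs b]
  have := le_of_mul_le_mul_left h2 hε
  linarith

/-- The `x`-part of the error committed by a product of quasimodes. -/
theorem abs_longitudinal_error_le {L ε ν l : ℝ} {Y : YDomain} {q V φ ψ : ℝ → ℝ}
    {F : ℝ × ℝ → ℝ} (hL : 0 < L) (hε : 0 < ε) (hV : MemLp V ⊤ (measX L))
    (hq : MemLp (fun x => q x ^ 2) ⊤ (measX L)) (hφ : IsTestX L φ) (hψ : IsTestY Y ψ)
    (hψ1 : ∫ y, ψ y ^ 2 ∂measY Y = 1) (hF : IsTest L Y F)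
    (hF2 : MemLp F 2 ((measX L).prod (measY Y))) (hFx : MemLp (dx F) 2 ((measX L).prod (measY Y)))
    (hX : ∀ χ, IsTestX L χ →
      (formX L (fun x => V x + ν * q x ^ 2) φ χ - l * ∫ x, φ x * χ x ∂measX L) ^ 2 ≤
        ε ^ 2 * (∫ x, χ x ^ 2 ∂measX L + ∫ x, deriv χ x ^ 2 ∂measX L)) :
    |∫ z, (dx F z * (deriv φ z.1 * ψ z.2) +
      F z * ((V z.1 + ν * q z.1 ^ 2 - l) * φ z.1 * ψ z.2)) ∂(measX L).prod (measY Y)| ≤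
      ε / 2 * (1 + (∫ z, F z ^ 2 ∂(measX L).prod (measY Y) +
        ∫ z, dx F z ^ 2 ∂(measX L).prod (measY Y))) := by
  set P : ℝ → ℝ := fun x => V x + ν * q x ^ 2 with hPdef
  have hP : MemLp P ⊤ (measX L) := hV.add (hq.const_mul ν)
  have hPl : MemLp (fun x => P x - l) ⊤ (measX L) := hP.sub (memLp_const l)
  have hm : MemLp (fun x => (P x - l) * φ x) 2 (measX L) := (hφ.memLp 2).mul hPl
  have hint : Integrable (fun z : ℝ × ℝ => dx F z * (deriv φ z.1 * ψ z.2) +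
      F z * ((P z.1 - l) * φ z.1 * ψ z.2)) ((measX L).prod (measY Y)) :=
    (hFx.integrable_mul (memLp_tensor (hφ.memLp_deriv 2) hψ.memLp)).add
      (hF2.integrable_mul (memLp_tensor hm hψ.memLp))
  -- For fixed `y` the slice of `F` is a test function in `x`, to which the longitudinal quasimode
  -- bound applies with weight `ψ y`.
  rw [integral_prod_symm _ hint]
  have hslice : ∀ y, ∫ x, (dx F (x, y) * (deriv φ x * ψ y) +
      F (x, y) * ((P x - l) * φ x * ψ y)) ∂measX L = ψ y * (formX L P φ (fun x => F (x, y)) -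
        l * ∫ x, φ x * F (x, y) ∂measX L) := by
    intro y
    have hχ := hF.slice_x hL y
    have hi : Integrable (fun x => deriv φ x * deriv (fun x => F (x, y)) x +
        P x * (φ x * F (x, y))) (measX L) :=
      (hφ.integrable_deriv_mul hχ).add (hφ.integrable_potential_mul hP hχ)
    rw [formX, ← integral_add (hφ.integrable_deriv_mul hχ) (hφ.integrable_potential_mul hP hχ),
      ← integral_const_mul, ← integral_sub hi ((hφ.integrable_mul hχ).const_mul _),
      ← integral_const_mul]
    congr 1
    funext x
    simp only [dx]
    ring
  have hN1 : Integrable (fun y => ∫ x, F (x, y) ^ 2 ∂measX L) (measY Y) :=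
    hF2.integrable_sq.integral_prod_right
  have hN2 : Integrable (fun y => ∫ x, dx F (x, y) ^ 2 ∂measX L) (measY Y) :=
    hFx.integrable_sq.integral_prod_right
  have hψi : Integrable (fun y => ψ y ^ 2) (measY Y) := hψ.memLp.integrable_sq
  rw [← Real.norm_eq_abs]
  refine (norm_integral_le_of_norm_le (g := fun y => ε / 2 * (ψ y ^ 2 +
    (∫ x, F (x, y) ^ 2 ∂measX L + ∫ x, dx F (x, y) ^ 2 ∂measX L)))
    ((hψi.add (hN1.add hN2)).const_mul _) (Filter.Eventually.of_forall fun y => ?_)).trans_eq ?_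
  · dsimp only
    rw [hslice y, Real.norm_eq_abs]
    exact abs_mul_le_of_sq_le hε (hX _ (hF.slice_x hL y))
  · have hN : Integrable (fun y => ∫ x, F (x, y) ^ 2 ∂measX L + ∫ x, dx F (x, y) ^ 2 ∂measX L)
        (measY Y) := hN1.add hN2
    rw [integral_const_mul, integral_add hψi hN, integral_add hN1 hN2, hψ1,
      ← integral_prod_symm _ hF2.integrable_sq, ← integral_prod_symm _ hFx.integrable_sq]

/-- The `y`-part of the error committed by a product of quasimodes. -/
theorem abs_transversal_error_le {L ε ν Q₁ : ℝ} {Y : YDomain} {q r φ ψ : ℝ → ℝ}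
    {F : ℝ × ℝ → ℝ} (hε : 0 < ε) (hr : IsTransversalCoeff Y r)
    (hq : MemLp q ⊤ (measX L)) (hq2 : MemLp (fun x => q x ^ 2) ⊤ (measX L))
    (hQ₁ : ∀ x ∈ Ioo (-L) L, |q x| ≤ Q₁) (hφ : IsTestX L φ) (hψ : IsTestY Y ψ)
    (hφ1 : ∫ x, φ x ^ 2 ∂measX L = 1) (hF : IsTest L Y F)
    (hF2 : MemLp F 2 ((measX L).prod (measY Y)))
    (hFY : MemLp (dY q r F) 2 ((measX L).prod (measY Y)))
    (hY : ∀ χ, IsTestY Y χ →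
      (∫ y, (r y * deriv ψ y) * (r y * deriv χ y) ∂measY Y - ν * ∫ y, ψ y * χ y ∂measY Y) ^ 2
        ≤ ε ^ 2 * (∫ y, χ y ^ 2 ∂measY Y + ∫ y, (r y * deriv χ y) ^ 2 ∂measY Y)) :
    |∫ z, (dY q r F z * (q z.1 * φ z.1 * (r z.2 * deriv ψ z.2)) -
      F z * (ν * q z.1 ^ 2 * φ z.1 * ψ z.2)) ∂(measX L).prod (measY Y)| ≤
      ε / 2 * (Q₁ ^ 2 + (Q₁ ^ 2 * ∫ z, F z ^ 2 ∂(measX L).prod (measY Y) +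
        ∫ z, dY q r F z ^ 2 ∂(measX L).prod (measY Y))) := by
  have hm1 : MemLp (fun x => q x * φ x) 2 (measX L) := (hφ.memLp 2).mul hq
  have hm2 : MemLp (fun x => ν * q x ^ 2 * φ x) 2 (measX L) := (hφ.memLp 2).mul (hq2.const_mul ν)
  have hint : Integrable (fun z : ℝ × ℝ => dY q r F z * (q z.1 * φ z.1 * (r z.2 * deriv ψ z.2)) -
      F z * (ν * q z.1 ^ 2 * φ z.1 * ψ z.2)) ((measX L).prod (measY Y)) :=
    (hFY.integrable_mul (memLp_tensor hm1 (hψ.memLp_deriv hr))).sub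
      (hF2.integrable_mul (memLp_tensor hm2 hψ.memLp))
  rw [integral_prod _ hint]
  -- One factor `q` stays with `φ`, the other with the transversal error: its square then carries
  -- `q²`, which is exactly the weight present in `dY q r F`.
  have hslice : ∀ x, ∫ y, (dY q r F (x, y) * (q x * φ x * (r y * deriv ψ y)) -
      F (x, y) * (ν * q x ^ 2 * φ x * ψ y)) ∂measY Y =
        (q x * φ x) * (q x * (∫ y, (r y * deriv ψ y) * (r y * deriv (fun y => F (x, y)) y) ∂measY Y -
          ν * ∫ y, ψ y * F (x, y) ∂measY Y)) := by
    intro x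
    have hχ := hF.slice_y x
    have hi1 : Integrable (fun y => (r y * deriv ψ y) * (r y * deriv (fun y => F (x, y)) y))
        (measY Y) := (hψ.memLp_deriv hr).integrable_mul (hχ.memLp_deriv hr)
    have hi2 : Integrable (fun y => ψ y * F (x, y)) (measY Y) := hψ.memLp.integrable_mul hχ.memLp
    rw [← integral_const_mul, ← integral_sub hi1 (hi2.const_mul _), ← integral_const_mul,
      ← integral_const_mul]
    congr 1
    funext y
    simp only [dY]
    ring
  have hN1 : Integrable (fun x => ∫ y, F (x, y) ^ 2 ∂measY Y) (measX L) :=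
    hF2.integrable_sq.integral_prod_left
  have hN2 : Integrable (fun x => ∫ y, dY q r F (x, y) ^ 2 ∂measY Y) (measX L) :=
    hFY.integrable_sq.integral_prod_left
  have hφi : Integrable (fun x => φ x ^ 2) (measX L) := (hφ.memLp 2).integrable_sq
  rw [← Real.norm_eq_abs]
  refine (norm_integral_le_of_norm_le (g := fun x => ε / 2 * (Q₁ ^ 2 * φ x ^ 2 +
    (Q₁ ^ 2 * ∫ y, F (x, y) ^ 2 ∂measY Y + ∫ y, dY q r F (x, y) ^ 2 ∂measY Y)))
    (((hφi.const_mul _).add ((hN1.const_mul _).add hN2)).const_mul _)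
    (ae_restrict_of_forall_mem measurableSet_Ioo fun x hx => ?_)).trans_eq ?_
  · dsimp only
    rw [hslice x, Real.norm_eq_abs]
    have hqx : q x ^ 2 ≤ Q₁ ^ 2 := by rw [← sq_abs]; gcongr; exact hQ₁ x hx
    have hdY : ∫ y, dY q r F (x, y) ^ 2 ∂measY Y =
        q x ^ 2 * ∫ y, (r y * deriv (fun y => F (x, y)) y) ^ 2 ∂measY Y := by
      rw [← integral_const_mul]
      congr 1
      funext y
      simp only [dY]
      ring
    have h0 : 0 ≤ ∫ y, F (x, y) ^ 2 ∂measY Y := integral_nonneg fun y => sq_nonneg _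
    refine (abs_mul_le_of_sq_le (N := q x ^ 2 * ∫ y, F (x, y) ^ 2 ∂measY Y +
      ∫ y, dY q r F (x, y) ^ 2 ∂measY Y) hε ?_).trans ?_
    · rw [hdY, mul_pow, ← mul_add, mul_left_comm]
      exact mul_le_mul_of_nonneg_left (hY _ (hF.slice_y x)) (sq_nonneg _)
    · rw [mul_pow]
      gcongr
  · have hN : Integrable (fun x => Q₁ ^ 2 * ∫ y, F (x, y) ^ 2 ∂measY Y +
        ∫ y, dY q r F (x, y) ^ 2 ∂measY Y) (measX L) := (hN1.const_mul _).add hN2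
    rw [integral_const_mul, integral_add (hφi.const_mul _) hN, integral_add (hN1.const_mul _) hN2,
      integral_const_mul, integral_const_mul, hφ1, ← integral_prod _ hF2.integrable_sq,
      ← integral_prod _ hFY.integrable_sq, mul_one]

/-- A product of quasimodes is a quasimode, tested against the whole form domain. -/
theorem abs_form_error_le {L ε ν l Q₁ : ℝ} {Y : YDomain} {q r V φ ψ : ℝ → ℝ} (hL : 0 < L)
    (hε : 0 < ε) (hV : MemLp V ⊤ (measX L)) (hr : IsTransversalCoeff Y r)
    (hq : MemLp q ⊤ (measX L)) (hq2 : MemLp (fun x => q x ^ 2) ⊤ (measX L))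
    (hQ₁ : ∀ x ∈ Ioo (-L) L, |q x| ≤ Q₁) (hφ : IsTestX L φ) (hψ : IsTestY Y ψ)
    (hφ1 : ∫ x, φ x ^ 2 ∂measX L = 1) (hψ1 : ∫ y, ψ y ^ 2 ∂measY Y = 1)
    (hX : ∀ χ, IsTestX L χ →
      (formX L (fun x => V x + ν * q x ^ 2) φ χ - l * ∫ x, φ x * χ x ∂measX L) ^ 2 ≤
        ε ^ 2 * (∫ x, χ x ^ 2 ∂measX L + ∫ x, deriv χ x ^ 2 ∂measX L))
    (hY : ∀ χ, IsTestY Y χ →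
      (∫ y, (r y * deriv ψ y) * (r y * deriv χ y) ∂measY Y - ν * ∫ y, ψ y * χ y ∂measY Y) ^ 2
        ≤ ε ^ 2 * (∫ y, χ y ^ 2 ∂measY Y + ∫ y, (r y * deriv χ y) ^ 2 ∂measY Y))
    {w wx wY wV : L2 L Y} (hw : w =ᵐ[meas L Y] tensor φ ψ)
    (hwx : wx =ᵐ[meas L Y] dx (tensor φ ψ)) (hwY : wY =ᵐ[meas L Y] dY q r (tensor φ ψ))
    (hwV : wV =ᵐ[meas L Y] fun z => V z.1 * tensor φ ψ z)
    {p : L2 L Y × L2 L Y × L2 L Y} (hp : p ∈ formGraph L Y q r) :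
    |⟪p.2.1, wx⟫ + ⟪p.2.2, wY⟫ + ⟪p.1, wV⟫ - l * ⟪p.1, w⟫| ≤
      ε * (1 + Q₁ ^ 2) * (1 + (‖p.1‖ ^ 2 + ‖p.2.1‖ ^ 2 + ‖p.2.2‖ ^ 2)) := by
  -- Both sides are continuous in the triple, so it suffices to test on triples of test functions.
  refine closure_minimal (t := {p : L2 L Y × L2 L Y × L2 L Y |
    |⟪p.2.1, wx⟫ + ⟪p.2.2, wY⟫ + ⟪p.1, wV⟫ - l * ⟪p.1, w⟫| ≤
      ε * (1 + Q₁ ^ 2) * (1 + (‖p.1‖ ^ 2 + ‖p.2.1‖ ^ 2 + ‖p.2.2‖ ^ 2))}) ?_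
    (isClosed_le (by fun_prop) (by fun_prop)) hp
  rintro ⟨f, g, h⟩ ⟨F, hF, hf, hg, hh⟩
  simp only [mem_ofPred_eq] at hf hg hh ⊢
  have hF2 : MemLp F 2 ((measX L).prod (measY Y)) := by
    rw [← meas_eq_prod]; exact (memLp_congr_ae hf).1 (Lp.memLp f)
  have hFx : MemLp (dx F) 2 ((measX L).prod (measY Y)) := by
    rw [← meas_eq_prod]; exact (memLp_congr_ae hg).1 (Lp.memLp g)
  have hFY : MemLp (dY q r F) 2 ((measX L).prod (measY Y)) := by
    rw [← meas_eq_prod]; exact (memLp_congr_ae hh).1 (Lp.memLp h)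
  have hA := abs_longitudinal_error_le hL hε hV hq2 hφ hψ hψ1 hF hF2 hFx hX
  have hB := abs_transversal_error_le hε hr hq hq2 hQ₁ hφ hψ hφ1 hF hF2 hFY hY
  rw [inner_eq_integral hg hwx, inner_eq_integral hh hwY, inner_eq_integral hf hwV,
    inner_eq_integral hf hw, norm_sq_eq_integral hf, norm_sq_eq_integral hg,
    norm_sq_eq_integral hh, dx_tensor, dY_tensor, meas_eq_prod]
  have hm : MemLp (fun x => (V x + ν * q x ^ 2 - l) * φ x) 2 (measX L) :=
    (hφ.memLp 2).mul ((hV.add (hq2.const_mul ν)).sub (memLp_const l))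
  have hmV : MemLp (fun x => V x * φ x) 2 (measX L) := (hφ.memLp 2).mul hV
  have hm1 : MemLp (fun x => q x * φ x) 2 (measX L) := (hφ.memLp 2).mul hq
  have hm2 : MemLp (fun x => ν * q x ^ 2 * φ x) 2 (measX L) := (hφ.memLp 2).mul (hq2.const_mul ν)
  have i1 : Integrable (fun z => dx F z * (deriv φ z.1 * ψ z.2)) ((measX L).prod (measY Y)) :=
    hFx.integrable_mul (memLp_tensor (hφ.memLp_deriv 2) hψ.memLp)
  have i2 : Integrable (fun z => F z * ((V z.1 + ν * q z.1 ^ 2 - l) * φ z.1 * ψ z.2))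
      ((measX L).prod (measY Y)) := hF2.integrable_mul (memLp_tensor hm hψ.memLp)
  have i3 : Integrable (fun z => dY q r F z * (q z.1 * φ z.1 * (r z.2 * deriv ψ z.2)))
      ((measX L).prod (measY Y)) := hFY.integrable_mul (memLp_tensor hm1 (hψ.memLp_deriv hr))
  have i4 : Integrable (fun z => F z * (ν * q z.1 ^ 2 * φ z.1 * ψ z.2))
      ((measX L).prod (measY Y)) := hF2.integrable_mul (memLp_tensor hm2 hψ.memLp)
  have i5 : Integrable (fun z => F z * (V z.1 * tensor φ ψ z)) ((measX L).prod (measY Y)) := by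
    refine (hF2.integrable_mul (memLp_tensor hmV hψ.memLp)).congr
      (Filter.Eventually.of_forall fun z => ?_)
    simp only [Pi.mul_apply, tensor]; ring
  have i6 : Integrable (fun z => F z * tensor φ ψ z) ((measX L).prod (measY Y)) :=
    hF2.integrable_mul (memLp_tensor (hφ.memLp 2) hψ.memLp)
  -- The separation constant `ν q²` is added to the `x`-part and subtracted from the `y`-part.
  have key : ∫ z, dx F z * tensor (deriv φ) ψ z ∂(measX L).prod (measY Y) +
      ∫ z, dY q r F z * tensor (fun x => q x * φ x) (fun y => r y * deriv ψ y) z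
        ∂(measX L).prod (measY Y) +
      ∫ z, F z * (V z.1 * tensor φ ψ z) ∂(measX L).prod (measY Y) -
      l * ∫ z, F z * tensor φ ψ z ∂(measX L).prod (measY Y) =
      ∫ z, (dx F z * (deriv φ z.1 * ψ z.2) +
        F z * ((V z.1 + ν * q z.1 ^ 2 - l) * φ z.1 * ψ z.2)) ∂(measX L).prod (measY Y) +
      ∫ z, (dY q r F z * (q z.1 * φ z.1 * (r z.2 * deriv ψ z.2)) -
        F z * (ν * q z.1 ^ 2 * φ z.1 * ψ z.2)) ∂(measX L).prod (measY Y) := by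
    have e : ∫ z, F z * ((V z.1 + ν * q z.1 ^ 2 - l) * φ z.1 * ψ z.2) ∂(measX L).prod (measY Y) =
        ∫ z, F z * (V z.1 * tensor φ ψ z) ∂(measX L).prod (measY Y) +
          ∫ z, F z * (ν * q z.1 ^ 2 * φ z.1 * ψ z.2) ∂(measX L).prod (measY Y) -
          l * ∫ z, F z * tensor φ ψ z ∂(measX L).prod (measY Y) := by
      have i7 : Integrable (fun z => F z * (V z.1 * tensor φ ψ z) +
        F z * (ν * q z.1 ^ 2 * φ z.1 * ψ z.2)) ((measX L).prod (measY Y)) := i5.add i4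
      rw [← integral_const_mul, ← integral_add i5 i4, ← integral_sub i7 (i6.const_mul _)]
      congr 1
      funext z
      simp only [tensor]
      ring
    rw [integral_add i1 i2, integral_sub i3 i4, e]
    simp only [tensor]
    ring
  rw [key]
  refine (abs_add_le _ _).trans ((add_le_add hA hB).trans ?_)
  have h1 : 0 ≤ ∫ z, F z ^ 2 ∂(measX L).prod (measY Y) := integral_nonneg fun _ => sq_nonneg _
  have h2 : 0 ≤ ∫ z, dx F z ^ 2 ∂(measX L).prod (measY Y) := integral_nonneg fun _ => sq_nonneg _
  have h3 : 0 ≤ ∫ z, dY q r F z ^ 2 ∂(measX L).prod (measY Y) :=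
    integral_nonneg fun _ => sq_nonneg _
  rw [mul_assoc, ← mul_add, div_mul_eq_mul_div, mul_div_assoc]
  gcongr
  have h4 := mul_nonneg (sq_nonneg Q₁) h1
  have h5 := mul_nonneg (sq_nonneg Q₁) h2
  have h6 := mul_nonneg (sq_nonneg Q₁) h3
  have h7 := sq_nonneg Q₁
  linarith

/-! ### Duality between controlled trajectories and quasimodes. -/

/-- Grönwall's inequality, backwards in time. -/
theorem abs_le_of_backward_integral_le {m : ℝ → ℝ} {T Λ K : ℝ} (hm : Continuous m) (hT : 0 ≤ T)
    (hΛ : 0 ≤ Λ) (h : ∀ t ∈ Icc 0 T, |m t| ≤ Λ * (∫ s in t..T, |m s|) + K) :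
    |m 0| ≤ K * Real.exp (Λ * T) := by
  set N : ℝ → ℝ := fun t => ∫ s in t..T, |m s| with hN
  have hNd : ∀ t, HasDerivAt N (-|m t|) t := fun t =>
    intervalIntegral.integral_hasDerivAt_left (hm.abs.intervalIntegrable _ _)
      (hm.abs.stronglyMeasurableAtFilter _ _) hm.abs.continuousAt
  have hEd : ∀ t, HasDerivAt (fun t : ℝ => Real.exp (Λ * t)) (Real.exp (Λ * t) * Λ) t := fun t => by
    simpa using ((hasDerivAt_id t).const_mul Λ).exp
  have hHd : ∀ t, HasDerivAt (fun t => Real.exp (Λ * t) * (Λ * N t + K))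
      (Real.exp (Λ * t) * Λ * (Λ * N t + K) + Real.exp (Λ * t) * (Λ * -|m t|)) t := fun t =>
    (hEd t).mul (((hNd t).const_mul Λ).add_const K)
  -- The derivative is `Λ exp (Λ t) (Λ N + K - |m|) ≥ 0`; at `T`, where `N` vanishes, the value is
  -- `K exp (Λ T)`.
  have hmono : MonotoneOn (fun t => Real.exp (Λ * t) * (Λ * N t + K)) (Icc 0 T) := by
    refine monotoneOn_of_deriv_nonneg (convex_Icc 0 T)
      (fun t _ => (hHd t).continuousAt.continuousWithinAt)
      (fun t _ => (hHd t).differentiableAt.differentiableWithinAt) fun t ht => ?_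
    rw [(hHd t).deriv]
    have h1 := h t (interior_subset ht)
    have h2 : 0 ≤ Real.exp (Λ * t) * Λ * (Λ * N t + K - |m t|) :=
      mul_nonneg (mul_nonneg (Real.exp_pos _).le hΛ) (by linarith)
    linarith
  have h1 := hmono (left_mem_Icc.2 hT) (right_mem_Icc.2 hT) hT
  have h2 : N T = 0 := by simp [hN]
  simp only [h2, mul_zero, Real.exp_zero, one_mul, zero_add] at h1
  linarith [h 0 (left_mem_Icc.2 hT)]

theorem setIntegral_Ioo_eq_intervalIntegral {t : ℝ} (ht : 0 ≤ t) (f : ℝ → ℝ) :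
    ∫ s in Ioo 0 t, f s = ∫ s in (0)..t, f s := by
  rw [intervalIntegral.integral_of_le ht, integral_Ioc_eq_integral_Ioo]

/-- If `f` is steered to `0`, the pairing of the initial state with a quasimode is controlled by
the precision of the quasimode and its mass on the control region. -/
theorem exists_abs_inner_initial_le {L T : ℝ} {Y : YDomain} {q r V : ℝ → ℝ} {W : Set (ℝ × ℝ)}
    {f₀ : L2 L Y} {u : ℝ × (ℝ × ℝ) → ℝ} {f : ℝ → L2 L Y} (hT : 0 < T)
    (hu : MemLp u 2 ((volume.restrict (Ioo 0 T)).prod ((meas L Y).restrict W)))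
    (hf : IsSolution L Y q r V W T f₀ u f) (hfT : f T = 0) :
    ∃ C : ℝ, ∀ (l Λ ε s : ℝ) (F : ℝ × ℝ → ℝ) (w wx wY wV : L2 L Y), |l| ≤ Λ → 0 ≤ ε → 0 < s →
      IsTest L Y F → w =ᵐ[meas L Y] F → wx =ᵐ[meas L Y] dx F → wY =ᵐ[meas L Y] dY q r F →
      (wV =ᵐ[meas L Y] fun z => V z.1 * F z) →
      (∀ p ∈ formGraph L Y q r, |⟪p.2.1, wx⟫ + ⟪p.2.2, wY⟫ + ⟪p.1, wV⟫ - l * ⟪p.1, w⟫| ≤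
        ε * (1 + (‖p.1‖ ^ 2 + ‖p.2.1‖ ^ 2 + ‖p.2.2‖ ^ 2))) →
      ∫ z in W, F z ^ 2 ∂meas L Y ≤ s ^ 2 →
      |⟪f₀, w⟫| ≤ C * (ε + s) * Real.exp (Λ * T) := by
  obtain ⟨hfc, hf0, g, h, hg, hh, hfgh, heq⟩ := hf
  have : SFinite (meas L Y) := by rw [meas_eq_prod]; infer_instance
  -- `f` is continuous only on `[0, T]`; freezing it beyond the endpoints makes it continuous on the
  -- line.
  set f' : ℝ → L2 L Y := fun t => f (projIcc 0 T hT.le t) with hf'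
  have hf'c : Continuous f' := hfc.domRestrict.comp continuous_projIcc
  have hf'e : ∀ t ∈ Icc 0 T, f' t = f t := fun t ht => by
    simp only [hf', projIcc_of_mem hT.le ht]
  have hg2 : Integrable (fun s => ‖g s‖ ^ 2) (volume.restrict (Ioo 0 T)) := hg.integrable_norm_pow (by simp)
  have hh2 : Integrable (fun s => ‖h s‖ ^ 2) (volume.restrict (Ioo 0 T)) := hh.integrable_norm_pow (by simp)
  have hcont : ∀ k : ℝ → ℝ, Continuous k → Integrable k (volume.restrict (Ioo 0 T)) := fun k hk =>
    (hk.integrableOn_Icc (a := 0) (b := T)).mono_set Ioo_subset_Icc_self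
  set n : ℝ → ℝ := fun s => 1 + (‖f' s‖ ^ 2 + ‖g s‖ ^ 2 + ‖h s‖ ^ 2) with hn
  have hni : Integrable n (volume.restrict (Ioo 0 T)) :=
    (hcont _ continuous_const).add (((hcont _ (by fun_prop)).add hg2).add hh2)
  have hn0 : ∀ s, 0 ≤ n s := fun s => by simp only [hn]; positivity
  set π := (volume.restrict (Ioo 0 T)).prod ((meas L Y).restrict W) with hπ
  set Cn := ∫ s in Ioo 0 T, n s with hCn
  set Cu := ∫ z, u z ^ 2 ∂π with hCu
  have hCn0 : 0 ≤ Cn := integral_nonneg hn0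
  have hCu0 : 0 ≤ Cu := integral_nonneg fun z => sq_nonneg _
  -- This constant involves the trajectory, the control and `T`, but not the quasimode, as uniform
  -- boundedness will require.
  refine ⟨Cn + (Cu + T), fun l Λ ε s F w wx wY wV hl hε hs hF hw hwx hwY hwV herr hW => ?_⟩
  have hΛ : 0 ≤ Λ := (abs_nonneg l).trans hl
  have hFm : MemLp F 2 ((meas L Y).restrict W) := by
    have : MemLp F 2 (meas L Y) := (memLp_congr_ae hw).1 (Lp.memLp w)
    exact this.restrict W
  have hFπ : MemLp (fun z : ℝ × (ℝ × ℝ) => F z.2) 2 π := hFm.comp_snd _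
  have huF : Integrable (fun z : ℝ × (ℝ × ℝ) => u z * F z.2) π := hu.integrable_mul hFπ
  set k : ℝ → ℝ := fun t => ∫ z in W, u (t, z) * F z ∂meas L Y with hk
  have hki : Integrable k (volume.restrict (Ioo 0 T)) := huF.integral_prod_left
  -- Young's inequality weighted by `s`, the bound for the norm of `F` on `W`.
  have hkle : ∫ t in Ioo 0 T, |k t| ≤ s * (Cu + T) := by
    calc ∫ t in Ioo 0 T, |k t| ≤ ∫ t in Ioo 0 T, ∫ z in W, |u (t, z) * F z| ∂meas L Y :=
          integral_mono hki.abs huF.abs.integral_prod_left fun t => abs_integral_le_integral_abs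
      _ = ∫ z, |u z * F z.2| ∂π := (integral_prod _ huF.abs).symm
      _ ≤ ∫ z, (s * u z ^ 2 + s⁻¹ * F z.2 ^ 2) ∂π := by
          refine integral_mono huF.abs ((hu.integrable_sq.const_mul _).add
            (hFπ.integrable_sq.const_mul _)) fun z => ?_
          have h1 : 0 ≤ s⁻¹ * (s * |u z| - |F z.2|) ^ 2 := by positivity
          have h2 : s⁻¹ * (s * |u z| - |F z.2|) ^ 2 =
              s * u z ^ 2 - 2 * |u z * F z.2| + s⁻¹ * F z.2 ^ 2 := by
            rw [abs_mul, ← sq_abs (u z), ← sq_abs (F z.2)]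
            field_simp
            ring
          dsimp only
          linarith [abs_nonneg (u z * F z.2)]
      _ = s * Cu + s⁻¹ * (T * ∫ z in W, F z ^ 2 ∂meas L Y) := by
          rw [integral_add (hu.integrable_sq.const_mul _) (hFπ.integrable_sq.const_mul _),
            integral_const_mul, integral_const_mul, integral_prod _ hFπ.integrable_sq]
          congr 2
          simp [hT.le]
      _ ≤ s * Cu + s⁻¹ * (T * s ^ 2) := by gcongr
      _ = s * (Cu + T) := by field_simp
  set B : ℝ → ℝ := fun t => ⟪g t, wx⟫ + ⟪h t, wY⟫ + ⟪f' t, wV⟫ with hB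
  have hgi : Integrable g (volume.restrict (Ioo 0 T)) := hg.integrable (by norm_num)
  have hhi : Integrable h (volume.restrict (Ioo 0 T)) := hh.integrable (by norm_num)
  have hBi : Integrable B (volume.restrict (Ioo 0 T)) :=
    ((hgi.inner_const wx).add (hhi.inner_const wY)).add (hcont _ (by fun_prop))
  set m : ℝ → ℝ := fun t => ⟪f' t, w⟫ with hm
  have hmc : Continuous m := by fun_prop
  have hweak : ∀ t ∈ Icc 0 T, m t + ∫ s in (0)..t, B s = m 0 + ∫ s in (0)..t, k s := by
    intro t ht
    have h1 := heq F hF t ht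
    rw [← setIntegral_Ioo_eq_intervalIntegral ht.1, ← setIntegral_Ioo_eq_intervalIntegral ht.1]
    have e1 : m t = ∫ z, f t z * F z ∂meas L Y := by
      simp only [hm]
      rw [hf'e t ht, inner_eq_integral (Filter.EventuallyEq.refl _ _) hw]
    have e2 : m 0 = ∫ z, f₀ z * F z ∂meas L Y := by
      simp only [hm]
      rw [hf'e 0 (left_mem_Icc.2 hT.le), hf0, inner_eq_integral (Filter.EventuallyEq.refl _ _) hw]
    have e3 : ∫ s in Ioo 0 t, B s = ∫ s in Ioo 0 t, ∫ z, (g s z * dx F z + h s z * dY q r F z +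
        V z.1 * f s z * F z) ∂meas L Y := by
      refine setIntegral_congr_fun measurableSet_Ioo fun s hs => ?_
      simp only [hB]
      rw [hf'e s ⟨hs.1.le, hs.2.le.trans ht.2⟩, inner_eq_integral (Filter.EventuallyEq.refl _ _) hwx,
        inner_eq_integral (Filter.EventuallyEq.refl _ _) hwY,
        inner_eq_integral (Filter.EventuallyEq.refl _ _) hwV]
      have i1 : Integrable (fun z => g s z * dx F z) (meas L Y) :=
        (Lp.memLp (g s)).integrable_mul ((memLp_congr_ae hwx).1 (Lp.memLp wx))
      have i2 : Integrable (fun z => h s z * dY q r F z) (meas L Y) :=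
        (Lp.memLp (h s)).integrable_mul ((memLp_congr_ae hwY).1 (Lp.memLp wY))
      have i3 : Integrable (fun z => f s z * (V z.1 * F z)) (meas L Y) :=
        (Lp.memLp (f s)).integrable_mul ((memLp_congr_ae hwV).1 (Lp.memLp wV))
      have i4 : Integrable (fun z => g s z * dx F z + h s z * dY q r F z) (meas L Y) := i1.add i2
      rw [← integral_add i1 i2, ← integral_add i4 i3]
      congr 1
      funext z
      ring
    rw [e1, e2, e3]
    exact h1
  have hmT : m T = 0 := by
    simp only [hm]
    rw [hf'e T (right_mem_Icc.2 hT.le), hfT, inner_zero_left]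
  have hii : ∀ {φ : ℝ → ℝ}, Integrable φ (volume.restrict (Ioo 0 T)) → ∀ {a b : ℝ},
      a ∈ Icc 0 T → b ∈ Icc 0 T → IntervalIntegrable φ volume a b := by
    intro φ hφ a b ha hb
    have h1 : IntervalIntegrable φ volume 0 T :=
      (intervalIntegrable_iff_integrableOn_Ioo_of_le hT.le).2 hφ
    refine h1.mono_set ?_
    rw [uIcc_of_le hT.le]
    exact uIcc_subset_Icc ha hb
  -- At almost every time the trajectory lies in the form graph, so the quasimode bound turns `B`
  -- into `l m` up to `ε n`.
  have hBl : ∀ᵐ t ∂volume.restrict (Ioo 0 T), |B t| ≤ Λ * |m t| + ε * n t := by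
    filter_upwards [hfgh, ae_restrict_mem measurableSet_Ioo] with t ht ht'
    have h1 := herr _ ht
    rw [← hf'e t ⟨ht'.1.le, ht'.2.le⟩] at h1
    have h2 : |B t - l * m t| ≤ ε * n t := h1
    have h3 : |l * m t| ≤ Λ * |m t| := by
      rw [abs_mul]; exact mul_le_mul_of_nonneg_right hl (abs_nonneg _)
    calc |B t| = |(B t - l * m t) + l * m t| := by ring_nf
      _ ≤ |B t - l * m t| + |l * m t| := abs_add_le _ _
      _ ≤ _ := by linarith
  have h0mem : (0 : ℝ) ∈ Icc 0 T := left_mem_Icc.2 hT.le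
  have hTmem : T ∈ Icc 0 T := right_mem_Icc.2 hT.le
  have hbound : ∀ t ∈ Icc 0 T, |m t| ≤ Λ * (∫ s in t..T, |m s|) + (ε * Cn + s * (Cu + T)) := by
    intro t ht
    have h1 := hweak t ht
    have h2 := hweak T hTmem
    have h3 := intervalIntegral.integral_add_adjacent_intervals (hii hBi h0mem ht) (hii hBi ht hTmem)
    have h4 := intervalIntegral.integral_add_adjacent_intervals (hii hki h0mem ht) (hii hki ht hTmem)
    -- Difference of the weak formulations at `t` and `T`, with `m T = 0`.
    have hmt : m t = (∫ s in t..T, B s) - ∫ s in t..T, k s := by linarith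
    have hsub : Ioo t T ⊆ Ioo 0 T := Ioo_subset_Ioo_left ht.1
    have hset : ∀ φ : ℝ → ℝ, ∫ s in t..T, φ s = ∫ s in Ioo t T, φ s := fun φ => by
      rw [intervalIntegral.integral_of_le ht.2, integral_Ioc_eq_integral_Ioo]
    have h5 : |∫ s in t..T, B s| ≤ Λ * (∫ s in t..T, |m s|) + ε * Cn := by
      rw [hset, hset]
      calc |∫ s in Ioo t T, B s| ≤ ∫ s in Ioo t T, |B s| := abs_integral_le_integral_abs
        _ ≤ ∫ s in Ioo t T, (Λ * |m s| + ε * n s) := by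
            refine integral_mono_ae (hBi.abs.mono_measure (Measure.restrict_mono hsub le_rfl))
              ((((hcont _ hmc.abs).const_mul _).add (hni.const_mul _)).mono_measure
                (Measure.restrict_mono hsub le_rfl)) ?_
            exact (ae_mono (Measure.restrict_mono hsub le_rfl)) hBl
        _ = Λ * (∫ s in Ioo t T, |m s|) + ε * ∫ s in Ioo t T, n s := by
            rw [integral_add (((hcont _ hmc.abs).const_mul _).mono_measure
              (Measure.restrict_mono hsub le_rfl)) ((hni.const_mul _).mono_measure
              (Measure.restrict_mono hsub le_rfl)), integral_const_mul, integral_const_mul]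
        _ ≤ _ := by
            gcongr
            exact setIntegral_mono_set hni (Filter.Eventually.of_forall hn0) hsub.eventuallyLE
    have h6 : |∫ s in t..T, k s| ≤ s * (Cu + T) := by
      rw [hset]
      refine abs_integral_le_integral_abs.trans (le_trans ?_ hkle)
      exact setIntegral_mono_set hki.abs (Filter.Eventually.of_forall fun _ => abs_nonneg _)
        hsub.eventuallyLE
    rw [hmt]
    refine (abs_sub _ _).trans ?_
    linarith
  have hfin := abs_le_of_backward_integral_le hmc hT.le hΛ hbound
  have hm0 : m 0 = ⟪f₀, w⟫ := by
    simp only [hm]; rw [hf'e 0 h0mem, hf0]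
  rw [hm0] at hfin
  refine hfin.trans ?_
  gcongr
  nlinarith [mul_nonneg hs.le hCn0, mul_nonneg hε (add_nonneg hCu0 hT.le)]

/-! ### The uniform boundedness argument. -/

theorem IsTest.differentiableAt_slice_x {L : ℝ} {Y : YDomain} {F : ℝ × ℝ → ℝ} (h : IsTest L Y F)
    (x y : ℝ) : DifferentiableAt ℝ (fun x => F (x, y)) x :=
  (h.smooth.comp (contDiff_id.prodMk contDiff_const)).differentiable (by simp) x

theorem IsTest.differentiableAt_slice_y {L : ℝ} {Y : YDomain} {F : ℝ × ℝ → ℝ} (h : IsTest L Y F)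
    (x y : ℝ) : DifferentiableAt ℝ (fun y => F (x, y)) y :=
  (h.smooth.comp (contDiff_const.prodMk contDiff_id)).differentiable (by simp) y

theorem isTest_zero {L : ℝ} (hL : 0 < L) (Y : YDomain) : IsTest L Y 0 := by
  have h0 : HasCompactSupport (0 : ℝ × ℝ → ℝ) := HasCompactSupport.zero
  cases Y
  · exact ⟨contDiff_const, h0, by simp⟩
  · exact ⟨contDiff_const, fun x y => rfl, 0, hL, fun x y _ => rfl⟩
  · exact ⟨contDiff_const, h0, by simp⟩

/-- The triples `(φ, ∂_x φ, q r ∂_y φ)` of test functions. -/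
def testTriples {L : ℝ} (hL : 0 < L) (Y : YDomain) (q r : ℝ → ℝ) :
    Submodule ℝ (L2 L Y × L2 L Y × L2 L Y) where
  carrier := {p | ∃ φ, IsTest L Y φ ∧ p.1 =ᵐ[meas L Y] φ ∧ p.2.1 =ᵐ[meas L Y] dx φ ∧
    p.2.2 =ᵐ[meas L Y] dY q r φ}
  add_mem' := by
    rintro p p' ⟨F, hF, h1, h2, h3⟩ ⟨G, hG, h4, h5, h6⟩
    refine ⟨F + G, hF.add hG, (Lp.coeFn_add _ _).trans (h1.add h4), ?_, ?_⟩
    · refine (Lp.coeFn_add _ _).trans ((h2.add h5).trans (Filter.Eventually.of_forall fun z => ?_))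
      exact (deriv_add (hF.differentiableAt_slice_x z.1 z.2)
        (hG.differentiableAt_slice_x z.1 z.2)).symm
    · refine (Lp.coeFn_add _ _).trans ((h3.add h6).trans (Filter.Eventually.of_forall fun z => ?_))
      have := deriv_add (hF.differentiableAt_slice_y z.1 z.2) (hG.differentiableAt_slice_y z.1 z.2)
      change q z.1 * r z.2 * _ + q z.1 * r z.2 * _ =
        q z.1 * r z.2 * deriv ((fun y => F (z.1, y)) + fun y => G (z.1, y)) z.2
      rw [this, mul_add]
  zero_mem' := by
    refine ⟨0, isTest_zero hL Y, Lp.coeFn_zero _ _ _, ?_, ?_⟩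
    · refine (Lp.coeFn_zero _ _ _).trans (Filter.Eventually.of_forall fun z => ?_)
      simp [dx]
    · refine (Lp.coeFn_zero _ _ _).trans (Filter.Eventually.of_forall fun z => ?_)
      simp [dY]
  smul_mem' := by
    rintro c p ⟨F, hF, h1, h2, h3⟩
    refine ⟨c • F, hF.const_smul c, (Lp.coeFn_smul _ _).trans (h1.const_smul c), ?_, ?_⟩
    · refine (Lp.coeFn_smul _ _).trans ((h2.const_smul c).trans
        (Filter.Eventually.of_forall fun z => ?_))
      exact (deriv_const_smul c (hF.differentiableAt_slice_x z.1 z.2)).symm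
    · refine (Lp.coeFn_smul _ _).trans ((h3.const_smul c).trans
        (Filter.Eventually.of_forall fun z => ?_))
      have := deriv_const_smul c (hF.differentiableAt_slice_y z.1 z.2)
      change c * (q z.1 * r z.2 * _) =
        q z.1 * r z.2 * deriv (c • fun y => F (z.1, y)) z.2
      rw [this, smul_eq_mul]
      ring

theorem integral_strip_tensor_sq {L : ℝ} {Y : YDomain} {ω : Set ℝ} (φ ψ : ℝ → ℝ) :
    ∫ z in ω ×ˢ Y.carrier, tensor φ ψ z ^ 2 ∂meas L Y =
      (∫ x in ω, φ x ^ 2 ∂measX L) * ∫ y, ψ y ^ 2 ∂measY Y := by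
  rw [meas_eq_prod, ← Measure.prod_restrict, Measure.restrict_restrict_of_subset subset_rfl,
    integral_tensor_sq]

/-- Quasimodes with energy growing more slowly than their decay on the control region obstruct
null controllability. -/
theorem exists_not_steerable_of_quasimodes {L T b C d Q : ℝ} {Y : YDomain} {q r V : ℝ → ℝ}
    {W : Set (ℝ × ℝ)} (hL : 0 < L) (hT : 0 < T) (hb : 0 ≤ b) (hC : 0 ≤ C) (hQ : 0 ≤ Q)
    (hd : b * T < d)
    (h : ∀ n : ℕ, ∃ (μ l : ℝ) (F : ℝ × ℝ → ℝ) (w wx wY wV : L2 L Y), 1 ≤ μ ∧ (n : ℝ) ≤ μ ∧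
      |l| ≤ b * μ + C ∧ IsTest L Y F ∧ w =ᵐ[meas L Y] F ∧ wx =ᵐ[meas L Y] dx F ∧
      wY =ᵐ[meas L Y] dY q r F ∧ (wV =ᵐ[meas L Y] fun z => V z.1 * F z) ∧
      (∀ p ∈ formGraph L Y q r, |⟪p.2.1, wx⟫ + ⟪p.2.2, wY⟫ + ⟪p.1, wV⟫ - l * ⟪p.1, w⟫| ≤
        Real.exp (-(μ * d)) * (1 + Q) * (1 + (‖p.1‖ ^ 2 + ‖p.2.1‖ ^ 2 + ‖p.2.2‖ ^ 2))) ∧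
      ∫ z in W, F z ^ 2 ∂meas L Y ≤ (1 + (b * μ + C)) * Real.exp (-(2 * μ * d)) ∧
      ‖w‖ = 1 ∧ ‖wx‖ ^ 2 ≤ b * μ + C ∧ ‖wY‖ ^ 2 ≤ Q * (2 * μ ^ 2 + 2)) :
    ∃ f₀ ∈ formDomain L Y q r, ¬ Steerable L Y q r V W T f₀ := by
  by_contra hcon
  push Not at hcon
  choose μ l F w wx wY wV hμ1 hμn hl hF hw hwx hwY hwV herr hW hw1 hwxn hwYn using h
  set G := (testTriples hL Y q r).topologicalClosure with hG
  have : CompleteSpace G := (testTriples hL Y q r).isClosed_topologicalClosure.completeSpace_coe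
  set ε : ℕ → ℝ := fun n => Real.exp (-(μ n * d)) * (1 + Q) with hε
  set s : ℕ → ℝ := fun n => (1 + (b * μ n + C)) * Real.exp (-(μ n * d)) with hs
  have hbμ : ∀ n, 0 ≤ b * μ n + C := fun n =>
    add_nonneg (mul_nonneg hb (by linarith [hμ1 n])) hC
  have hεpos : ∀ n, 0 < ε n := fun n => by positivity
  have hspos : ∀ n, 0 < s n := fun n => mul_pos (by linarith [hbμ n]) (Real.exp_pos _)
  have hWs : ∀ n, ∫ z in W, F n z ^ 2 ∂meas L Y ≤ s n ^ 2 := fun n => by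
    refine (hW n).trans ?_
    rw [hs, mul_pow, ← Real.exp_nat_mul]
    have e : ((2 : ℕ) : ℝ) * -(μ n * d) = -(2 * μ n * d) := by push_cast; ring
    rw [e]
    gcongr
    nlinarith [hbμ n]
  -- This normalisation turns the duality estimate for each steerable state into pointwise
  -- boundedness of the functionals `ℓ n`.
  set c : ℕ → ℝ := fun n => ((ε n + s n) * Real.exp ((b * μ n + C) * T))⁻¹ with hc
  have hcpos : ∀ n, 0 < c n := fun n =>
    inv_pos.2 (mul_pos (add_pos (hεpos n) (hspos n)) (Real.exp_pos _))
  set ℓ : ℕ → G →L[ℝ] ℝ := fun n =>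
    c n • ((innerSL ℝ (w n)).comp ((ContinuousLinearMap.fst ℝ _ _).comp G.subtypeL)) with hℓ
  have hℓv : ∀ n (p : G), ℓ n p = c n * ⟪(p : L2 L Y × L2 L Y × L2 L Y).1, w n⟫ := fun n p => by
    simp [hℓ, real_inner_comm]
  have hptw : ∀ p : G, ∃ K, ∀ n, ‖ℓ n p‖ ≤ K := by
    intro p
    obtain ⟨u, hu, f, hf, hfT⟩ := hcon (p : L2 L Y × L2 L Y × L2 L Y).1 ⟨_, _, p.2⟩
    obtain ⟨K, hK⟩ := exists_abs_inner_initial_le hT hu hf hfT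
    refine ⟨K, fun n => ?_⟩
    have h1 := hK (l n) (b * μ n + C) (ε n) (s n) (F n) (w n) (wx n) (wY n) (wV n) (hl n)
      (hεpos n).le (hspos n) (hF n) (hw n) (hwx n) (hwY n) (hwV n) (herr n) (hWs n)
    rw [hℓv, Real.norm_eq_abs, abs_mul, abs_of_pos (hcpos n), hc,
      inv_mul_le_iff₀ (mul_pos (add_pos (hεpos n) (hspos n)) (Real.exp_pos _))]
    linarith
  -- Every state of the form domain is assumed steerable, so the functionals are pointwise bounded
  -- on the complete space `G`; one `K` now serves all states.
  obtain ⟨K, hK⟩ := banach_steinhaus hptw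
  have hKn : 0 ≤ K := (norm_nonneg _).trans (hK 0)
  set A := 1 + b + C + 4 * Q with hA
  set A' := 2 + Q + b + C with hA'
  have hA0 : 0 ≤ A := by positivity
  have hA0' : 0 ≤ A' := by positivity
  have hfin : ∀ n, 1 ≤ K * A * A' * Real.exp (C * T) * (μ n ^ 3 * Real.exp (-((d - b * T) * μ n))) := by
    intro n
    have hμ := hμ1 n
    -- The `n`-th functional is evaluated at its own quasimode, whose graph norm grows at most like
    -- `μ ^ 2`.
    have hmem : (w n, wx n, wY n) ∈ G :=
      Submodule.le_topologicalClosure _ ⟨F n, hF n, hw n, hwx n, hwY n⟩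
    have h1 := (ℓ n).le_of_opNorm_le (hK n) ⟨_, hmem⟩
    rw [hℓv] at h1
    simp only [real_inner_self_eq_norm_sq, hw1 n, one_pow, mul_one] at h1
    rw [Real.norm_eq_abs, abs_of_pos (hcpos n), hc, inv_le_iff_one_le_mul₀
      (mul_pos (add_pos (hεpos n) (hspos n)) (Real.exp_pos _))] at h1
    have hb1 : b * μ n ≤ b * μ n ^ 2 := by gcongr; nlinarith
    have hμ2 : 1 ≤ μ n ^ 2 := one_le_pow₀ hμ
    have hnorm : ‖(⟨(w n, wx n, wY n), hmem⟩ : G)‖ ≤ A * μ n ^ 2 := by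
      have e : ‖(⟨(w n, wx n, wY n), hmem⟩ : G)‖ = max ‖w n‖ (max ‖wx n‖ ‖wY n‖) := rfl
      have hle : ∀ t : ℝ, t ≤ 1 + t ^ 2 := fun t => by nlinarith [sq_nonneg (t - 1)]
      have hC2 : C ≤ C * μ n ^ 2 := le_mul_of_one_le_right hC hμ2
      have hQ2 : Q ≤ Q * μ n ^ 2 := le_mul_of_one_le_right hQ hμ2
      have hb2 : 0 ≤ b * μ n ^ 2 := by positivity
      have e2 : A * μ n ^ 2 = μ n ^ 2 + b * μ n ^ 2 + C * μ n ^ 2 + 4 * (Q * μ n ^ 2) := by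
        rw [hA]; ring
      rw [e, e2]
      refine max_le ?_ (max_le ?_ ?_)
      · rw [hw1 n]; linarith
      · linarith [hle ‖wx n‖, hwxn n]
      · have := hwYn n
        linarith [hle ‖wY n‖]
    have hsum : ε n + s n ≤ A' * μ n * Real.exp (-(μ n * d)) := by
      have : ε n + s n = (2 + Q + b * μ n + C) * Real.exp (-(μ n * d)) := by
        simp only [hε, hs]; ring
      rw [this]
      gcongr
      rw [hA']
      nlinarith
    calc 1 ≤ K * ‖(⟨(w n, wx n, wY n), hmem⟩ : G)‖ *
          ((ε n + s n) * Real.exp ((b * μ n + C) * T)) := h1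
      _ ≤ K * (A * μ n ^ 2) * ((A' * μ n * Real.exp (-(μ n * d))) * Real.exp ((b * μ n + C) * T)) := by
          have := (add_pos (hεpos n) (hspos n)).le
          gcongr
      _ = K * A * A' * (μ n ^ 3 * (Real.exp (-(μ n * d)) * Real.exp ((b * μ n + C) * T))) := by ring
      _ = K * A * A' * (μ n ^ 3 * (Real.exp (C * T) * Real.exp (-((d - b * T) * μ n)))) := by
          have e : Real.exp (-(μ n * d)) * Real.exp ((b * μ n + C) * T) =
              Real.exp (C * T) * Real.exp (-((d - b * T) * μ n)) := by
            rw [← Real.exp_add, ← Real.exp_add]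
            congr 1
            ring
          rw [e]
      _ = _ := by ring
  have hpos : 0 < d - b * T := by linarith
  have hlim : Filter.Tendsto (fun n => K * A * A' * Real.exp (C * T) *
      (μ n ^ 3 * Real.exp (-((d - b * T) * μ n)))) Filter.atTop (nhds 0) := by
    have hμt : Filter.Tendsto μ Filter.atTop Filter.atTop :=
      Filter.tendsto_atTop_mono hμn tendsto_natCast_atTop_atTop
    have h1 := (Real.tendsto_pow_mul_exp_neg_atTop_nhds_zero 3).comp (hμt.const_mul_atTop hpos)
    have h2 := h1.const_mul (K * A * A' * Real.exp (C * T) * ((d - b * T) ^ 3)⁻¹)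
    rw [mul_zero] at h2
    refine h2.congr fun n => ?_
    simp only [Function.comp_apply]
    have h3 : ((d - b * T) ^ 3)⁻¹ * (d - b * T) ^ 3 = 1 := inv_mul_cancel₀ (by positivity)
    linear_combination (K * A * A' * Real.exp (C * T) *
      (μ n ^ 3 * Real.exp (-((d - b * T) * μ n)))) * h3
  exact absurd (ge_of_tendsto' hlim hfin) (by norm_num)

/-- The products of quasimodes at transversal energy `ν = μ²` meet the requirements of
`exists_not_steerable_of_quasimodes`. The hypothesis `hd` is the decisive balance: the dissipation
rate times `T` stays below the Agmon decay rate on `ω`. -/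
theorem exists_not_steerable {L T b s a d σ κ q₀ Q₁ D₁ : ℝ} {Y : YDomain} {q r V D : ℝ → ℝ}
    {ω : Set ℝ} (hT : 0 < T) (hr : IsTransversalCoeff Y r)
    (hq : ContinuousOn q (Ioo (-L) L)) (hQ₁ : ∀ x ∈ Ioo (-L) L, |q x| ≤ Q₁)
    (hV : MemLp V ⊤ (measX L)) (hb : 0 ≤ b) (hs : 0 < s) (h2s : 2 * s < L)
    (hqb : ∀ x, |x| ≤ 2 * s → |q x| ≤ b * |x|)
    (hD : ContDiffOn ℝ ((⊤ : ℕ∞) : WithTop ℕ∞) D (Ioo (-L) L))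
    (hD0 : ∀ x ∈ Ioo (-L) L, |D x| ≤ D₁) (hDq : ∀ x ∈ Ioo (-L) L, |deriv D x| ≤ |q x|)
    (hω : MeasurableSet ω) (hωd : ∀ x ∈ ω, d ≤ D x)
    (hωa : ∀ x ∈ ω, a ≤ |x|) (hσ : 0 ≤ σ) (hDσ : ∀ x, |x| < a → D x ≤ σ) (hq₀ : 0 < q₀)
    (hqa : ∀ x ∈ Ioo (-L) L, a ≤ |x| → q₀ ≤ |q x|) (hκ : 0 < κ) (hκ1 : κ < 1)
    (hd : b * T < κ * (d - σ)) :
    ∃ f₀ ∈ formDomain L Y q r, ¬ Steerable L Y q r V (ω ×ˢ Y.carrier) T f₀ := by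
  have hL : 0 < L := by linarith
  obtain ⟨C, M, hC, hM, hX⟩ := exists_longitudinal_quasimode hq hQ₁ hV hb hs h2s hqb hD hD0 hDq hω
    hωd hωa hσ hDσ hq₀ hqa hκ hκ1
  set d' := κ * (d - σ) with hd'
  have hd'pos : 0 < d' := lt_of_le_of_lt (by positivity) hd
  have hqm : MemLp q ⊤ (measX L) := memLp_top_of_continuousOn hq hQ₁
  have hq2 : MemLp (fun x => q x ^ 2) ⊤ (measX L) :=
    memLp_top_of_continuousOn (c := Q₁ ^ 2) (hq.pow 2) fun x hx => by
      rw [abs_pow]; gcongr; exact hQ₁ x hx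
  refine exists_not_steerable_of_quasimodes (Q := Q₁ ^ 2) hL hT hb hC (sq_nonneg _) hd fun n => ?_
  -- This energy level puts `√ν` above `1`, above `n` and above the threshold `M` of the
  -- longitudinal quasimodes.
  obtain ⟨ν, hν, hY⟩ := exists_transversal_quasimode hr ((max 1 (max (n : ℝ) M)) ^ 2)
  have hm1 : (1 : ℝ) ≤ max 1 (max (n : ℝ) M) := le_max_left _ _
  have hν0 : 0 ≤ ν := (sq_nonneg _).trans hν
  set μ := √ν with hμ
  have hμν : μ ^ 2 = ν := Real.sq_sqrt hν0
  have hμm : max 1 (max (n : ℝ) M) ≤ μ := Real.le_sqrt_of_sq_le hν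
  have hμ1 : 1 ≤ μ := hm1.trans hμm
  -- The precision is matched to the size on the control region.
  set ε := Real.exp (-(μ * d')) with hε
  have hεpos : 0 < ε := Real.exp_pos _
  have hε1 : ε ≤ 1 := Real.exp_le_one_iff.2 (by nlinarith)
  obtain ⟨ψ, hψ, hψ1, hψq⟩ := hY ε hεpos
  obtain ⟨l, φ, hφ, hφ1, hl, hφd, hφq, hφω⟩ :=
    hX μ ((le_max_right _ _).trans ((le_max_right _ _).trans hμm)) ε hεpos
  rw [hμν] at hφq
  have hmY : MemLp (fun x => q x * φ x) 2 (measX L) := (hφ.memLp 2).mul hqm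
  have hmV : MemLp (fun x => V x * φ x) 2 (measX L) := (hφ.memLp 2).mul hV
  have m1 : MemLp (tensor φ ψ) 2 (meas L Y) := by
    rw [meas_eq_prod]; exact memLp_tensor (hφ.memLp 2) hψ.memLp
  have m2 : MemLp (dx (tensor φ ψ)) 2 (meas L Y) := by
    rw [meas_eq_prod, dx_tensor]; exact memLp_tensor (hφ.memLp_deriv 2) hψ.memLp
  have m3 : MemLp (dY q r (tensor φ ψ)) 2 (meas L Y) := by
    rw [meas_eq_prod, dY_tensor]; exact memLp_tensor hmY (hψ.memLp_deriv hr)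
  have m4 : MemLp (fun z => V z.1 * tensor φ ψ z) 2 (meas L Y) := by
    have : (fun z : ℝ × ℝ => V z.1 * tensor φ ψ z) = tensor (fun x => V x * φ x) ψ := by
      funext z; simp only [tensor]; ring
    rw [meas_eq_prod, this]; exact memLp_tensor hmV hψ.memLp
  refine ⟨μ, l, tensor φ ψ, m1.toLp _, m2.toLp _, m3.toLp _, m4.toLp _, hμ1,
    (le_max_left _ _).trans ((le_max_right _ _).trans hμm), hl, hφ.tensor hψ, m1.coeFn_toLp,
    m2.coeFn_toLp, m3.coeFn_toLp, m4.coeFn_toLp, fun p hp => ?_, ?_, ?_, ?_, ?_⟩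
  · exact abs_form_error_le hL hεpos hV hr hqm hq2 hQ₁ hφ hψ hφ1 hψ1 hφq hψq m1.coeFn_toLp
      m2.coeFn_toLp m3.coeFn_toLp m4.coeFn_toLp hp
  · rw [integral_strip_tensor_sq, hψ1, mul_one]
    exact hφω
  · have h1 : ‖m1.toLp (tensor φ ψ)‖ ^ 2 = 1 := by
      rw [norm_sq_eq_integral m1.coeFn_toLp, meas_eq_prod, integral_tensor_sq, hφ1, hψ1, one_mul]
    exact (pow_eq_one_iff_of_nonneg (norm_nonneg _) two_ne_zero).1 h1
  · rw [norm_sq_eq_integral m2.coeFn_toLp, meas_eq_prod, dx_tensor, integral_tensor_sq, hψ1, mul_one]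
    exact hφd
  · rw [norm_sq_eq_integral m3.coeFn_toLp, meas_eq_prod, dY_tensor, integral_tensor_sq, hμν]
    set A := ∫ y, (r y * deriv ψ y) ^ 2 ∂measY Y with hA
    have hA0 : 0 ≤ A := integral_nonneg fun y => sq_nonneg _
    have h1 : (A - ν) ^ 2 ≤ 1 + A := by
      have h2 := hψq ψ hψ
      simp only [← sq, hψ1, mul_one] at h2
      refine h2.trans ?_
      have : ε ^ 2 ≤ 1 := pow_le_one₀ hεpos.le hε1
      nlinarith
    -- Otherwise `A - ν > A / 2 + 1`, whose square exceeds `1 + A`.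
    have h3 : A ≤ 2 * ν + 2 := by
      by_contra hlt
      push Not at hlt
      nlinarith
    have h4 : ∫ x, (q x * φ x) ^ 2 ∂measX L ≤ Q₁ ^ 2 := by
      calc ∫ x, (q x * φ x) ^ 2 ∂measX L ≤ ∫ x, Q₁ ^ 2 * φ x ^ 2 ∂measX L := by
            refine integral_mono_ae hmY.integrable_sq ((hφ.memLp 2).integrable_sq.const_mul _)
              (ae_restrict_of_forall_mem measurableSet_Ioo fun x hx => ?_)
            dsimp only
            rw [mul_pow, ← sq_abs (q x)]
            gcongr
            exact hQ₁ x hx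
        _ = Q₁ ^ 2 := by rw [integral_const_mul, hφ1, mul_one]
    gcongr

/-! ### Agmon weights and constants for the coefficient `q`. -/

theorem exists_agmon_loss {d e : ℝ} (he : 0 ≤ e) (hed : e < d) :
    ∃ κ σ : ℝ, 0 < κ ∧ κ < 1 ∧ 0 < σ ∧ e < κ * (d - σ) := by
  have hd : 0 < d := by linarith
  -- With `κ = 1 - η` and `σ = η d` one gets `κ (d - σ) = (1 - η)² d ≥ d - 2 η d = (d + e) / 2`.
  set η := (d - e) / (4 * d) with hη
  have h0 : 0 < η := div_pos (by linarith) (by linarith)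
  have h1 : η * (4 * d) = d - e := div_mul_cancel₀ _ (by positivity)
  have h2 : η ≤ 1 / 4 := by rw [hη, div_le_iff₀ (by positivity)]; linarith
  refine ⟨1 - η, η * d, by linarith, by linarith, by positivity, ?_⟩
  nlinarith [mul_nonneg (mul_self_nonneg η) hd.le]

section Primitive

variable {L : ℝ} {Q : ℝ → ℝ}

theorem hasDerivAt_primitive (hQ : ContinuousOn Q (Icc (-L) L)) {x : ℝ} (hx : x ∈ Ioo (-L) L) :
    HasDerivAt (fun x => ∫ s in (0)..x, Q s) (Q x) x := by
  have hL : 0 < L := by linarith [hx.1, hx.2]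
  have hx' : x ∈ Icc (-L) L := Ioo_subset_Icc_self hx
  refine intervalIntegral.integral_hasDerivAt_right ?_ ?_ ?_
  · refine (hQ.mono ?_).intervalIntegrable
    exact uIcc_subset_Icc ⟨by linarith, hL.le⟩ hx'
  · exact (hQ.mono Ioo_subset_Icc_self).stronglyMeasurableAtFilter isOpen_Ioo x hx
  · exact hQ.continuousAt (Icc_mem_nhds hx.1 hx.2)

theorem contDiffOn_primitive (hQ : ContDiffOn ℝ ((⊤ : ℕ∞) : WithTop ℕ∞) Q (Icc (-L) L)) :
    ContDiffOn ℝ ((⊤ : ℕ∞) : WithTop ℕ∞) (fun x => ∫ s in (0)..x, Q s) (Ioo (-L) L) := by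
  rw [contDiffOn_infty_iff_deriv_of_isOpen isOpen_Ioo]
  refine ⟨fun x hx => (hasDerivAt_primitive hQ.continuousOn hx).differentiableAt.differentiableWithinAt,
    (hQ.mono Ioo_subset_Icc_self).congr fun x hx => (hasDerivAt_primitive hQ.continuousOn hx).deriv⟩

theorem abs_primitive_le {c : ℝ} (hQ : ∀ x ∈ Icc (-L) L, |Q x| ≤ c) {x : ℝ}
    (hx : x ∈ Icc (-L) L) : |∫ s in (0)..x, Q s| ≤ c * |x| := by
  have h := intervalIntegral.norm_integral_le_of_norm_le_const (a := 0) (b := x) (C := c) (f := Q)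
    fun s hs => hQ s (uIcc_subset_Icc ⟨by linarith [hx.1, hx.2], by linarith [hx.1, hx.2]⟩ hx
      (uIoc_subset_uIcc hs))
  simpa using h

end Primitive

section Coefficient

variable {L : ℝ} {γ : ℕ} {q : ℝ → ℝ}

theorem IsGrushinCoeff.apply_zero (hq : IsGrushinCoeff L γ q) (hγ : 1 ≤ γ) : q 0 = 0 := by
  simpa using hq.deriv_zero 0 (by omega)

theorem IsGrushinCoeff.hasDerivAt_zero (hL : 0 < L) (hq : IsGrushinCoeff L γ q) :
    HasDerivAt q (deriv q 0) 0 :=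
  ((hq.smooth.contDiffAt (Icc_mem_nhds (by linarith) hL)).differentiableAt (by simp)).hasDerivAt

/-- Differentiability at the zero of `q`: any slope above `q'(0)` bounds `q` close enough to `0`.
This slope is the growth rate of the energy in `μ`. -/
theorem IsGrushinCoeff.exists_abs_le_near_zero (hL : 0 < L) (hq : IsGrushinCoeff L γ q)
    (hγ : 1 ≤ γ) {b : ℝ} (h0 : 0 ≤ deriv q 0) (hb : deriv q 0 < b) :
    ∃ s > 0, 2 * s < L ∧ ∀ x, |x| ≤ 2 * s → |q x| ≤ b * |x| := by
  have h1 := (hq.hasDerivAt_zero hL).isLittleO.def (sub_pos.2 hb)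
  obtain ⟨ρ, hρ, h2⟩ := Metric.eventually_nhds_iff.1 h1
  refine ⟨min ρ L / 4, by positivity, ?_, fun x hx => ?_⟩
  · linarith [min_le_right ρ L]
  · have h3 : dist x 0 < ρ := by
      rw [Real.dist_eq, sub_zero]
      have : 0 < min ρ L := by positivity
      linarith [min_le_left ρ L]
    have h4 := h2 h3
    simp only [hq.apply_zero hγ, sub_zero, smul_eq_mul, Real.norm_eq_abs] at h4
    calc |q x| = |(q x - x * deriv q 0) + x * deriv q 0| := by ring_nf
      _ ≤ |q x - x * deriv q 0| + |x * deriv q 0| := abs_add_le _ _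
      _ ≤ (b - deriv q 0) * |x| + |x| * deriv q 0 := by
          rw [abs_mul x, abs_of_nonneg h0]; gcongr
      _ = b * |x| := by ring

theorem IsGrushinCoeff.exists_le_abs_away (hq : IsGrushinCoeff L γ q) {a : ℝ} (ha : 0 < a) :
    ∃ q₀ > 0, ∀ x ∈ Icc (-L) L, a ≤ |x| → q₀ ≤ |q x| := by
  set S := Icc (-L) L ∩ {x | a ≤ |x|} with hS
  have hSc : IsCompact S := isCompact_Icc.inter_right (isClosed_le continuous_const continuous_abs)
  rcases S.eq_empty_or_nonempty with h0 | hne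
  · refine ⟨1, one_pos, fun x hx hax => ?_⟩
    have : x ∈ S := ⟨hx, hax⟩
    rw [h0] at this
    exact this.elim
  · obtain ⟨x₀, hx₀, hmin⟩ := hSc.exists_isMinOn hne
      (hq.smooth.continuousOn.abs.mono inter_subset_left)
    refine ⟨|q x₀|, abs_pos.2 (hq.ne_zero x₀ hx₀.1 ?_), fun x hx hax => hmin ⟨hx, hax⟩⟩
    rintro rfl
    have h := hx₀.2
    simp only [mem_ofPred_eq, abs_zero] at h
    linarith

/-- The obstruction to null controllability, for a weight `Q` dominated by `q`. -/
theorem IsGrushinCoeff.exists_not_steerable {T b d : ℝ} {Y : YDomain} {r V Q : ℝ → ℝ} {ω : Set ℝ}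
    (hL : 0 < L) (hT : 0 < T) (hγ : 1 ≤ γ) (hq : IsGrushinCoeff L γ q)
    (hr : IsTransversalCoeff Y r) (hV : MemLp V ⊤ (measX L)) (hω : MeasurableSet ω)
    (hω0 : 0 < Metric.infDist 0 ω)
    (hQ : ContDiffOn ℝ ((⊤ : ℕ∞) : WithTop ℕ∞) Q (Icc (-L) L))
    (hQq : ∀ x ∈ Icc (-L) L, |Q x| ≤ |q x|) (hωd : ∀ x ∈ ω, d ≤ ∫ s in (0)..x, Q s)
    (h0 : 0 ≤ deriv q 0) (hb : deriv q 0 < b) (hbT : b * T < d) :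
    ∃ f₀ ∈ formDomain L Y q r, ¬ Steerable L Y q r V (ω ×ˢ Y.carrier) T f₀ := by
  have hb0 : 0 ≤ b := h0.trans hb.le
  obtain ⟨κ, σ, hκ, hκ1, hσ, hloss⟩ := exists_agmon_loss (by positivity) hbT
  obtain ⟨s, hs, h2s, hqb⟩ := hq.exists_abs_le_near_zero hL hγ h0 hb
  obtain ⟨Q₁, hQ₁⟩ := isCompact_Icc.exists_bound_of_continuousOn hq.smooth.continuousOn
  have hQ₁' : ∀ x ∈ Icc (-L) L, |q x| ≤ Q₁ := hQ₁
  have hQ₁0 : 0 ≤ Q₁ := (abs_nonneg _).trans (hQ₁' 0 ⟨by linarith, hL.le⟩)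
  have hQb : ∀ x ∈ Icc (-L) L, |Q x| ≤ Q₁ := fun x hx => (hQq x hx).trans (hQ₁' x hx)
  -- The three bounds respectively place `|x| < a` inside `[-L, L]`, leave `ω` outside it, and keep
  -- the weight below `σ` on it.
  set a := min (min L (Metric.infDist 0 ω)) (σ / (Q₁ + 1)) with ha
  have hapos : 0 < a := by positivity
  obtain ⟨q₀, hq₀, hqa⟩ := hq.exists_le_abs_away hapos
  refine Grushin.exists_not_steerable (D := fun x => ∫ s in (0)..x, Q s) (Q₁ := Q₁) (D₁ := Q₁ * L)
    hT hr (hq.smooth.continuousOn.mono Ioo_subset_Icc_self)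
    (fun x hx => hQ₁' x (Ioo_subset_Icc_self hx)) hV hb0 hs h2s hqb (contDiffOn_primitive hQ)
    (fun x hx => ?_) (fun x hx => ?_) hω hωd (fun x hx => ?_) hσ.le (fun x hx => ?_) hq₀
    (fun x hx => hqa x (Ioo_subset_Icc_self hx)) hκ hκ1 hloss
  · refine (abs_primitive_le hQb (Ioo_subset_Icc_self hx)).trans ?_
    gcongr
    exact abs_le.2 (Ioo_subset_Icc_self hx)
  · rw [(hasDerivAt_primitive hQ.continuousOn hx).deriv]
    exact hQq x (Ioo_subset_Icc_self hx)
  · have := Metric.infDist_le_dist_of_mem (x := (0 : ℝ)) hx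
    rw [Real.dist_eq, zero_sub, abs_neg] at this
    exact ((min_le_left _ _).trans (min_le_right _ _)).trans this
  · have hxL : x ∈ Icc (-L) L :=
      abs_le.1 (hx.le.trans ((min_le_left _ _).trans (min_le_left _ _)))
    refine (le_abs_self _).trans ((abs_primitive_le hQb hxL).trans ?_)
    have h1 : |x| ≤ σ / (Q₁ + 1) := hx.le.trans (min_le_right _ _)
    rw [le_div_iff₀ (by positivity)] at h1
    nlinarith [abs_nonneg x]

/-- The derivative fixes the signs next to `0`; a later change of sign would create a second zero.
-/
theorem IsGrushinCoeff.pos_of_deriv_pos (hL : 0 < L) (hγ : 1 ≤ γ) (hq : IsGrushinCoeff L γ q)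
    (h : 0 < deriv q 0) : (∀ x ∈ Icc 0 L, 0 ≤ q x) ∧ ∀ x ∈ Icc (-L) 0, q x ≤ 0 := by
  have hd := hq.hasDerivAt_zero hL
  have h0 := hq.apply_zero hγ
  have hev := hd.isLittleO.def (half_pos h)
  obtain ⟨ρ, hρ, h2⟩ := Metric.eventually_nhds_iff.1 hev
  set t := min ρ L / 2 with ht
  have htpos : 0 < t := by positivity
  have htρ : t < ρ := by have := min_le_left ρ L; linarith
  have htL : t < L := by have := min_le_right ρ L; linarith
  have hpos : ∀ x, 0 < x → x ≤ t → 0 < q x := by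
    intro x hx hxt
    have h3 := h2 (y := x) (by rw [Real.dist_eq, sub_zero, abs_of_pos hx]; linarith)
    simp only [h0, sub_zero, smul_eq_mul, Real.norm_eq_abs, abs_of_pos hx] at h3
    nlinarith [(abs_le.1 h3).1, mul_pos hx h]
  have hneg : ∀ x, x < 0 → -t ≤ x → q x < 0 := by
    intro x hx hxt
    have h3 := h2 (y := x) (by rw [Real.dist_eq, sub_zero, abs_of_neg hx]; linarith)
    simp only [h0, sub_zero, smul_eq_mul, Real.norm_eq_abs, abs_of_neg hx] at h3
    nlinarith [(abs_le.1 h3).2, mul_pos (neg_pos.2 hx) h]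
  have hqc := hq.smooth.continuousOn
  constructor
  · intro x hx
    by_contra hlt
    push Not at hlt
    have hxt : t < x := by
      by_contra hle
      push Not at hle
      rcases hx.1.eq_or_lt with rfl | hx0
      · linarith
      · linarith [hpos x hx0 hle]
    obtain ⟨z, hz, hz0⟩ := intermediate_value_Icc' hxt.le
      (hqc.mono (Icc_subset_Icc (by linarith) hx.2)) ⟨hlt.le, (hpos t htpos le_rfl).le⟩
    exact hq.ne_zero z ⟨by linarith [hz.1], hz.2.trans hx.2⟩ (by linarith [hz.1]) hz0
  · intro x hx
    by_contra hlt
    push Not at hlt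
    have hxt : x < -t := by
      by_contra hle
      push Not at hle
      rcases hx.2.eq_or_lt with rfl | hx0
      · linarith
      · linarith [hneg x hx0 hle]
    obtain ⟨z, hz, hz0⟩ := intermediate_value_Icc' hxt.le
      (hqc.mono (Icc_subset_Icc hx.1 (by linarith))) ⟨(hneg (-t) (by linarith) le_rfl).le, hlt.le⟩
    exact hq.ne_zero z ⟨hx.1.trans hz.1, by linarith [hz.2]⟩ (by linarith [hz.2]) hz0

/-- `q` has the sign of `x`, so the Agmon distance is a primitive of the smooth function `q` itself
and serves as the weight with no loss. -/
theorem IsGrushinCoeff.agmonDist_eq (hL : 0 < L) (hγ : 1 ≤ γ) (hq : IsGrushinCoeff L γ q)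
    (h : 0 < deriv q 0) {x : ℝ} (hx : x ∈ Icc (-L) L) : agmonDist q x = ∫ s in (0)..x, q s := by
  obtain ⟨hp, hn⟩ := hq.pos_of_deriv_pos hL hγ h
  rw [agmonDist]
  rcases le_total 0 x with h0 | h0
  · rw [min_eq_left h0, max_eq_right h0]
    refine intervalIntegral.integral_congr fun s hs => ?_
    rw [uIcc_of_le h0] at hs
    exact abs_of_nonneg (hp s ⟨hs.1, hs.2.trans hx.2⟩)
  · rw [min_eq_right h0, max_eq_left h0, intervalIntegral.integral_symm x 0,
      ← intervalIntegral.integral_neg]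
    refine intervalIntegral.integral_congr fun s hs => ?_
    rw [uIcc_of_le h0] at hs
    exact abs_of_nonpos (hn s ⟨hx.1.trans hs.1, hs.2⟩)

theorem agmonDistSet_le (q : ℝ → ℝ) {A : Set ℝ} {x : ℝ} (hx : x ∈ A) :
    agmonDistSet q A ≤ agmonDist q x := by
  refine csInf_le ⟨0, ?_⟩ ⟨x, hx, rfl⟩
  rintro _ ⟨y, -, rfl⟩
  exact intervalIntegral.integral_nonneg (min_le_max) fun s _ => abs_nonneg _

/-- If `q` vanishes to higher order, a weak smooth weight is positive on `ω`. -/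
theorem IsGrushinCoeff.exists_weight (hL : 0 < L) (hq : IsGrushinCoeff L γ q) {ω : Set ℝ}
    (hωL : ω ⊆ Ioo (-L) L) (hω0 : 0 < Metric.infDist 0 ω) :
    ∃ Q : ℝ → ℝ, ∃ d > 0, ContDiffOn ℝ ((⊤ : ℕ∞) : WithTop ℕ∞) Q (Icc (-L) L) ∧
      (∀ x ∈ Icc (-L) L, |Q x| ≤ |q x|) ∧ ∀ x ∈ ω, d ≤ ∫ s in (0)..x, Q s := by
  obtain ⟨Q₁, hQ₁⟩ := isCompact_Icc.exists_bound_of_continuousOn hq.smooth.continuousOn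
  have hQ₁' : ∀ x ∈ Icc (-L) L, |q x| ≤ Q₁ := hQ₁
  have hQ₁0 : 0 ≤ Q₁ := (abs_nonneg _).trans (hQ₁' 0 ⟨by linarith, hL.le⟩)
  set c := 1 / (L * (Q₁ + 1)) with hc
  have hcpos : 0 < c := by positivity
  -- The factor `x` makes the primitive positive on both sides of `0`, even when `q` keeps its sign;
  -- `q ^ 2` keeps `Q` smooth, and `c` ensures `c |x| |q| ≤ 1`.
  set Q : ℝ → ℝ := fun x => c * x * q x ^ 2 with hQdef
  have hQ : ContDiffOn ℝ ((⊤ : ℕ∞) : WithTop ℕ∞) Q (Icc (-L) L) :=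
    (contDiffOn_const.mul contDiffOn_id).mul (hq.smooth.pow 2)
  have hQc := hQ.continuousOn
  have hωa : ∀ x ∈ ω, Metric.infDist 0 ω ≤ |x| := fun x hx => by
    have := Metric.infDist_le_dist_of_mem (x := (0 : ℝ)) hx
    rwa [Real.dist_eq, zero_sub, abs_neg] at this
  set a := min (Metric.infDist 0 ω) L with ha
  have hapos : 0 < a := by positivity
  have haL : a ≤ L := min_le_right _ _
  have hi : ∀ x y, x ∈ Icc (-L) L → y ∈ Icc (-L) L → IntervalIntegrable Q volume x y :=
    fun x y hx hy => (hQc.mono (uIcc_subset_Icc hx hy)).intervalIntegrable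
  have m0 : (0 : ℝ) ∈ Icc (-L) L := ⟨by linarith, hL.le⟩
  have ma : a ∈ Icc (-L) L := ⟨by linarith, haL⟩
  have mna : -a ∈ Icc (-L) L := ⟨by linarith, by linarith⟩
  have hp : 0 < ∫ s in (0)..a, Q s := by
    refine intervalIntegral.intervalIntegral_pos_of_pos_on (hi _ _ m0 ma) (fun s hs => ?_) hapos
    have := hq.ne_zero s ⟨by linarith [hs.1], by linarith [hs.2]⟩ hs.1.ne'
    have := hs.1
    simp only [hQdef]
    positivity
  have hn : 0 < ∫ s in (0)..(-a), Q s := by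
    rw [intervalIntegral.integral_symm, ← intervalIntegral.integral_neg]
    refine intervalIntegral.intervalIntegral_pos_of_pos_on (hi _ _ mna m0).neg (fun s hs => ?_)
      (by linarith)
    have h1 := hq.ne_zero s ⟨by linarith [hs.1], by linarith [hs.2]⟩ hs.2.ne
    have h2 : 0 < c * -s * q s ^ 2 := by
      have : 0 < -s := by linarith [hs.2]
      positivity
    simp only [hQdef]
    linarith
  refine ⟨Q, min (∫ s in (0)..a, Q s) (∫ s in (0)..(-a), Q s), lt_min hp hn, hQ, fun x hx => ?_,
    fun x hx => ?_⟩
  · have h1 := hQ₁' x hx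
    have h2 : |x| ≤ L := abs_le.2 hx
    simp only [hQdef]
    rw [abs_mul, abs_mul, abs_of_pos hcpos, abs_pow, sq, ← mul_assoc]
    refine mul_le_of_le_one_left (abs_nonneg _) ?_
    calc c * |x| * |q x| ≤ c * L * (Q₁ + 1) := by gcongr; linarith
      _ = 1 := by rw [hc]; field_simp
  · have hxL := Ioo_subset_Icc_self (hωL hx)
    have hax : a ≤ |x| := (min_le_left _ _).trans (hωa x hx)
    rcases le_total 0 x with h0 | h0
    · rw [abs_of_nonneg h0] at hax
      refine (min_le_left _ _).trans ?_
      rw [← intervalIntegral.integral_add_adjacent_intervals (hi _ _ m0 ma) (hi _ _ ma hxL)]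
      refine le_add_of_nonneg_right (intervalIntegral.integral_nonneg hax fun s hs => ?_)
      have : 0 ≤ s := by linarith [hs.1]
      simp only [hQdef]
      positivity
    · rw [abs_of_nonpos h0] at hax
      refine (min_le_right _ _).trans ?_
      rw [← intervalIntegral.integral_add_adjacent_intervals (hi _ _ m0 mna) (hi _ _ mna hxL)]
      refine le_add_of_nonneg_right ?_
      rw [intervalIntegral.integral_symm, ← intervalIntegral.integral_neg]
      refine intervalIntegral.integral_nonneg (by linarith) fun s hs => ?_
      have h2 : 0 ≤ c * -s * q s ^ 2 := by
        have : 0 ≤ -s := by linarith [hs.2]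
        positivity
      simp only [hQdef]
      linarith

end Coefficient

end Grushin

theorem mainTheorem3 (L : ℝ) (hL : 0 < L) (Y : Grushin.YDomain) (γ : ℕ) (hγ : 1 ≤ γ)
    (q r V : ℝ → ℝ) (hq : Grushin.IsGrushinCoeff L γ q) (hr : Grushin.IsTransversalCoeff Y r)
    (hV : MemLp V ⊤ (volume.restrict (Ioo (-L) L)))
    (ωx : Set ℝ) (hω_meas : MeasurableSet ωx) (hω_sub : ωx ⊆ Ioo (-L) L)
    (hω_dist : 0 < Metric.infDist 0 ωx) :
    (γ = 1 → ∀ T : ℝ, 0 < T → T < Grushin.agmonDistSet q ωx / deriv q 0 →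
      ∃ f₀ ∈ Grushin.formDomain L Y q r,
        ¬ Grushin.Steerable L Y q r V (ωx ×ˢ Y.carrier) T f₀) ∧
    (1 < γ → ∀ T : ℝ, 0 < T →
      ∃ f₀ ∈ Grushin.formDomain L Y q r,
        ¬ Grushin.Steerable L Y q r V (ωx ×ˢ Y.carrier) T f₀) := by
  constructor
  · rintro rfl T hT hTd
    have hd : 0 < deriv q 0 := by simpa [iteratedDeriv_one] using hq.deriv_pos
    set d := Grushin.agmonDistSet q ωx
    have h1 : deriv q 0 * T < d := by rwa [lt_div_iff₀ hd, mul_comm] at hTd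
    have h2 : deriv q 0 < d / T := by rwa [lt_div_iff₀ hT]
    -- `b` is the midpoint of `q'(0) < d / T`: an admissible slope that still satisfies `b T < d`.
    refine hq.exists_not_steerable (Q := q) (d := d) (b := (deriv q 0 + d / T) / 2) hL hT hγ hr hV
      hω_meas hω_dist hq.smooth (fun x _ => le_rfl) (fun x hx => ?_) hd.le (by linarith) ?_
    · rw [← hq.agmonDist_eq hL hγ hd (Ioo_subset_Icc_self (hω_sub hx))]
      exact Grushin.agmonDistSet_le q hx
    · rw [div_mul_eq_mul_div, add_mul, div_mul_cancel₀ _ hT.ne']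
      linarith
  · intro hγ1 T hT
    have hd : deriv q 0 = 0 := by simpa [iteratedDeriv_one] using hq.deriv_zero 1 hγ1
    obtain ⟨Q, d, hd0, hQ, hQq, hωd⟩ := hq.exists_weight hL hω_sub hω_dist
    -- As `q'(0) = 0`, any positive slope is admissible, so some positive `d` suffices whatever `T`
    -- is, and the true Agmon distance is not needed.
    refine hq.exists_not_steerable (Q := Q) (d := d) (b := d / (2 * T)) hL hT hγ hr hV
      hω_meas hω_dist hQ hQq hωd hd.ge (by rw [hd]; positivity) ?_
    have : d / (2 * T) * T = d / 2 := by field_simp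
    linarith
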